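/- **Setting.** Fix $r$. For all $N,T$ let $z_{it}=\alpha_i+\lambda_i'f_t+e_{it}$ ($1\le i\le N$, $1\le t\le T$), where $\lambda_i,f_t\in\mathbb R^r$ are nonrandom and may depend on $(N,T)$ (so that the normalizations below can hold at every sample size). Put $\Lambda=(\lambda_1,\dots,\lambda_N)'$, $\bar z=\frac1T\sum_t z_t$, $\bar f=\frac1T\sum_t f_t$, $M_{zz}=\frac1T\sum_t(z_t-\bar z)(z_t-\bar z)'$, $M_{ff}=\frac1T\sum_t(f_t-\bar f)(f_t-\bar f)'$ and $\Sigma_{ee}=\mathrm{diag}(\sigma_1^2,\dots,\sigma_N^2)$. All limits are as $N,T\to\infty$ jointly, without restriction on the relative rates. Assume: * (A) $M_{ff}\to\overline M_{ff}$ for some positive definite $\overline M_{ff}$. * (B) The $e_{it}$ are independent over all $i,t$, the vectors $(e_{1t},\dots,e_{Nt})$ are identically distributed over $t$, $E e_{it}=0$, $E(e_te_t')=\Sigma_{ee}$, and $\sup_{i,t}E e_{it}^4<\infty$. * (C) For a constant $C>0$: $\|\lambda_i\|\le C$ and $C^{-2}\le\sigma_i^2\le C^2$ for all $i$; $\frac1N\Lambda'\Sigma_{ee}^{-1}\Lambda\to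 Q$ with $Q$ positive definite; and $\frac1N\sum_{i=1}^N\sigma_i^{-4}(\lambda_i\otimes\lambda_i)(\lambda_i'\otimes\lambda_i')\to\Omega$ with $\Omega$ positive definite on the symmetric tensors (i.e. $\mathrm{vec}(S)'\,\Omega\,\mathrm{vec}(S)>0$ for every symmetric $r\times r$ matrix $S\ne0$). * (D) Estimation is over $\sigma_i^2\in[C^{-2},C^2]$ and positive semidefinite $M_{ff}$ with all entries in $[-C,C]$; the loadings are not bounded. The entries of $\overline M_{ff}$ lie in the open interval $(-C,C)$. One of the following restrictions on $(\Lambda,\Sigma_{ee},M_{ff})$ is imposed on the estimates, and holds for the true parameters for all sufficiently large $N,T$ (here $\Lambda_1$ is the top $r\times r$ block of $\Lambda$): * IC1: $\Lambda_1=I_r$. * IC2: $M_{ff}$ is diagonal with positive, strictly decreasing diagonal elements, and $\frac1N\Lambda'\Sigma_{ee}^{-1}\Lambda=I_r$; the diagonal elements of the limit $\overline M_{ff}$ are distinct. * IC3: $M_{ff}=I_r$, and $\frac1N\Lambda'\Sigma_{ee}^{-1}\Lambda$ is diagonal with positive, strictly decreasing diagonal elements; the diagonal elements of the limit $Q$ are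 distinct. * IC4: $M_{ff}$ is diagonal and $\Lambda_1$ is lower triangular with unit diagonal. * IC5: $M_{ff}=I_r$ and $\Lambda_1$ is lower triangular with nonzero diagonal elements; those of the true $\Lambda_1$ are bounded away from $0$ for all large $N,T$. Let $\hat\theta=(\hat\lambda_1,\dots,\hat\lambda_N,\hat\sigma_1^2,\dots,\hat\sigma_N^2,\hat M_{ff})$ be such that, with probability tending to one, it maximizes $$-\frac1{2N}\ln|\Sigma_{zz}|-\frac1{2N}\operatorname{tr}\bigl(M_{zz}\Sigma_{zz}^{-1}\bigr),\qquad \Sigma_{zz}=\Lambda M_{ff}\Lambda'+\Sigma_{ee},$$ over all $(\Lambda,\Sigma_{ee},M_{ff})$ in the set described in (D) that satisfy the chosen restrictions, and, under IC2, IC3 and IC5, $\hat\Lambda$ has the same column signs as $\Lambda$, that is, $\sum_{i=1}^N\hat\lambda_{ik}\lambda_{ik}\ge0$ for $k=1,\dots,r$. **Proposition.** Under (A)–(D) and any one of IC1–IC5, as $N,T\to\infty$, $$\frac1N\sum_{i=1}^N\frac1{\hat\sigma_i^2}\|\hat\lambda_i-\lambda_i\|^2\xrightarrow{p}0,\qquad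 \frac1N\sum_{i=1}^N(\hat\sigma_i^2-\sigma_i^2)^2\xrightarrow{p}0,\qquad \hat M_{ff}-M_{ff}\xrightarrow{p}0 .$$ -/

import Mathlib

open MeasureTheory ProbabilityTheory Filter Topology Matrix

/-- A parameter value `θ = (Λ, σ₁², …, σ_N², M_ff)` of a factor model with `N` variables and
`r` factors; row `i` of `loading` is `λ_i'`. -/
structure FactorParam (N r : ℕ) where
  /-- the `N × r` matrix `Λ` of loadings -/
  loading : Matrix (Fin N) (Fin r) ℝ
  /-- the idiosyncratic variances `σ_i²` -/
  idioVar : Fin N → ℝ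
  /-- the second moment matrix `M_ff` of the factors -/
  factorCov : Matrix (Fin r) (Fin r) ℝ

/-- The five sets of identifying restrictions. -/
inductive IdentCond
  | ic1
  | ic2
  | ic3
  | ic4
  | ic5

/-- The sample mean `T⁻¹ ∑ₜ xₜ`. -/
noncomputable def sampleMean {n T : ℕ} (x : Fin T → Fin n → ℝ) : Fin n → ℝ :=
  (T : ℝ)⁻¹ • ∑ t, x t

/-- The sample variance `T⁻¹ ∑ₜ (xₜ - x̄)(xₜ - x̄)'`. -/
noncomputable def sampleCov {n T : ℕ} (x : Fin T → Fin n → ℝ) : Matrix (Fin n) (Fin n) ℝ :=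
  (T : ℝ)⁻¹ • ∑ t, vecMulVec (x t - sampleMean x) (x t - sampleMean x)

namespace FactorParam

variable {N r : ℕ}

/-- `Σ_ee = diag(σ₁², …, σ_N²)`. -/
noncomputable def sigmaEE (θ : FactorParam N r) : Matrix (Fin N) (Fin N) ℝ :=
  diagonal θ.idioVar

/-- `Σ_zz = Λ M_ff Λ' + Σ_ee`. -/
noncomputable def sigmaZZ (θ : FactorParam N r) : Matrix (Fin N) (Fin N) ℝ :=
  θ.loading * θ.factorCov * θ.loadingᵀ + θ.sigmaEE

/-- `N⁻¹ Λ' Σ_ee⁻¹ Λ`. -/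
noncomputable def loadingCov (θ : FactorParam N r) : Matrix (Fin r) (Fin r) ℝ :=
  (N : ℝ)⁻¹ • (θ.loadingᵀ * θ.sigmaEE⁻¹ * θ.loading)

/-- The quasi log-likelihood `-(2N)⁻¹ ln|Σ_zz| - (2N)⁻¹ tr(M_zz Σ_zz⁻¹)`. -/
noncomputable def logLik (Mzz : Matrix (Fin N) (Fin N) ℝ) (θ : FactorParam N r) : ℝ :=
  -(1 / (2 * (N : ℝ))) * Real.log θ.sigmaZZ.det
    - (1 / (2 * (N : ℝ))) * (Mzz * θ.sigmaZZ⁻¹).trace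

/-- The identifying restrictions on a parameter value. Rows and columns are numbered from `0`, so
the top `r × r` block of `Λ` consists of the rows `i` with `i < r`. -/
def Restricted (θ : FactorParam N r) : IdentCond → Prop
  | .ic1 => ∀ (i : Fin N) (k : Fin r), (i : ℕ) < r →
      θ.loading i k = if (i : ℕ) = (k : ℕ) then 1 else 0
  | .ic2 => (θ.factorCov.IsDiag ∧ (∀ k, 0 < θ.factorCov k k) ∧
        StrictAnti (fun k => θ.factorCov k k)) ∧
      θ.loadingCov = 1
  | .ic3 => θ.factorCov = 1 ∧
      (θ.loadingCov.IsDiag ∧ (∀ k, 0 < θ.loadingCov k k) ∧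
        StrictAnti (fun k => θ.loadingCov k k))
  | .ic4 => θ.factorCov.IsDiag ∧
      (∀ (i : Fin N) (k : Fin r), (i : ℕ) = (k : ℕ) → θ.loading i k = 1) ∧
      (∀ (i : Fin N) (k : Fin r), (i : ℕ) < (k : ℕ) → θ.loading i k = 0)
  | .ic5 => θ.factorCov = 1 ∧
      (∀ (i : Fin N) (k : Fin r), (i : ℕ) = (k : ℕ) → θ.loading i k ≠ 0) ∧
      (∀ (i : Fin N) (k : Fin r), (i : ℕ) < (k : ℕ) → θ.loading i k = 0)

/-- The set over which the likelihood is maximized: `σ_i² ∈ [C⁻², C²]`, `M_ff` positive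
semidefinite with all its entries in `[-C, C]`, and the identifying restrictions. The loadings
are not bounded. -/
structure Admissible (C : ℝ) (ic : IdentCond) (θ : FactorParam N r) : Prop where
  idioVar_mem : ∀ i, θ.idioVar i ∈ Set.Icc ((C ^ 2)⁻¹) (C ^ 2)
  factorCov_psd : θ.factorCov.PosSemidef
  factorCov_mem : ∀ k l, θ.factorCov k l ∈ Set.Icc (-C) C
  restricted : θ.Restricted ic

/-- `θ` is a maximum likelihood estimate for the sample moment matrix `M_zz`. -/
def IsMLE (C : ℝ) (ic : IdentCond) (Mzz : Matrix (Fin N) (Fin N) ℝ) (θ : FactorParam N r) : Prop :=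
  θ.Admissible C ic ∧ ∀ θ' : FactorParam N r, θ'.Admissible C ic → logLik Mzz θ' ≤ logLik Mzz θ

/-- The columns of the two loading matrices have the same signs: corresponding columns do not
point in opposite directions. -/
def SameColumnSigns (θ θ' : FactorParam N r) : Prop :=
  ∀ k, 0 ≤ ∑ i, θ.loading i k * θ'.loading i k

/-- The sign convention that belongs to the identifying restrictions: under IC2, IC3 and IC5 they
leave the signs of the columns of `Λ` undetermined, so matching signs are demanded there. -/
def SignsMatch (ic : IdentCond) (θ θ' : FactorParam N r) : Prop :=
  match ic with
  | .ic1 => True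
  | .ic2 => θ.SameColumnSigns θ'
  | .ic3 => θ.SameColumnSigns θ'
  | .ic4 => True
  | .ic5 => θ.SameColumnSigns θ'

end FactorParam

/-- The true parameter for sample size `(N, T)`. The loadings `lam N T i` and the factors
`f N T t` may depend on `(N, T)`, since the normalizations (for instance `N⁻¹ Λ' Σ_ee⁻¹ Λ = I`
and `M_ff` diagonal) have to hold at every sample size. -/
noncomputable def trueParam {r : ℕ} (lam f : ℕ → ℕ → ℕ → Fin r → ℝ) (σsq : ℕ → ℝ) (N T : ℕ) :
    FactorParam N r where
  loading := fun i k => lam N T i k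
  idioVar := fun i => σsq i
  factorCov := sampleCov (fun t : Fin T => f N T t)

/-- The sample `z_it = α_i + λ_i' f_t + e_it`, `i < N`, `t < T`. -/
noncomputable def observation {Ω : Type*} {r : ℕ} (α : ℕ → ℝ) (lam f : ℕ → ℕ → ℕ → Fin r → ℝ)
    (e : ℕ → ℕ → Ω → ℝ) (N T : ℕ) (ω : Ω) : Fin T → Fin N → ℝ :=
  fun t i => α i + lam N T i ⬝ᵥ f N T t + e i t ω

/-- The factors are nonrandom, and `M_ff` converges to a positive definite matrix. -/
def AssumptionA {r : ℕ} (f : ℕ → ℕ → ℕ → Fin r → ℝ) (Mbar : Matrix (Fin r) (Fin r) ℝ) : Prop :=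
  Mbar.PosDef ∧
    Tendsto (fun p : ℕ × ℕ => sampleCov (fun t : Fin p.2 => f p.1 p.2 t)) atTop (𝓝 Mbar)

/-- The idiosyncratic errors `e_it` (first index `i`, second index `t`). -/
structure AssumptionB {Ω : Type*} [MeasurableSpace Ω] (μ : Measure Ω) (e : ℕ → ℕ → Ω → ℝ)
    (σsq : ℕ → ℝ) : Prop where
  measurable : ∀ i t, Measurable (e i t)
  mean_zero : ∀ i t, ∫ ω, e i t ω ∂μ = 0
  covariance : ∀ i j t, ∫ ω, e i t ω * e j t ω ∂μ = if i = j then σsq i else 0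
  fourth_moment : ∃ C : ℝ, ∀ i t, Integrable (fun ω => e i t ω ^ 4) μ ∧
    ∫ ω, e i t ω ^ 4 ∂μ ≤ C ^ 4
  indep : iIndepFun (fun p : ℕ × ℕ => e p.1 p.2) μ
  identDistrib : ∀ N t s, IdentDistrib (fun ω (i : Fin N) => e i t ω)
    (fun ω (i : Fin N) => e i s ω) μ μ

/-- The matrix `N⁻¹ ∑ᵢ σ_i⁻⁴ (λ_i ⊗ λ_i)(λ_i' ⊗ λ_i')`, rows and columns indexed by pairs. -/
noncomputable def loadingFourth {N r : ℕ} (θ : FactorParam N r) :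
    Matrix (Fin r × Fin r) (Fin r × Fin r) ℝ :=
  (N : ℝ)⁻¹ • ∑ i, ((θ.idioVar i) ^ 2)⁻¹ •
    vecMulVec (fun a : Fin r × Fin r => θ.loading i a.1 * θ.loading i a.2)
      (fun a : Fin r × Fin r => θ.loading i a.1 * θ.loading i a.2)

/-- Positive definiteness on the symmetric tensors. (The vectors `λ ⊗ λ` are symmetric tensors,
so the limit of `loadingFourth` always vanishes on the antisymmetric ones.) -/
def PosDefOnSymm {r : ℕ} (Om : Matrix (Fin r × Fin r) (Fin r × Fin r) ℝ) : Prop :=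
  ∀ S : Matrix (Fin r) (Fin r) ℝ, S.IsSymm → S ≠ 0 →
    0 < (fun a : Fin r × Fin r => S a.1 a.2) ⬝ᵥ (Om *ᵥ (fun a : Fin r × Fin r => S a.1 a.2))

/-- Loadings and variances are bounded, and their second and fourth moments converge. -/
structure AssumptionC {r : ℕ} (C : ℝ) (lam f : ℕ → ℕ → ℕ → Fin r → ℝ) (σsq : ℕ → ℝ)
    (Q : Matrix (Fin r) (Fin r) ℝ) : Prop where
  const_pos : 0 < C
  loading_bound : ∀ N T i, Real.sqrt (∑ k, lam N T i k ^ 2) ≤ C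
  idioVar_mem : ∀ i, σsq i ∈ Set.Icc ((C ^ 2)⁻¹) (C ^ 2)
  posDef : Q.PosDef
  tendsto : Tendsto (fun p : ℕ × ℕ => (trueParam lam f σsq p.1 p.2).loadingCov) atTop (𝓝 Q)
  tendsto_fourth : ∃ Om : Matrix (Fin r × Fin r) (Fin r × Fin r) ℝ, PosDefOnSymm Om ∧
    Tendsto (fun p : ℕ × ℕ => loadingFourth (trueParam lam f σsq p.1 p.2)) atTop (𝓝 Om)

/-- The true parameters satisfy the identifying restrictions (for all large `N, T`), and the
strict inequalities among them (distinct diagonal elements, nonzero diagonal elements) do not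
degenerate as `N, T → ∞`. -/
def Identified {r : ℕ} (ic : IdentCond) (lam f : ℕ → ℕ → ℕ → Fin r → ℝ) (σsq : ℕ → ℝ)
    (Mbar Q : Matrix (Fin r) (Fin r) ℝ) : Prop :=
  (∀ᶠ p : ℕ × ℕ in atTop, (trueParam lam f σsq p.1 p.2).Restricted ic) ∧
    match ic with
    | .ic1 => True
    | .ic2 => Function.Injective (fun k => Mbar k k)
    | .ic3 => Function.Injective (fun k => Q k k)
    | .ic4 => True
    | .ic5 => ∃ δ : ℝ, 0 < δ ∧ ∀ᶠ p : ℕ × ℕ in atTop, ∀ k : Fin r, δ ≤ |lam p.1 p.2 k k|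

namespace Matrix

section Real

variable {m n : Type*}

theorem PosSemidef.transpose_eq {A : Matrix n n ℝ} (hA : A.PosSemidef) : Aᵀ = A := by
  simpa [conjTranspose_eq_transpose_of_trivial] using hA.isHermitian.eq

variable [Fintype m] [Fintype n]

theorem PosSemidef.transpose_mul_mul {A : Matrix n n ℝ} (hA : A.PosSemidef) (B : Matrix n m ℝ) :
    (Bᵀ * A * B).PosSemidef := by
  simpa [conjTranspose_eq_transpose_of_trivial] using hA.conjTranspose_mul_mul_same B

theorem PosSemidef.mul_mul_transpose {A : Matrix n n ℝ} (hA : A.PosSemidef) (B : Matrix m n ℝ) :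
    (B * A * Bᵀ).PosSemidef := by
  simpa [conjTranspose_eq_transpose_of_trivial] using hA.mul_mul_conjTranspose_same B

open scoped MatrixOrder Matrix.Norms.L2Operator in
theorem PosSemidef.exists_transpose_mul_self [DecidableEq n] {A : Matrix n n ℝ}
    (hA : A.PosSemidef) : ∃ B : Matrix n n ℝ, A = Bᵀ * B := by
  obtain ⟨B, hB⟩ := CStarAlgebra.nonneg_iff_eq_star_mul_self.mp hA.nonneg
  exact ⟨B, by rw [hB, star_eq_conjTranspose, conjTranspose_eq_transpose_of_trivial]⟩

theorem PosSemidef.trace_mul_nonneg [DecidableEq n] {A B : Matrix n n ℝ} (hA : A.PosSemidef)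
    (hB : B.PosSemidef) : 0 ≤ (A * B).trace := by
  obtain ⟨X, rfl⟩ := hA.exists_transpose_mul_self
  rw [Matrix.mul_assoc, trace_mul_comm]
  exact (hB.mul_mul_transpose X).trace_nonneg

theorem PosSemidef.trace_mul_le_of_sub [DecidableEq n] {S A B : Matrix n n ℝ} (hS : S.PosSemidef)
    (hAB : (B - A).PosSemidef) : (S * A).trace ≤ (S * B).trace := by
  have h := hS.trace_mul_nonneg hAB
  rw [Matrix.mul_sub, trace_sub] at h
  linarith

theorem PosSemidef.abs_apply_le_trace [DecidableEq n] {A : Matrix n n ℝ} (hA : A.PosSemidef)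
    (k l : n) : |A k l| ≤ A.trace := by
  obtain ⟨X, hX⟩ := hA.exists_transpose_mul_self
  have hd : ∀ k, A k k ≤ A.trace := fun k =>
    Finset.single_le_sum (f := fun k => A k k) (fun i _ => hA.diag_nonneg) (Finset.mem_univ k)
  have h1 : A k l = ∑ a, X a k * X a l := by rw [hX]; simp [mul_apply]
  have h2 : ∀ k, A k k = ∑ a, X a k ^ 2 := fun k => by rw [hX]; simp [mul_apply, sq]
  have h3 : |A k l| ≤ (A k k + A l l) / 2 := by
    rw [h1, h2, h2, ← Finset.sum_add_distrib, Finset.sum_div]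
    refine (Finset.abs_sum_le_sum_abs _ _).trans (Finset.sum_le_sum fun a _ => ?_)
    rw [abs_le]
    constructor <;> nlinarith [sq_nonneg (X a k + X a l), sq_nonneg (X a k - X a l)]
  linarith [hd k, hd l]

theorem trace_diagonal_mul [DecidableEq n] (d : n → ℝ) (A : Matrix n n ℝ) :
    (diagonal d * A).trace = ∑ i, d i * A i i := by
  simp [trace, diagonal_mul]

theorem trace_mul_diagonal [DecidableEq n] (d : n → ℝ) (A : Matrix n n ℝ) :
    (A * diagonal d).trace = ∑ i, A i i * d i := by
  simp [trace, mul_diagonal]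

/-- The trace of a matrix product as a double sum. -/
theorem abs_trace_mul_le (A B : Matrix n n ℝ) :
    |(A * B).trace| ≤ √(∑ i, ∑ j, A i j ^ 2) * √(∑ i, ∑ j, B i j ^ 2) := by
  have h : (A * B).trace = ∑ p : n × n, A p.1 p.2 * B p.2 p.1 := by
    simp [trace, mul_apply, Fintype.sum_prod_type]
  have hA : ∑ i, ∑ j, A i j ^ 2 = ∑ p : n × n, A p.1 p.2 ^ 2 := by
    simp [Fintype.sum_prod_type]
  have hB : ∑ i, ∑ j, B i j ^ 2 = ∑ p : n × n, B p.2 p.1 ^ 2 := by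
    rw [Finset.sum_comm]; simp [Fintype.sum_prod_type]
  rw [h, hA, hB, ← Real.sqrt_mul (Finset.sum_nonneg fun _ _ => sq_nonneg _), ]
  exact Real.abs_le_sqrt (Finset.sum_mul_sq_le_sq_mul_sq _ _ _)

theorem one_le_det_one_add [DecidableEq n] {A : Matrix n n ℝ} (hA : A.PosSemidef) :
    1 ≤ (1 + A).det := by
  have h1 : (1 + A).IsHermitian := (PosSemidef.one.add hA).isHermitian
  rw [h1.det_eq_prod_eigenvalues]
  have : ∀ i, 1 ≤ h1.eigenvalues i := by
    intro i
    have hv := h1.mulVec_eigenvectorBasis i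
    set v : n → ℝ := ⇑(h1.eigenvectorBasis i) with hvdef
    have hnv : v ⬝ᵥ v = 1 := by
      have := h1.eigenvectorBasis.orthonormal.1 i
      have h2 := EuclideanSpace.real_norm_sq_eq (h1.eigenvectorBasis i)
      rw [this] at h2
      simpa [dotProduct, sq, hvdef] using h2.symm
    have h3 := hA.dotProduct_mulVec_nonneg v
    have h4 : v ⬝ᵥ ((1 + A) *ᵥ v) = h1.eigenvalues i := by
      rw [hv, dotProduct_smul, hnv]; simp
    rw [add_mulVec, one_mulVec, dotProduct_add, hnv] at h4
    simp only [star_trivial] at h3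
    linarith
  calc (1 : ℝ) = ∏ i : n, 1 := by simp
    _ ≤ ∏ i, h1.eigenvalues i := Finset.prod_le_prod (fun _ _ => zero_le_one) fun i _ => this i

end Real

end Matrix

namespace FactorParam

variable {N r : ℕ} (θ : FactorParam N r)

/-- The unnormalized matrix `Λ' Σ_ee⁻¹ Λ`. -/
noncomputable def gram : Matrix (Fin r) (Fin r) ℝ := θ.loadingᵀ * θ.sigmaEE⁻¹ * θ.loading

/-- The matrix `Λ' Σ_zz⁻¹ Λ`. -/
noncomputable def modelGram : Matrix (Fin r) (Fin r) ℝ := θ.loadingᵀ * θ.sigmaZZ⁻¹ * θ.loading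

/-- The generalized least squares matrix `(Λ' Σ_ee⁻¹ Λ)⁻¹ Λ' Σ_ee⁻¹`. -/
noncomputable def gls : Matrix (Fin r) (Fin N) ℝ := θ.gram⁻¹ * θ.loadingᵀ * θ.sigmaEE⁻¹

variable {θ}

theorem sigmaEE_inv (hd : ∀ i, 0 < θ.idioVar i) :
    θ.sigmaEE⁻¹ = diagonal fun i => (θ.idioVar i)⁻¹ := by
  refine inv_eq_right_inv ?_
  rw [sigmaEE, diagonal_mul_diagonal, ← diagonal_one]
  congr 1
  ext i
  exact mul_inv_cancel₀ (hd i).ne'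

theorem posDef_sigmaEE (hd : ∀ i, 0 < θ.idioVar i) : θ.sigmaEE.PosDef :=
  PosDef.diagonal hd

theorem posDef_sigmaZZ (hd : ∀ i, 0 < θ.idioVar i) (hM : θ.factorCov.PosSemidef) :
    θ.sigmaZZ.PosDef :=
  (posDef_sigmaEE hd).posSemidef_add (hM.mul_mul_transpose θ.loading)

theorem gram_posSemidef (hd : ∀ i, 0 < θ.idioVar i) : θ.gram.PosSemidef :=
  (posDef_sigmaEE hd).inv.posSemidef.transpose_mul_mul θ.loading

theorem modelGram_posSemidef (hd : ∀ i, 0 < θ.idioVar i) (hM : θ.factorCov.PosSemidef) :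
    θ.modelGram.PosSemidef :=
  (posDef_sigmaZZ hd hM).inv.posSemidef.transpose_mul_mul θ.loading

theorem loadingCov_eq : θ.loadingCov = (N : ℝ)⁻¹ • θ.gram := rfl

theorem det_sigmaZZ (hd : ∀ i, 0 < θ.idioVar i) :
    θ.sigmaZZ.det = (∏ i, θ.idioVar i) * (1 + θ.factorCov * θ.gram).det := by
  have hu : IsUnit θ.sigmaEE.det := (isUnit_iff_isUnit_det _).1 (posDef_sigmaEE hd).isUnit
  have h1 : θ.sigmaZZ =
      θ.sigmaEE * (1 + (θ.sigmaEE⁻¹ * θ.loading) * (θ.factorCov * θ.loadingᵀ)) := by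
    rw [Matrix.mul_add, Matrix.mul_one, sigmaZZ, add_comm, ← Matrix.mul_assoc, ← Matrix.mul_assoc,
      ← Matrix.mul_assoc, mul_nonsing_inv _ hu, Matrix.one_mul]
  rw [h1, det_mul, det_one_add_mul_comm, sigmaEE, det_diagonal, gram]
  simp only [Matrix.mul_assoc, sigmaEE]

theorem prod_le_det_sigmaZZ (hd : ∀ i, 0 < θ.idioVar i) (hM : θ.factorCov.PosSemidef) :
    ∏ i, θ.idioVar i ≤ θ.sigmaZZ.det := by
  obtain ⟨B, hB⟩ := hM.exists_transpose_mul_self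
  rw [det_sigmaZZ hd]
  have h : (1 + θ.factorCov * θ.gram).det = (1 + B * θ.gram * Bᵀ).det := by
    rw [hB, Matrix.mul_assoc, det_one_add_mul_comm]
  have := one_le_det_one_add ((gram_posSemidef hd).mul_mul_transpose B)
  rw [h]
  exact le_mul_of_one_le_right (Finset.prod_nonneg fun i _ => (hd i).le) this

/-- The push-through identity. -/
theorem modelGram_mul (hd : ∀ i, 0 < θ.idioVar i) (hM : θ.factorCov.PosSemidef) :
    θ.modelGram * (1 + θ.factorCov * θ.gram) = θ.gram := by
  have hu : IsUnit θ.sigmaEE.det := (isUnit_iff_isUnit_det _).1 (posDef_sigmaEE hd).isUnit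
  have hz : IsUnit θ.sigmaZZ.det := (isUnit_iff_isUnit_det _).1 (posDef_sigmaZZ hd hM).isUnit
  have h1 : θ.loading * (1 + θ.factorCov * θ.gram) = θ.sigmaZZ * (θ.sigmaEE⁻¹ * θ.loading) := by
    rw [sigmaZZ, gram, Matrix.add_mul, Matrix.mul_add, ← Matrix.mul_assoc θ.sigmaEE,
      mul_nonsing_inv _ hu]
    simp only [Matrix.mul_assoc, Matrix.mul_one, Matrix.one_mul]
    rw [add_comm]
  rw [modelGram, Matrix.mul_assoc, h1, ← Matrix.mul_assoc, Matrix.mul_assoc _ θ.sigmaZZ⁻¹,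
    nonsing_inv_mul _ hz, Matrix.mul_one, gram, Matrix.mul_assoc]

end FactorParam

namespace FactorParam

variable {N r : ℕ} {θ : FactorParam N r}

/-- The difference `Σ_ee⁻¹ - Σ_zz⁻¹` is positive semidefinite, and, relative to `Σ_ee`, its trace
and its squared Frobenius norm are at most the number of factors. -/
theorem precision_gap (hd : ∀ i, 0 < θ.idioVar i) (hM : θ.factorCov.PosSemidef) :
    (θ.sigmaEE⁻¹ - θ.sigmaZZ⁻¹).PosSemidef ∧
      ((θ.sigmaEE⁻¹ - θ.sigmaZZ⁻¹) * θ.sigmaEE).trace ≤ r ∧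
      ((θ.sigmaEE⁻¹ - θ.sigmaZZ⁻¹) * θ.sigmaEE * ((θ.sigmaEE⁻¹ - θ.sigmaZZ⁻¹) * θ.sigmaEE)).trace
        ≤ r := by
  obtain ⟨B, hB⟩ := hM.exists_transpose_mul_self
  set L : Matrix (Fin N) (Fin r) ℝ := θ.loading * Bᵀ with hL
  set D := θ.sigmaEE with hD
  have hDpd : D.PosDef := posDef_sigmaEE hd
  have hu : IsUnit D.det := (isUnit_iff_isUnit_det _).1 hDpd.isUnit
  set K : Matrix (Fin r) (Fin r) ℝ := Lᵀ * D⁻¹ * L with hK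
  have hKpsd : K.PosSemidef := hDpd.inv.posSemidef.transpose_mul_mul L
  have h1K : (1 + K).PosDef := PosDef.one.add_posSemidef hKpsd
  have h1Ku : IsUnit (1 + K).det := (isUnit_iff_isUnit_det _).1 h1K.isUnit
  set G := (1 + K)⁻¹ with hG
  have hGpsd : G.PosSemidef := h1K.inv.posSemidef
  have hGK : G * K = 1 - G := by
    have : G * (1 + K) = 1 := nonsing_inv_mul _ h1Ku
    rw [Matrix.mul_add, Matrix.mul_one] at this
    exact eq_sub_of_add_eq' this
  have hS : θ.sigmaZZ = D + L * (1 : Matrix (Fin r) (Fin r) ℝ) * Lᵀ := by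
    rw [sigmaZZ, hB, hL, transpose_mul, transpose_transpose, add_comm]
    simp only [Matrix.mul_assoc, Matrix.mul_one]
    rfl
  have hgap : D⁻¹ - θ.sigmaZZ⁻¹ = D⁻¹ * L * G * Lᵀ * D⁻¹ := by
    rw [hS, add_mul_mul_inv_eq_sub _ _ _ _ hDpd.isUnit isUnit_one (by simpa using h1K.isUnit)]
    simp [hG, hK]
  have hDt : (D⁻¹)ᵀ = D⁻¹ := hDpd.inv.posSemidef.transpose_eq
  have hgD : (D⁻¹ - θ.sigmaZZ⁻¹) * D = D⁻¹ * L * G * Lᵀ := by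
    rw [hgap, Matrix.mul_assoc _ D⁻¹ D, nonsing_inv_mul _ hu, Matrix.mul_one]
  have htr : (D⁻¹ * L * G * Lᵀ).trace = r - G.trace := by
    rw [trace_mul_comm, ← Matrix.mul_assoc, ← Matrix.mul_assoc, ← hK, trace_mul_comm, hGK,
      trace_sub]
    simp
  refine ⟨?_, ?_, ?_⟩
  · have := (hGpsd.mul_mul_transpose (D⁻¹ * L))
    rw [transpose_mul, hDt] at this
    rw [hgap]
    simpa only [Matrix.mul_assoc] using this
  · rw [hgD, htr]
    linarith [hGpsd.trace_nonneg]
  · rw [hgD]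
    have h2 : (D⁻¹ * L * G * Lᵀ * (D⁻¹ * L * G * Lᵀ)).trace = ((1 - G) * (1 - G)).trace := by
      have : D⁻¹ * L * G * Lᵀ * (D⁻¹ * L * G * Lᵀ) = (D⁻¹ * L) * (G * K * G * Lᵀ) := by
        simp only [hK, Matrix.mul_assoc]
      rw [this, trace_mul_comm, ← hGK]
      simp only [hK, Matrix.mul_assoc]
    have h3 : (1 - G) * (1 - G) = 1 - G - G * K * G := by
      rw [hGK]; noncomm_ring
    have h4 : (G * K * G).PosSemidef := by
      have := hKpsd.mul_mul_transpose G
      rwa [hGpsd.transpose_eq] at this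
    rw [h2, h3, trace_sub, trace_sub]
    simp only [trace_one, Fintype.card_fin]
    linarith [hGpsd.trace_nonneg, h4.trace_nonneg]

theorem sum_sq_precision_gap_le {c : ℝ} (hc : 0 < c) (hd : ∀ i, c⁻¹ ≤ θ.idioVar i)
    (hM : θ.factorCov.PosSemidef) :
    ∑ i, ∑ j, (θ.sigmaEE⁻¹ - θ.sigmaZZ⁻¹) i j ^ 2 ≤ c ^ 2 * r := by
  have hd' : ∀ i, 0 < θ.idioVar i := fun i => (inv_pos.2 hc).trans_le (hd i)
  obtain ⟨h1, -, h3⟩ := precision_gap hd' hM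
  set P := θ.sigmaEE⁻¹ - θ.sigmaZZ⁻¹ with hP
  have hsym : ∀ i j, P j i = P i j := fun i j => congrFun (congrFun h1.transpose_eq i) j
  have h4 : (P * θ.sigmaEE * (P * θ.sigmaEE)).trace =
      ∑ i, ∑ j, P i j ^ 2 * (θ.idioVar i * θ.idioVar j) := by
    refine Finset.sum_congr rfl fun i _ => ?_
    rw [diag_apply, mul_apply]
    refine Finset.sum_congr rfl fun j _ => ?_
    rw [sigmaEE, mul_diagonal, mul_diagonal, hsym i j]
    ring
  rw [h4] at h3
  refine le_trans ?_ (mul_le_mul_of_nonneg_left h3 (sq_nonneg c))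
  rw [Finset.mul_sum]
  refine Finset.sum_le_sum fun i _ => ?_
  rw [Finset.mul_sum]
  refine Finset.sum_le_sum fun j _ => ?_
  have hi : 1 ≤ c * θ.idioVar i := by
    have := mul_le_mul_of_nonneg_left (hd i) hc.le; rwa [mul_inv_cancel₀ hc.ne'] at this
  have hj : 1 ≤ c * θ.idioVar j := by
    have := mul_le_mul_of_nonneg_left (hd j) hc.le; rwa [mul_inv_cancel₀ hc.ne'] at this
  have := mul_le_mul_of_nonneg_left (one_le_mul_of_one_le_of_one_le hi hj) (sq_nonneg (P i j))
  calc P i j ^ 2 = P i j ^ 2 * 1 := by ring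
    _ ≤ _ := this
    _ = _ := by ring

theorem abs_trace_mul_inv_le {c : ℝ} (hc : 0 < c) (hd : ∀ i, c⁻¹ ≤ θ.idioVar i)
    (hM : θ.factorCov.PosSemidef) (W : Matrix (Fin N) (Fin N) ℝ) :
    |(W * θ.sigmaZZ⁻¹).trace| ≤ c * ∑ i, |W i i| + √(∑ i, ∑ j, W i j ^ 2) * (c * √r) := by
  have hd' : ∀ i, 0 < θ.idioVar i := fun i => (inv_pos.2 hc).trans_le (hd i)
  have h1 : (W * θ.sigmaZZ⁻¹).trace =
      ∑ i, W i i * (θ.idioVar i)⁻¹ - (W * (θ.sigmaEE⁻¹ - θ.sigmaZZ⁻¹)).trace := by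
    rw [Matrix.mul_sub, trace_sub, sigmaEE_inv hd', trace_mul_diagonal]; ring
  have h2 : |∑ i, W i i * (θ.idioVar i)⁻¹| ≤ c * ∑ i, |W i i| := by
    rw [Finset.mul_sum]
    refine (Finset.abs_sum_le_sum_abs _ _).trans (Finset.sum_le_sum fun i _ => ?_)
    rw [abs_mul, abs_of_pos (inv_pos.2 (hd' i)), mul_comm]
    exact mul_le_mul_of_nonneg_right (inv_le_of_inv_le₀ hc (hd i)) (abs_nonneg _)
  have h3 := abs_trace_mul_le W (θ.sigmaEE⁻¹ - θ.sigmaZZ⁻¹)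
  have h4 : √(∑ i, ∑ j, (θ.sigmaEE⁻¹ - θ.sigmaZZ⁻¹) i j ^ 2) ≤ c * √r := by
    refine (Real.sqrt_le_sqrt (sum_sq_precision_gap_le hc hd hM)).trans_eq ?_
    rw [Real.sqrt_mul (sq_nonneg c), Real.sqrt_sq hc.le]
  rw [h1]
  refine (abs_sub _ _).trans (add_le_add h2 (h3.trans ?_))
  exact mul_le_mul_of_nonneg_left h4 (Real.sqrt_nonneg _)

theorem le_trace_diagonal_mul_inv {c : ℝ} (hc : 0 < c) (hd : ∀ i, c⁻¹ ≤ θ.idioVar i)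
    (hM : θ.factorCov.PosSemidef) {v : Fin N → ℝ} (hv : ∀ i, v i ≤ c) :
    ∑ i, v i / θ.idioVar i - c ^ 2 * r ≤ (diagonal v * θ.sigmaZZ⁻¹).trace := by
  have hd' : ∀ i, 0 < θ.idioVar i := fun i => (inv_pos.2 hc).trans_le (hd i)
  obtain ⟨h1, h2, -⟩ := precision_gap hd' hM
  set P := θ.sigmaEE⁻¹ - θ.sigmaZZ⁻¹ with hP
  have h3 : (diagonal v * θ.sigmaZZ⁻¹).trace = ∑ i, v i / θ.idioVar i - ∑ i, v i * P i i := by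
    have : θ.sigmaZZ⁻¹ = θ.sigmaEE⁻¹ - P := by rw [hP]; abel
    rw [this, Matrix.mul_sub, trace_sub, trace_diagonal_mul, trace_diagonal_mul, sigmaEE_inv hd']
    simp [div_eq_mul_inv]
  have h4 : ∑ i, v i * P i i ≤ c ^ 2 * ∑ i, P i i * θ.idioVar i := by
    rw [Finset.mul_sum]
    refine Finset.sum_le_sum fun i _ => ?_
    have hPi : 0 ≤ P i i := h1.diag_nonneg
    have hi : 1 ≤ c * θ.idioVar i := by
      have := mul_le_mul_of_nonneg_left (hd i) hc.le; rwa [mul_inv_cancel₀ hc.ne'] at this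
    calc v i * P i i ≤ c * P i i := mul_le_mul_of_nonneg_right (hv i) hPi
      _ ≤ c * P i i * (c * θ.idioVar i) := le_mul_of_one_le_right (by positivity) hi
      _ = _ := by ring
  rw [sigmaEE, trace_mul_diagonal] at h2
  have h5 := mul_le_mul_of_nonneg_left h2 (sq_nonneg c)
  rw [h3]
  linarith

/-- Decomposition of `Σ_zz⁻¹` into the least squares residual form and the factor part. -/
theorem sigmaZZ_inv_eq (hd : ∀ i, 0 < θ.idioVar i) (hM : θ.factorCov.PosSemidef)
    (hK : IsUnit θ.gram.det) :
    θ.sigmaZZ⁻¹ = (1 - θ.loading * θ.gls)ᵀ * θ.sigmaEE⁻¹ * (1 - θ.loading * θ.gls) +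
      θ.glsᵀ * θ.modelGram * θ.gls := by
  have hu : IsUnit θ.sigmaEE.det := (isUnit_iff_isUnit_det _).1 (posDef_sigmaEE hd).isUnit
  have hDt : (θ.sigmaEE⁻¹)ᵀ = θ.sigmaEE⁻¹ := (posDef_sigmaEE hd).inv.posSemidef.transpose_eq
  have hKt : (θ.gram⁻¹)ᵀ = θ.gram⁻¹ := (gram_posSemidef hd).inv.transpose_eq
  have hglsT : θ.glsᵀ = θ.sigmaEE⁻¹ * θ.loading * θ.gram⁻¹ := by
    rw [gls, transpose_mul, transpose_mul, hDt, hKt, transpose_transpose, Matrix.mul_assoc]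
  have hgl : θ.gls * θ.loading = 1 := by
    have : θ.gls * θ.loading = θ.gram⁻¹ * θ.gram := by simp only [gls, gram, Matrix.mul_assoc]
    rw [this, nonsing_inv_mul _ hK]
  have hLD : θ.loadingᵀ * θ.sigmaEE⁻¹ = θ.gram * θ.gls := by
    rw [gls, ← Matrix.mul_assoc, ← Matrix.mul_assoc, mul_nonsing_inv _ hK, Matrix.one_mul]
  have hres : (1 - θ.loading * θ.gls)ᵀ * θ.sigmaEE⁻¹ * (1 - θ.loading * θ.gls) =
      θ.sigmaEE⁻¹ * (1 - θ.loading * θ.gls) := by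
    rw [transpose_sub, transpose_one, transpose_mul, Matrix.sub_mul, Matrix.one_mul,
      Matrix.mul_assoc, hLD, Matrix.sub_mul]
    have : θ.glsᵀ * (θ.gram * θ.gls) * (1 - θ.loading * θ.gls) = 0 := by
      rw [Matrix.mul_sub, Matrix.mul_one]
      have : θ.glsᵀ * (θ.gram * θ.gls) * (θ.loading * θ.gls) =
          θ.glsᵀ * (θ.gram * (θ.gls * θ.loading * θ.gls)) := by simp only [Matrix.mul_assoc]
      rw [this, hgl, Matrix.one_mul, sub_self]
    rw [this, sub_zero]
  have hH : (1 + θ.factorCov * θ.gram) * θ.gram⁻¹ * θ.modelGram = 1 := by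
    have h := modelGram_mul hd hM
    have h' : θ.modelGram * ((1 + θ.factorCov * θ.gram) * θ.gram⁻¹) = 1 := by
      rw [← Matrix.mul_assoc, h, mul_nonsing_inv _ hK]
    exact mul_eq_one_comm.1 h'
  refine inv_eq_right_inv ?_
  have h1 : θ.sigmaZZ * (θ.sigmaEE⁻¹ * (1 - θ.loading * θ.gls)) = 1 - θ.loading * θ.gls := by
    rw [sigmaZZ, Matrix.add_mul, ← Matrix.mul_assoc θ.sigmaEE, mul_nonsing_inv _ hu, Matrix.one_mul]
    have : θ.loading * θ.factorCov * θ.loadingᵀ * (θ.sigmaEE⁻¹ * (1 - θ.loading * θ.gls)) =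
        θ.loading * θ.factorCov * (θ.gram * θ.gls - θ.gram * (θ.gls * θ.loading) * θ.gls) := by
      rw [Matrix.mul_assoc _ θ.loadingᵀ, ← Matrix.mul_assoc θ.loadingᵀ, hLD, Matrix.mul_sub,
        Matrix.mul_one]
      simp only [Matrix.mul_assoc]
    rw [this, hgl, Matrix.mul_one, sub_self, Matrix.mul_zero, zero_add]
  have h2 : θ.sigmaZZ * (θ.glsᵀ * θ.modelGram * θ.gls) = θ.loading * θ.gls := by
    have h3 : θ.sigmaZZ * (θ.sigmaEE⁻¹ * θ.loading) = θ.loading * (1 + θ.factorCov * θ.gram) := by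
      rw [sigmaZZ, gram, Matrix.add_mul, Matrix.mul_add, ← Matrix.mul_assoc θ.sigmaEE,
        mul_nonsing_inv _ hu]
      simp only [Matrix.mul_assoc, Matrix.mul_one, Matrix.one_mul]
      rw [add_comm]
    calc θ.sigmaZZ * (θ.glsᵀ * θ.modelGram * θ.gls)
        = θ.sigmaZZ * (θ.sigmaEE⁻¹ * θ.loading) * (θ.gram⁻¹ * θ.modelGram * θ.gls) := by
          rw [hglsT]; simp only [Matrix.mul_assoc]
      _ = θ.loading * ((1 + θ.factorCov * θ.gram) * θ.gram⁻¹ * θ.modelGram) * θ.gls := by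
          rw [h3]; simp only [Matrix.mul_assoc]
      _ = _ := by rw [hH, Matrix.mul_one]
  rw [hres, Matrix.mul_add, h1, h2, sub_add_cancel]

/-- Predicting the factors linearly by any `B` cannot beat the quadratic form of `Σ_zz⁻¹`. -/
theorem trace_mul_inv_le (hd : ∀ i, 0 < θ.idioVar i) (hM : θ.factorCov.PosDef)
    {S : Matrix (Fin N) (Fin N) ℝ} (hS : S.PosSemidef) (B : Matrix (Fin r) (Fin N) ℝ) :
    (S * θ.sigmaZZ⁻¹).trace ≤
      (S * ((1 - θ.loading * B)ᵀ * θ.sigmaEE⁻¹ * (1 - θ.loading * B))).trace +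
        (θ.factorCov⁻¹ * (B * S * Bᵀ)).trace := by
  have hDpd := posDef_sigmaEE hd
  have hDt : (θ.sigmaEE⁻¹)ᵀ = θ.sigmaEE⁻¹ := hDpd.inv.posSemidef.transpose_eq
  set F := θ.factorCov⁻¹ + θ.gram with hF
  have hFpd : F.PosDef := hM.inv.add_posSemidef (gram_posSemidef hd)
  have hFu : IsUnit F.det := (isUnit_iff_isUnit_det _).1 hFpd.isUnit
  have hFt : Fᵀ = F := hFpd.posSemidef.transpose_eq
  have hFit : (F⁻¹)ᵀ = F⁻¹ := hFpd.inv.posSemidef.transpose_eq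
  set E := θ.loadingᵀ * θ.sigmaEE⁻¹ with hE
  have hEt : Eᵀ = θ.sigmaEE⁻¹ * θ.loading := by rw [hE, transpose_mul, hDt, transpose_transpose]
  have hinv : θ.sigmaZZ⁻¹ = θ.sigmaEE⁻¹ - Eᵀ * F⁻¹ * E := by
    rw [sigmaZZ, add_comm, add_mul_mul_inv_eq_sub _ _ _ _ hDpd.isUnit hM.isUnit hFpd.isUnit, hEt]
    simp only [hE, hF, gram, Matrix.mul_assoc]
  have hEL : E * θ.loading = θ.gram := rfl
  have hsq : (B - F⁻¹ * E)ᵀ * F * (B - F⁻¹ * E) =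
      Bᵀ * F * B - Bᵀ * E - Eᵀ * B + Eᵀ * F⁻¹ * E := by
    rw [transpose_sub, transpose_mul, hFit, Matrix.sub_mul, Matrix.sub_mul, Matrix.mul_sub,
      Matrix.mul_sub]
    have h1 : Bᵀ * F * (F⁻¹ * E) = Bᵀ * E := by
      rw [Matrix.mul_assoc, ← Matrix.mul_assoc F, mul_nonsing_inv _ hFu, Matrix.one_mul]
    have h2 : Eᵀ * F⁻¹ * F = Eᵀ := by
      rw [Matrix.mul_assoc, nonsing_inv_mul _ hFu, Matrix.mul_one]
    rw [h1, h2, Matrix.mul_assoc Eᵀ]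
    abel
  have hpsd := hFpd.posSemidef.transpose_mul_mul (B - F⁻¹ * E)
  have hid : (1 - θ.loading * B)ᵀ * θ.sigmaEE⁻¹ * (1 - θ.loading * B) + Bᵀ * θ.factorCov⁻¹ * B
      - θ.sigmaZZ⁻¹ = (B - F⁻¹ * E)ᵀ * F * (B - F⁻¹ * E) := by
    rw [hsq, hinv, hF, Matrix.mul_add, Matrix.add_mul, transpose_sub, transpose_one, transpose_mul,
      Matrix.sub_mul, Matrix.sub_mul, Matrix.mul_sub, Matrix.mul_sub, hEt, ← hEL]
    simp only [hE, Matrix.mul_assoc, Matrix.one_mul, Matrix.mul_one]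
    abel
  have h := hS.trace_mul_le_of_sub (A := θ.sigmaZZ⁻¹) (hid ▸ hpsd)
  rw [Matrix.mul_add, trace_add] at h
  have h2 : (S * (Bᵀ * θ.factorCov⁻¹ * B)).trace = (θ.factorCov⁻¹ * (B * S * Bᵀ)).trace := by
    have e1 : S * (Bᵀ * θ.factorCov⁻¹ * B) = (S * Bᵀ) * (θ.factorCov⁻¹ * B) := by
      simp only [Matrix.mul_assoc]
    rw [e1, trace_mul_comm]
    simp only [Matrix.mul_assoc]
  rwa [h2] at h

end FactorParam

section Scalar

theorem sq_sub_one_div_le_sub_one_sub_log {x : ℝ} (hx : 0 < x) :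
    (x - 1) ^ 2 / (2 * (x + 1)) ≤ x - 1 - Real.log x := by
  have hs : 0 < √x := Real.sqrt_pos.2 hx
  have hxs : √x ^ 2 = x := Real.sq_sqrt hx.le
  have h1 : Real.log x = 2 * Real.log √x := by rw [Real.log_sqrt hx.le]; ring
  have h2 : Real.log √x ≤ √x - 1 := Real.log_le_sub_one_of_pos hs
  have h3 : (√x - 1) ^ 2 ≤ x - 1 - Real.log x := by rw [h1]; nlinarith
  refine le_trans ?_ h3
  rw [div_le_iff₀ (by positivity)]
  set s := √x
  rw [← hxs]
  have : (s ^ 2 - 1) ^ 2 = (s - 1) ^ 2 * (s + 1) ^ 2 := by ring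
  rw [this]
  refine mul_le_mul_of_nonneg_left ?_ (sq_nonneg _)
  nlinarith [sq_nonneg (s - 1)]

theorem sub_one_sub_log_nonneg {x : ℝ} (hx : 0 < x) : 0 ≤ x - 1 - Real.log x := by
  linarith [Real.log_le_sub_one_of_pos hx]

theorem sq_sub_one_le_of_sub_one_sub_log_le {x ε : ℝ} (hx : 0 < x) (hε : ε ≤ 1)
    (h : x - 1 - Real.log x ≤ ε) : (x - 1) ^ 2 ≤ 12 * ε := by
  have hx4 : x ≤ 5 := by
    have h1 : Real.log x = Real.log (x / 2) + Real.log 2 := by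
      rw [← Real.log_mul (by positivity) (by norm_num)]; congr 1; ring
    have h2 : Real.log (x / 2) ≤ x / 2 - 1 := Real.log_le_sub_one_of_pos (by positivity)
    have h3 := Real.log_two_lt_d9
    linarith
  have h4 := (sq_sub_one_div_le_sub_one_sub_log hx).trans h
  rw [div_le_iff₀ (by positivity)] at h4
  have hε0 : 0 ≤ ε := (sub_one_sub_log_nonneg hx).trans h
  nlinarith

end Scalar

namespace Matrix

variable {n : Type*} [Fintype n]

theorem PosDef.trace_sub_log_det [DecidableEq n] {X : Matrix n n ℝ} (hX : X.PosDef) :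
    X.trace - Real.log X.det - Fintype.card n =
      ∑ i, (hX.isHermitian.eigenvalues i - 1 - Real.log (hX.isHermitian.eigenvalues i)) := by
  have h1 := hX.isHermitian.trace_eq_sum_eigenvalues
  have h2 := hX.isHermitian.det_eq_prod_eigenvalues
  simp only [RCLike.ofReal_real_eq_id, id_eq] at h1 h2
  rw [h1, h2, Real.log_prod (fun i _ => (hX.eigenvalues_pos i).ne')]
  simp [Finset.sum_sub_distrib]
  ring

theorem PosDef.trace_sub_log_det_nonneg [DecidableEq n] {X : Matrix n n ℝ} (hX : X.PosDef) :
    0 ≤ X.trace - Real.log X.det - Fintype.card n := by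
  rw [hX.trace_sub_log_det]
  exact Finset.sum_nonneg fun i _ => sub_one_sub_log_nonneg (hX.eigenvalues_pos i)

theorem IsHermitian.abs_sub_one_apply_le [DecidableEq n] {X : Matrix n n ℝ}
    (hX : X.IsHermitian) {b : ℝ}
    (hb : ∀ i, |hX.eigenvalues i - 1| ≤ b) (k l : n) : |(X - 1) k l| ≤ b := by
  set U : Matrix n n ℝ := (hX.eigenvectorUnitary : Matrix n n ℝ) with hU
  have hUU : U * Uᵀ = 1 := by
    have := Unitary.coe_mul_star_self hX.eigenvectorUnitary
    rwa [Unitary.coe_star, star_eq_conjTranspose, conjTranspose_eq_transpose_of_trivial] at this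
  have hspec : X = U * diagonal hX.eigenvalues * Uᵀ := by
    have := hX.spectral_theorem
    rw [Unitary.conjStarAlgAut_apply] at this
    rw [star_eq_conjTranspose, conjTranspose_eq_transpose_of_trivial] at this
    exact this
  have h1 : X - 1 = U * diagonal (fun i => hX.eigenvalues i - 1) * Uᵀ := by
    have : (diagonal fun i => hX.eigenvalues i - 1) = diagonal hX.eigenvalues - 1 := by
      rw [← diagonal_one, diagonal_sub]
    rw [this, Matrix.mul_sub, Matrix.sub_mul, ← hspec, Matrix.mul_one, hUU]
  have h2 : ∀ a c, (U * Uᵀ) a c = ∑ j, U a j * U c j := fun a c => by simp [mul_apply]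
  have h3 : ∀ a, ∑ j, U a j ^ 2 = 1 := fun a => by
    have := h2 a a
    rw [hUU, one_apply_eq] at this
    rw [this]; exact Finset.sum_congr rfl fun j _ => sq _
  rw [h1, mul_apply]
  simp only [mul_diagonal, transpose_apply]
  calc |∑ j, U k j * (hX.eigenvalues j - 1) * U l j|
      ≤ ∑ j, |U k j * (hX.eigenvalues j - 1) * U l j| := Finset.abs_sum_le_sum_abs _ _
    _ ≤ ∑ j, b * ((U k j ^ 2 + U l j ^ 2) / 2) := by
        refine Finset.sum_le_sum fun j _ => ?_
        rw [abs_mul, abs_mul, mul_comm |U k j|, mul_assoc]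
        have h4 : |U k j| * |U l j| ≤ (U k j ^ 2 + U l j ^ 2) / 2 := by
          nlinarith [sq_nonneg (|U k j| - |U l j|), sq_abs (U k j), sq_abs (U l j)]
        exact mul_le_mul (hb j) h4 (by positivity) ((abs_nonneg _).trans (hb j))
    _ = b := by
        rw [← Finset.mul_sum, ← Finset.sum_div, Finset.sum_add_distrib, h3, h3]; ring

theorem PosDef.abs_sub_one_apply_le [DecidableEq n] {X : Matrix n n ℝ}
    (hX : X.PosDef) {ε : ℝ} (hε : ε ≤ 1)
    (h : X.trace - Real.log X.det - Fintype.card n ≤ ε) (k l : n) :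
    |(X - 1) k l| ≤ √(12 * ε) := by
  refine hX.isHermitian.abs_sub_one_apply_le (fun i => ?_) k l
  refine Real.abs_le_sqrt (sq_sub_one_le_of_sub_one_sub_log_le (hX.eigenvalues_pos i) hε ?_)
  rw [hX.trace_sub_log_det] at h
  refine le_trans ?_ h
  exact Finset.single_le_sum
    (f := fun i => hX.isHermitian.eigenvalues i - 1 - Real.log (hX.isHermitian.eigenvalues i))
    (fun j _ => sub_one_sub_log_nonneg (hX.eigenvalues_pos j)) (Finset.mem_univ i)

theorem PosDef.exists_pos_mul_le [DecidableEq n] {M : Matrix n n ℝ} (hM : M.PosDef) :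
    ∃ c : ℝ, 0 < c ∧ ∀ q : n → ℝ, c * (q ⬝ᵥ q) ≤ q ⬝ᵥ (M *ᵥ q) := by
  obtain ⟨B, hB⟩ := hM.posSemidef.exists_transpose_mul_self
  have hBdet : IsUnit B.det := by
    have := (isUnit_iff_isUnit_det _).1 hM.isUnit
    rw [hB, det_mul] at this
    exact isUnit_of_mul_isUnit_right this
  set A := B⁻¹ with hA
  set s : ℝ := ∑ i, ∑ j, A i j ^ 2 with hs
  have hs0 : 0 ≤ s := Finset.sum_nonneg fun _ _ => Finset.sum_nonneg fun _ _ => sq_nonneg _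
  refine ⟨(1 + s)⁻¹, by positivity, fun q => ?_⟩
  rw [inv_mul_le_iff₀ (by positivity)]
  set p := B *ᵥ q with hp
  have hq : q = A *ᵥ p := by rw [hp, mulVec_mulVec, hA, nonsing_inv_mul _ hBdet, one_mulVec]
  have h1 : q ⬝ᵥ (M *ᵥ q) = p ⬝ᵥ p := by
    rw [hB, ← mulVec_mulVec, dotProduct_mulVec, vecMul_transpose]
  have h2 : q ⬝ᵥ q ≤ s * (p ⬝ᵥ p) := by
    have : ∀ i, q i ^ 2 ≤ (∑ j, A i j ^ 2) * (p ⬝ᵥ p) := fun i => by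
      have h3 := Finset.sum_mul_sq_le_sq_mul_sq Finset.univ (fun j => A i j) p
      have h4 : q i = ∑ j, A i j * p j := congrFun hq i
      rw [h4]
      simpa [dotProduct, sq] using h3
    calc q ⬝ᵥ q = ∑ i, q i ^ 2 := by simp [dotProduct, sq]
      _ ≤ ∑ i, (∑ j, A i j ^ 2) * (p ⬝ᵥ p) := Finset.sum_le_sum fun i _ => this i
      _ = _ := by rw [← Finset.sum_mul]
  have h5 : 0 ≤ p ⬝ᵥ p := Finset.sum_nonneg fun i _ => mul_self_nonneg _
  rw [h1]
  linarith

theorem abs_dotProduct_mulVec_le {E : Matrix n n ℝ} {ε : ℝ} (hE : ∀ i j, |E i j| ≤ ε)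
    (q : n → ℝ) : |q ⬝ᵥ (E *ᵥ q)| ≤ ε * Fintype.card n * (q ⬝ᵥ q) := by
  have h1 : q ⬝ᵥ (E *ᵥ q) = ∑ i, ∑ j, q i * (E i j * q j) := by
    simp [dotProduct, mulVec, Finset.mul_sum]
  rw [h1]
  have h2 : ∀ i j, |q i * (E i j * q j)| ≤ ε * ((q i ^ 2 + q j ^ 2) / 2) := fun i j => by
    rw [abs_mul, abs_mul, mul_left_comm]
    refine mul_le_mul (hE i j) ?_ (by positivity) ((abs_nonneg _).trans (hE i j))
    nlinarith [sq_nonneg (|q i| - |q j|), sq_abs (q i), sq_abs (q j)]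
  calc |∑ i, ∑ j, q i * (E i j * q j)|
      ≤ ∑ i, ∑ j, ε * ((q i ^ 2 + q j ^ 2) / 2) :=
        (Finset.abs_sum_le_sum_abs _ _).trans (Finset.sum_le_sum fun i _ =>
          (Finset.abs_sum_le_sum_abs _ _).trans (Finset.sum_le_sum fun j _ => h2 i j))
    _ = _ := by
        simp only [← Finset.mul_sum, ← Finset.sum_div, Finset.sum_add_distrib, Finset.sum_const,
          Finset.card_univ, nsmul_eq_mul, dotProduct, ← sq]
        ring

end Matrix

section Limits

variable {ι : Type*} {l : Filter ι} {m n : Type*}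

theorem tendsto_matrix_iff {A : ι → Matrix m n ℝ} {A₀ : Matrix m n ℝ} :
    Tendsto A l (𝓝 A₀) ↔ ∀ i j, Tendsto (fun x => A x i j) l (𝓝 (A₀ i j)) := by
  refine tendsto_pi_nhds.trans (forall_congr' fun i => ?_)
  exact tendsto_pi_nhds

theorem Filter.Tendsto.matrix_transpose {A : ι → Matrix m n ℝ} {A₀ : Matrix m n ℝ}
    (h : Tendsto A l (𝓝 A₀)) : Tendsto (fun x => (A x)ᵀ) l (𝓝 A₀ᵀ) :=
  tendsto_matrix_iff.2 fun i j => tendsto_matrix_iff.1 h j i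

variable [Fintype n]

theorem Filter.Tendsto.matrix_det [DecidableEq n] {A : ι → Matrix n n ℝ} {A₀ : Matrix n n ℝ}
    (h : Tendsto A l (𝓝 A₀)) : Tendsto (fun x => (A x).det) l (𝓝 A₀.det) :=
  (continuous_id.matrix_det.tendsto A₀).comp h

theorem Filter.Tendsto.matrix_trace {A : ι → Matrix n n ℝ} {A₀ : Matrix n n ℝ}
    (h : Tendsto A l (𝓝 A₀)) : Tendsto (fun x => (A x).trace) l (𝓝 A₀.trace) :=
  (continuous_id.matrix_trace.tendsto A₀).comp h

theorem Filter.Tendsto.matrix_inv [DecidableEq n] {A : ι → Matrix n n ℝ} {A₀ : Matrix n n ℝ}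
    (h : Tendsto A l (𝓝 A₀)) (h₀ : A₀.det ≠ 0) : Tendsto (fun x => (A x)⁻¹) l (𝓝 A₀⁻¹) := by
  have : ContinuousAt Ring.inverse A₀.det := by
    rw [Ring.inverse_eq_inv']
    exact continuousAt_inv₀ h₀
  exact (continuousAt_matrix_inv A₀ this).tendsto.comp h

theorem Filter.Tendsto.eventually_posDef_bound [DecidableEq n]
    {A : ι → Matrix n n ℝ} {A₀ : Matrix n n ℝ}
    (h : Tendsto A l (𝓝 A₀)) (h₀ : A₀.PosDef) :
    ∃ c : ℝ, 0 < c ∧ ∀ᶠ x in l, ∀ q : n → ℝ, c * (q ⬝ᵥ q) ≤ q ⬝ᵥ (A x *ᵥ q) := by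
  obtain ⟨c, hc, hcb⟩ := h₀.exists_pos_mul_le
  refine ⟨c / 2, by positivity, ?_⟩
  set ε := c / (2 * (Fintype.card n + 1)) with hε
  have hε0 : 0 < ε := by positivity
  have hev : ∀ᶠ x in l, ∀ i j, |(A x - A₀) i j| ≤ ε := by
    refine eventually_all.2 fun i => eventually_all.2 fun j => ?_
    have := (tendsto_matrix_iff.1 h i j).sub_const (A₀ i j)
    rw [sub_self] at this
    filter_upwards [this.abs.eventually_le_const (by simpa using hε0)] with x hx
    exact hx
  filter_upwards [hev] with x hx q
  have h1 := abs_dotProduct_mulVec_le hx q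
  rw [sub_mulVec, dotProduct_sub] at h1
  have hqq : 0 ≤ q ⬝ᵥ q := Finset.sum_nonneg fun i _ => mul_self_nonneg _
  have h2 : ε * Fintype.card n ≤ c / 2 := by
    rw [hε, div_mul_eq_mul_div, div_le_iff₀ (by positivity)]
    nlinarith
  have h3 := mul_le_mul_of_nonneg_right h2 hqq
  have h4 := (abs_le.1 h1).1
  have h5 := hcb q
  linarith

theorem posDef_of_bound {A : Matrix n n ℝ} (hA : A.IsHermitian) {c : ℝ} (hc : 0 < c)
    (h : ∀ q : n → ℝ, c * (q ⬝ᵥ q) ≤ q ⬝ᵥ (A *ᵥ q)) : A.PosDef := by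
  refine PosDef.of_dotProduct_mulVec_pos hA fun x hx => ?_
  have h1 : 0 < x ⬝ᵥ x := by
    refine lt_of_le_of_ne (Finset.sum_nonneg fun i _ => mul_self_nonneg _) fun h0 => hx ?_
    exact dotProduct_self_eq_zero.1 h0.symm
  exact (mul_pos hc h1).trans_le (h x)

theorem Ultrafilter.exists_tendsto_real {ι : Type*} (l : Ultrafilter ι) {a : ι → ℝ} {b : ℝ}
    (h : ∀ᶠ x in l, |a x| ≤ b) : ∃ a₀, |a₀| ≤ b ∧ Tendsto a l (𝓝 a₀) := by
  have hmem : Set.Icc (-b) b ∈ l.map a := by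
    exact Ultrafilter.mem_coe.1 (h.mono fun x hx => abs_le.1 hx)
  obtain ⟨a₀, ha₀, hle⟩ := isCompact_Icc.ultrafilter_le_nhds' (l.map a) hmem
  exact ⟨a₀, abs_le.2 ha₀, hle⟩

theorem Ultrafilter.exists_tendsto_matrix {ι m n : Type*} (l : Ultrafilter ι)
    {A : ι → Matrix m n ℝ} (h : ∃ b : ℝ, ∀ᶠ x in l, ∀ i j, |A x i j| ≤ b) :
    ∃ A₀, Tendsto A l (𝓝 A₀) := by
  obtain ⟨b, hb⟩ := h
  have : ∀ i j, ∃ a₀, Tendsto (fun x => A x i j) l (𝓝 a₀) := fun i j => by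
    obtain ⟨a₀, -, h⟩ := l.exists_tendsto_real (a := fun x => A x i j) (hb.mono fun x hx => hx i j)
    exact ⟨a₀, h⟩
  choose A₀ hA₀ using this
  exact ⟨A₀, tendsto_matrix_iff.2 hA₀⟩

/-- A sequence of matrices with bounded `A M A'` is bounded when `M` tends to a positive definite
limit. -/
theorem Filter.Tendsto.eventually_bounded_of_conj [DecidableEq n]
    {A M : ι → Matrix n n ℝ} {M₀ : Matrix n n ℝ}
    (hM : Tendsto M l (𝓝 M₀)) (h₀ : M₀.PosDef)
    (h : ∃ b : ℝ, ∀ᶠ x in l, ∀ i, (A x * M x * (A x)ᵀ) i i ≤ b) :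
    ∃ b : ℝ, ∀ᶠ x in l, ∀ i j, |A x i j| ≤ b := by
  obtain ⟨c, hc, hcb⟩ := hM.eventually_posDef_bound h₀
  obtain ⟨b, hb⟩ := h
  refine ⟨√(b / c), ?_⟩
  filter_upwards [hcb, hb] with x h1 h2 i j
  refine Real.abs_le_sqrt ?_
  rw [le_div_iff₀' hc]
  have h3 : (A x * M x * (A x)ᵀ) i i = A x i ⬝ᵥ (M x *ᵥ A x i) := by
    rw [Matrix.mul_assoc]
    simp [mul_apply, dotProduct, mulVec]
  have h4 : A x i j ^ 2 ≤ A x i ⬝ᵥ A x i := by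
    have := Finset.single_le_sum (f := fun j => A x i j ^ 2) (fun _ _ => sq_nonneg _)
      (Finset.mem_univ j)
    simpa [dotProduct, sq] using this
  have h5 := h1 (A x i)
  have h6 := h2 i
  rw [h3] at h6
  nlinarith

end Limits

section Averages

variable {ι : Type*} {l : Filter ι} {N : ι → ℕ}

theorem tendsto_avg_mul_of_tendsto_avg_sq {w u v : (x : ι) → Fin (N x) → ℝ} {c : ℝ}
    (hw : ∀ᶠ x in l, ∀ i, |w x i| ≤ c)
    (hu : Tendsto (fun x => (N x : ℝ)⁻¹ * ∑ i, u x i ^ 2) l (𝓝 0))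
    (hv : ∃ b : ℝ, ∀ᶠ x in l, (N x : ℝ)⁻¹ * ∑ i, v x i ^ 2 ≤ b) :
    Tendsto (fun x => (N x : ℝ)⁻¹ * ∑ i, w x i * (u x i * v x i)) l (𝓝 0) := by
  obtain ⟨b, hb⟩ := hv
  have hlim : Tendsto (fun x => √(c ^ 2 * ((N x : ℝ)⁻¹ * ∑ i, u x i ^ 2) * b)) l (𝓝 0) := by
    have := ((hu.const_mul (c ^ 2)).mul_const b).sqrt
    simpa using this
  refine squeeze_zero_norm' ?_ hlim
  filter_upwards [hw, hb] with x hw hb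
  rw [Real.norm_eq_abs]
  refine Real.abs_le_sqrt ?_
  have h1 := Finset.sum_mul_sq_le_sq_mul_sq Finset.univ (fun i => w x i * u x i) (v x)
  have h2 : ∑ i, (w x i * u x i) ^ 2 ≤ c ^ 2 * ∑ i, u x i ^ 2 := by
    rw [Finset.mul_sum]
    refine Finset.sum_le_sum fun i _ => ?_
    rw [mul_pow]
    refine mul_le_mul_of_nonneg_right ?_ (sq_nonneg _)
    rw [← sq_abs]
    exact pow_le_pow_left₀ (abs_nonneg _) (hw i) 2
  have h3 : ∑ i, w x i * (u x i * v x i) = ∑ i, w x i * u x i * v x i :=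
    Finset.sum_congr rfl fun i _ => by ring
  have hN : (0 : ℝ) ≤ (N x : ℝ)⁻¹ := by positivity
  have hu0 : 0 ≤ ∑ i, u x i ^ 2 := Finset.sum_nonneg fun _ _ => sq_nonneg _
  have hv0 : 0 ≤ ∑ i, v x i ^ 2 := Finset.sum_nonneg fun _ _ => sq_nonneg _
  calc ((N x : ℝ)⁻¹ * ∑ i, w x i * (u x i * v x i)) ^ 2
      = ((N x : ℝ)⁻¹) ^ 2 * (∑ i, w x i * u x i * v x i) ^ 2 := by rw [h3, mul_pow]
    _ ≤ ((N x : ℝ)⁻¹) ^ 2 * ((∑ i, (w x i * u x i) ^ 2) * ∑ i, v x i ^ 2) :=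
        mul_le_mul_of_nonneg_left h1 (sq_nonneg _)
    _ ≤ ((N x : ℝ)⁻¹) ^ 2 * ((c ^ 2 * ∑ i, u x i ^ 2) * ∑ i, v x i ^ 2) := by gcongr
    _ = (c ^ 2 * ((N x : ℝ)⁻¹ * ∑ i, u x i ^ 2)) * ((N x : ℝ)⁻¹ * ∑ i, v x i ^ 2) := by ring
    _ ≤ _ := by gcongr

theorem tendsto_avg_avg_mul {W : (x : ι) → Matrix (Fin (N x)) (Fin (N x)) ℝ}
    {u v : (x : ι) → Fin (N x) → ℝ}
    (hW : Tendsto (fun x => ((N x : ℝ) ^ 2)⁻¹ * ∑ i, ∑ j, W x i j ^ 2) l (𝓝 0))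
    (hu : ∃ b : ℝ, ∀ᶠ x in l, (N x : ℝ)⁻¹ * ∑ i, u x i ^ 2 ≤ b)
    (hv : ∃ b : ℝ, ∀ᶠ x in l, (N x : ℝ)⁻¹ * ∑ i, v x i ^ 2 ≤ b) :
    Tendsto (fun x => ((N x : ℝ) ^ 2)⁻¹ * ∑ i, ∑ j, u x i * W x i j * v x j) l (𝓝 0) := by
  obtain ⟨b, hb⟩ := hu
  obtain ⟨b', hb'⟩ := hv
  have hlim : Tendsto (fun x => √((((N x : ℝ) ^ 2)⁻¹ * ∑ i, ∑ j, W x i j ^ 2) * (b * b'))) l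
      (𝓝 0) := by
    have := (hW.mul_const (b * b')).sqrt
    simpa using this
  refine squeeze_zero_norm' ?_ hlim
  filter_upwards [hb, hb'] with x hb hb'
  rw [Real.norm_eq_abs]
  refine Real.abs_le_sqrt ?_
  have h1 := Finset.sum_mul_sq_le_sq_mul_sq Finset.univ
    (fun p : Fin (N x) × Fin (N x) => W x p.1 p.2) (fun p => u x p.1 * v x p.2)
  have h2 : ∑ i, ∑ j, u x i * W x i j * v x j =
      ∑ p : Fin (N x) × Fin (N x), W x p.1 p.2 * (u x p.1 * v x p.2) := by
    rw [Fintype.sum_prod_type]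
    exact Finset.sum_congr rfl fun i _ => Finset.sum_congr rfl fun j _ => by ring
  have h3 : ∑ p : Fin (N x) × Fin (N x), (u x p.1 * v x p.2) ^ 2 =
      (∑ i, u x i ^ 2) * ∑ j, v x j ^ 2 := by
    rw [Fintype.sum_prod_type, Finset.sum_mul_sum]
    exact Finset.sum_congr rfl fun i _ => Finset.sum_congr rfl fun j _ => by ring
  have h4 : ∑ p : Fin (N x) × Fin (N x), W x p.1 p.2 ^ 2 = ∑ i, ∑ j, W x i j ^ 2 := by
    rw [Fintype.sum_prod_type]
  rw [h3, h4] at h1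
  rw [h2, mul_pow]
  have hu0 : 0 ≤ (N x : ℝ)⁻¹ * ∑ i, u x i ^ 2 :=
    mul_nonneg (by positivity) (Finset.sum_nonneg fun _ _ => sq_nonneg _)
  have hv0 : 0 ≤ (N x : ℝ)⁻¹ * ∑ i, v x i ^ 2 :=
    mul_nonneg (by positivity) (Finset.sum_nonneg fun _ _ => sq_nonneg _)
  have hW0 : 0 ≤ ((N x : ℝ) ^ 2)⁻¹ * ∑ i, ∑ j, W x i j ^ 2 :=
    mul_nonneg (by positivity) (Finset.sum_nonneg fun _ _ => Finset.sum_nonneg fun _ _ =>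
      sq_nonneg _)
  calc (((N x : ℝ) ^ 2)⁻¹) ^ 2 *
        (∑ p : Fin (N x) × Fin (N x), W x p.1 p.2 * (u x p.1 * v x p.2)) ^ 2
      ≤ (((N x : ℝ) ^ 2)⁻¹) ^ 2 *
        ((∑ i, ∑ j, W x i j ^ 2) * ((∑ i, u x i ^ 2) * ∑ j, v x j ^ 2)) :=
        mul_le_mul_of_nonneg_left h1 (sq_nonneg _)
    _ = (((N x : ℝ) ^ 2)⁻¹ * ∑ i, ∑ j, W x i j ^ 2) *
        (((N x : ℝ)⁻¹ * ∑ i, u x i ^ 2) * ((N x : ℝ)⁻¹ * ∑ j, v x j ^ 2)) := by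
        rw [sq (N x : ℝ), mul_inv]; ring
    _ ≤ _ := by gcongr; exact hu0.trans hb

end Averages

namespace FactorParam

variable {N r : ℕ}

theorem logDet_add_trace_le_of_logLik_le {S : Matrix (Fin N) (Fin N) ℝ} {θ θ' : FactorParam N r}
    (hN : 0 < N) (h : logLik S θ' ≤ logLik S θ) :
    Real.log θ.sigmaZZ.det + (S * θ.sigmaZZ⁻¹).trace ≤
      Real.log θ'.sigmaZZ.det + (S * θ'.sigmaZZ⁻¹).trace := by
  have hN' : (0 : ℝ) < 1 / (2 * (N : ℝ)) := by positivity
  unfold logLik at h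
  refine le_of_mul_le_mul_left ?_ hN'
  linarith

/-- The basic inequality satisfied by a parameter value that is at least as likely as the true
one. -/
theorem divergence_le {c : ℝ} (hc : 0 < c) {θs θ : FactorParam N r}
    {S : Matrix (Fin N) (Fin N) ℝ} (hN : 0 < N)
    (hds : ∀ i, θs.idioVar i ∈ Set.Icc c⁻¹ c) (hd : ∀ i, θ.idioVar i ∈ Set.Icc c⁻¹ c)
    (hMs : θs.factorCov.PosSemidef) (hM : θ.factorCov.PosSemidef)
    (h : logLik S θs ≤ logLik S θ) :
    ∑ i, (θs.idioVar i / θ.idioVar i - 1 - Real.log (θs.idioVar i / θ.idioVar i)) +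
        (θs.factorCov * (θs.loadingᵀ * θ.sigmaZZ⁻¹ * θs.loading)).trace ≤
      2 * (c * ∑ i, |(S - θs.sigmaZZ) i i| +
        √(∑ i, ∑ j, (S - θs.sigmaZZ) i j ^ 2) * (c * √r)) + c ^ 2 * r +
        Real.log (1 + θs.factorCov * θs.gram).det := by
  have hpos : ∀ i, 0 < θ.idioVar i := fun i => (inv_pos.2 hc).trans_le (hd i).1
  have hspos : ∀ i, 0 < θs.idioVar i := fun i => (inv_pos.2 hc).trans_le (hds i).1
  have h0 := logDet_add_trace_le_of_logLik_le hN h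
  set W := S - θs.sigmaZZ with hW
  have hS : S = θs.sigmaZZ + W := by rw [hW]; abel
  have hlow : ∑ i, Real.log (θ.idioVar i) ≤ Real.log θ.sigmaZZ.det := by
    rw [← Real.log_prod (fun i _ => (hpos i).ne')]
    exact Real.log_le_log (Finset.prod_pos fun i _ => hpos i) (prod_le_det_sigmaZZ hpos hM)
  have hdet : Real.log θs.sigmaZZ.det =
      ∑ i, Real.log (θs.idioVar i) + Real.log (1 + θs.factorCov * θs.gram).det := by
    have h1 := (posDef_sigmaZZ hspos hMs).det_pos
    rw [det_sigmaZZ hspos] at h1 ⊢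
    have hp : 0 < ∏ i, θs.idioVar i := Finset.prod_pos fun i _ => hspos i
    rw [Real.log_mul hp.ne' (pos_of_mul_pos_right h1 hp.le).ne',
      Real.log_prod (fun i _ => (hspos i).ne')]
  have ht : (S * θs.sigmaZZ⁻¹).trace = N + (W * θs.sigmaZZ⁻¹).trace := by
    have hu : IsUnit θs.sigmaZZ.det := (isUnit_iff_isUnit_det _).1 (posDef_sigmaZZ hspos hMs).isUnit
    rw [hS, Matrix.add_mul, mul_nonsing_inv _ hu, trace_add, trace_one, Fintype.card_fin]
  have ht2 : (S * θ.sigmaZZ⁻¹).trace =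
      (θs.factorCov * (θs.loadingᵀ * θ.sigmaZZ⁻¹ * θs.loading)).trace +
        (diagonal θs.idioVar * θ.sigmaZZ⁻¹).trace + (W * θ.sigmaZZ⁻¹).trace := by
    rw [hS, Matrix.add_mul, trace_add]
    congr 1
    conv_lhs => rw [sigmaZZ, Matrix.add_mul, trace_add, sigmaEE]
    congr 1
    have e1 : θs.loading * θs.factorCov * θs.loadingᵀ * θ.sigmaZZ⁻¹ =
      θs.loading * (θs.factorCov * (θs.loadingᵀ * θ.sigmaZZ⁻¹)) := by simp only [Matrix.mul_assoc]
    rw [e1, trace_mul_comm]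
    simp only [Matrix.mul_assoc]
  have hb1 := abs_le.1 (abs_trace_mul_inv_le hc (fun i => (hd i).1) hM W)
  have hb2 := abs_le.1 (abs_trace_mul_inv_le hc (fun i => (hds i).1) hMs W)
  have hb3 := le_trace_diagonal_mul_inv hc (fun i => (hd i).1) hM (fun i => (hds i).2)
  have hphi : ∑ i, (θs.idioVar i / θ.idioVar i - 1 - Real.log (θs.idioVar i / θ.idioVar i)) =
      ∑ i, θs.idioVar i / θ.idioVar i - N - ∑ i, Real.log (θs.idioVar i) +
        ∑ i, Real.log (θ.idioVar i) := by
    have : ∀ i, Real.log (θs.idioVar i / θ.idioVar i) =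
        Real.log (θs.idioVar i) - Real.log (θ.idioVar i) := fun i =>
      Real.log_div (hspos i).ne' (hpos i).ne'
    simp only [this, Finset.sum_sub_distrib]
    simp
    ring
  rw [hphi]
  rw [hdet, ht, ht2] at h0
  linarith [hb1.1, hb2.2]

theorem trace_residual_eq {d : Fin N → ℝ} {S : Matrix (Fin N) (Fin N) ℝ} (hS : Sᵀ = S)
    (A : Matrix (Fin N) (Fin r) ℝ) (B : Matrix (Fin r) (Fin N) ℝ) :
    (S * ((1 - A * B)ᵀ * diagonal d * (1 - A * B))).trace =
      ∑ i, d i * (S i i - 2 * (A i ⬝ᵥ (B *ᵥ S.col i)) + A i ⬝ᵥ ((B * S * Bᵀ) *ᵥ A i)) := by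
  have h1 : (S * ((1 - A * B)ᵀ * diagonal d * (1 - A * B))).trace =
      (diagonal d * ((1 - A * B) * S * (1 - A * B)ᵀ)).trace := by
    have e1 : S * ((1 - A * B)ᵀ * diagonal d * (1 - A * B)) =
      (S * (1 - A * B)ᵀ) * (diagonal d * (1 - A * B)) := by simp only [Matrix.mul_assoc]
    rw [e1, trace_mul_comm]
    simp only [Matrix.mul_assoc]
  have h2 : (1 - A * B) * S * (1 - A * B)ᵀ =
      S - A * (B * S) - (A * (B * S))ᵀ + A * (B * S * Bᵀ) * Aᵀ := by
    simp only [transpose_sub, transpose_one, transpose_mul, Matrix.sub_mul, Matrix.mul_sub,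
      Matrix.one_mul, Matrix.mul_one, hS, Matrix.mul_assoc]
    abel
  rw [h1, trace_diagonal_mul, h2]
  refine Finset.sum_congr rfl fun i _ => ?_
  have h3 : (A * (B * S)) i i = A i ⬝ᵥ (B *ᵥ S.col i) := rfl
  have h4 : (A * (B * S * Bᵀ) * Aᵀ) i i = A i ⬝ᵥ ((B * S * Bᵀ) *ᵥ A i) := by
    rw [Matrix.mul_assoc]; rfl
  rw [Matrix.add_apply, Matrix.sub_apply, Matrix.sub_apply, transpose_apply, h3, h4]
  ring

/-- The inequality obtained by comparing `θ` with the parameter value whose first `m` loadings are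
those of `Λs`, whose remaining loadings and idiosyncratic variances are those of `θ`, and whose
factor covariance is `Ms`. -/
theorem profile_le {θ : FactorParam N r} {S : Matrix (Fin N) (Fin N) ℝ} (hN : 0 < N)
    (hd : ∀ i, 0 < θ.idioVar i) (hM : θ.factorCov.PosSemidef) (hK : θ.gram.PosDef)
    (hS : S.PosSemidef) {Ms : Matrix (Fin r) (Fin r) ℝ} (hMs : Ms.PosDef) (m : ℕ)
    (Λs : Matrix (Fin N) (Fin r) ℝ) {θ' : FactorParam N r}
    (hθ' : θ' = ⟨fun i => if (i : ℕ) < m then Λs i else θ.loading i, θ.idioVar, Ms⟩)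
    (h : logLik S θ' ≤ logLik S θ) :
    (θ.modelGram * (θ.gls * S * θ.glsᵀ)).trace - Real.log θ.modelGram.det +
        ∑ i ∈ Finset.univ.filter (fun i : Fin N => (i : ℕ) < m), (θ.idioVar i)⁻¹ *
          ((θ.loading i - Λs i) ⬝ᵥ ((θ.gls * S * θ.glsᵀ) *ᵥ (θ.loading i - Λs i)) +
            2 * ((θ.loading i - Λs i) ⬝ᵥ
              ((θ.gls * S * θ.glsᵀ) *ᵥ Λs i - θ.gls *ᵥ S.col i))) ≤
      Real.log (1 + Ms * θ'.gram).det - Real.log θ.gram.det +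
        (Ms⁻¹ * (θ.gls * S * θ.glsᵀ)).trace := by
  have hd' : ∀ i, 0 < θ'.idioVar i := by rw [hθ']; exact hd
  have hM' : θ'.factorCov.PosDef := by rw [hθ']; exact hMs
  have hKu : IsUnit θ.gram.det := (isUnit_iff_isUnit_det _).1 hK.isUnit
  set U := θ.gls * S * θ.glsᵀ with hU
  have hUt : Uᵀ = U := (hS.mul_mul_transpose θ.gls).transpose_eq
  have hSt : Sᵀ = S := hS.transpose_eq
  have hp : 0 < ∏ i, θ.idioVar i := Finset.prod_pos fun i _ => hd i
  have h0 := logDet_add_trace_le_of_logLik_le hN h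
  have hdetH : θ.modelGram.det * (1 + θ.factorCov * θ.gram).det = θ.gram.det := by
    rw [← det_mul, modelGram_mul hd hM]
  have hpos1 : 0 < (1 + θ.factorCov * θ.gram).det := by
    have h1 := (posDef_sigmaZZ hd hM).det_pos
    rw [det_sigmaZZ hd] at h1
    exact pos_of_mul_pos_right h1 hp.le
  have hHpos : 0 < θ.modelGram.det := by
    have := hK.det_pos
    rw [← hdetH] at this
    exact pos_of_mul_pos_left this hpos1.le
  have hl1 : Real.log θ.sigmaZZ.det =
      Real.log (∏ i, θ.idioVar i) + Real.log θ.gram.det - Real.log θ.modelGram.det := by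
    rw [det_sigmaZZ hd, Real.log_mul hp.ne' hpos1.ne', ← hdetH,
      Real.log_mul hHpos.ne' hpos1.ne']
    ring
  have hfc : θ'.factorCov = Ms := by rw [hθ']
  have hid : θ'.idioVar = θ.idioVar := by rw [hθ']
  have hl2 : Real.log θ'.sigmaZZ.det =
      Real.log (∏ i, θ.idioVar i) + Real.log (1 + Ms * θ'.gram).det := by
    have h1 := (posDef_sigmaZZ hd' hM'.posSemidef).det_pos
    rw [det_sigmaZZ hd', hid, hfc] at h1 ⊢
    rw [Real.log_mul hp.ne' (pos_of_mul_pos_right h1 hp.le).ne']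
  have ht1 : (S * θ.sigmaZZ⁻¹).trace =
      (S * ((1 - θ.loading * θ.gls)ᵀ * θ.sigmaEE⁻¹ * (1 - θ.loading * θ.gls))).trace +
        (θ.modelGram * U).trace := by
    conv_lhs => rw [sigmaZZ_inv_eq hd hM hKu, Matrix.mul_add, trace_add]
    congr 1
    have e1 : S * (θ.glsᵀ * θ.modelGram * θ.gls) = (S * θ.glsᵀ) * (θ.modelGram * θ.gls) := by
      simp only [Matrix.mul_assoc]
    rw [e1, trace_mul_comm, hU]
    simp only [Matrix.mul_assoc]
  have ht2 := trace_mul_inv_le hd' hM' hS θ.gls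
  have hEE : θ'.sigmaEE = θ.sigmaEE := by rw [sigmaEE, hid, sigmaEE]
  rw [hEE, sigmaEE_inv hd, trace_residual_eq hSt, hfc, ← hU] at ht2
  rw [sigmaEE_inv hd, trace_residual_eq hSt, ← hU] at ht1
  have hdiff : ∑ i, (θ.idioVar i)⁻¹ * (S i i - 2 * (θ.loading i ⬝ᵥ (θ.gls *ᵥ S.col i)) +
        θ.loading i ⬝ᵥ (U *ᵥ θ.loading i)) -
      ∑ i, (θ.idioVar i)⁻¹ * (S i i - 2 * (θ'.loading i ⬝ᵥ (θ.gls *ᵥ S.col i)) +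
        θ'.loading i ⬝ᵥ (U *ᵥ θ'.loading i)) =
      ∑ i ∈ Finset.univ.filter (fun i : Fin N => (i : ℕ) < m), (θ.idioVar i)⁻¹ *
          ((θ.loading i - Λs i) ⬝ᵥ (U *ᵥ (θ.loading i - Λs i)) +
            2 * ((θ.loading i - Λs i) ⬝ᵥ (U *ᵥ Λs i - θ.gls *ᵥ S.col i))) := by
    rw [Finset.sum_filter, ← Finset.sum_sub_distrib]
    refine Finset.sum_congr rfl fun i _ => ?_
    have hlo : θ'.loading i = if (i : ℕ) < m then Λs i else θ.loading i := by rw [hθ']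
    rw [hlo]
    split_ifs with him
    · have hsym : Λs i ⬝ᵥ (U *ᵥ θ.loading i) = θ.loading i ⬝ᵥ (U *ᵥ Λs i) := by
        rw [dotProduct_mulVec, ← mulVec_transpose, hUt, dotProduct_comm]
      simp only [mulVec_sub, dotProduct_sub, sub_dotProduct, hsym]
      ring
    · ring
  rw [hl1, hl2, ht1] at h0
  rw [← hdiff]
  linarith

end FactorParam

namespace Matrix

variable {n : Type*} [Fintype n] [DecidableEq n]

theorem PosSemidef.mul_trace_le_trace_mul {M Y : Matrix n n ℝ} (hY : Y.PosSemidef) {c : ℝ}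
    (hM : ∀ q : n → ℝ, c * (q ⬝ᵥ q) ≤ q ⬝ᵥ (M *ᵥ q)) : c * Y.trace ≤ (M * Y).trace := by
  obtain ⟨Z, rfl⟩ := hY.exists_transpose_mul_self
  have e : (M * (Zᵀ * Z)).trace = (Z * (M * Zᵀ)).trace := by
    rw [← Matrix.mul_assoc, trace_mul_comm]
  rw [e, trace_mul_comm Zᵀ, trace, trace, Finset.mul_sum]
  refine Finset.sum_le_sum fun i _ => ?_
  have h1 : (Z * Zᵀ) i i = Z i ⬝ᵥ Z i := rfl
  have h2 : (Z * (M * Zᵀ)) i i = Z i ⬝ᵥ (M *ᵥ Z i) := rfl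
  rw [diag_apply, diag_apply, h1, h2]
  exact hM (Z i)

theorem tendsto_zero_of_trace {ι : Type*} {l : Filter ι} {Y : ι → Matrix n n ℝ}
    (hY : ∀ᶠ x in l, (Y x).PosSemidef) (h : Tendsto (fun x => (Y x).trace) l (𝓝 0)) :
    Tendsto Y l (𝓝 0) := by
  refine tendsto_matrix_iff.2 fun i j => squeeze_zero_norm' ?_ h
  filter_upwards [hY] with x hx
  exact hx.abs_apply_le_trace i j

end Matrix

section MeanSquare

variable {ι : Type*} {l : Filter ι} {N : ι → ℕ} {r : ℕ}

/-- The mean square distance between corresponding columns tends to zero. -/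
def MeanSqClose (l : Filter ι) (A B : (x : ι) → Matrix (Fin (N x)) (Fin r) ℝ) : Prop :=
  ∀ k, Tendsto (fun x => (N x : ℝ)⁻¹ * ∑ i, (A x i k - B x i k) ^ 2) l (𝓝 0)

/-- The columns have bounded mean squares. -/
def MeanSqBounded (l : Filter ι) (A : (x : ι) → Matrix (Fin (N x)) (Fin r) ℝ) : Prop :=
  ∀ k, ∃ b : ℝ, ∀ᶠ x in l, (N x : ℝ)⁻¹ * ∑ i, A x i k ^ 2 ≤ b

theorem avg_add_sq_le (n : ℕ) (u v : Fin n → ℝ) : (n : ℝ)⁻¹ * ∑ i, (u i + v i) ^ 2 ≤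
    2 * ((n : ℝ)⁻¹ * ∑ i, u i ^ 2) + 2 * ((n : ℝ)⁻¹ * ∑ i, v i ^ 2) := by
  have h : ∑ i, (u i + v i) ^ 2 ≤ 2 * ∑ i, u i ^ 2 + 2 * ∑ i, v i ^ 2 := by
    rw [Finset.mul_sum, Finset.mul_sum, ← Finset.sum_add_distrib]
    exact Finset.sum_le_sum fun i _ => by nlinarith [sq_nonneg (u i - v i)]
  have hn : (0 : ℝ) ≤ (n : ℝ)⁻¹ := by positivity
  calc _ ≤ (n : ℝ)⁻¹ * (2 * ∑ i, u i ^ 2 + 2 * ∑ i, v i ^ 2) := mul_le_mul_of_nonneg_left h hn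
    _ = _ := by ring

theorem avg_sq_nonneg (n : ℕ) (u : Fin n → ℝ) : 0 ≤ (n : ℝ)⁻¹ * ∑ i, u i ^ 2 :=
  mul_nonneg (by positivity) (Finset.sum_nonneg fun _ _ => sq_nonneg _)

theorem tendsto_avg_add_sq {u v : (x : ι) → Fin (N x) → ℝ}
    (hu : Tendsto (fun x => (N x : ℝ)⁻¹ * ∑ i, u x i ^ 2) l (𝓝 0))
    (hv : Tendsto (fun x => (N x : ℝ)⁻¹ * ∑ i, v x i ^ 2) l (𝓝 0)) :
    Tendsto (fun x => (N x : ℝ)⁻¹ * ∑ i, (u x i + v x i) ^ 2) l (𝓝 0) := by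
  refine squeeze_zero (fun x => avg_sq_nonneg _ _) (fun x => avg_add_sq_le _ _ _) ?_
  simpa using (hu.const_mul 2).add (hv.const_mul 2)

variable {A B A' B' : (x : ι) → Matrix (Fin (N x)) (Fin r) ℝ}

theorem MeanSqClose.trans {D : (x : ι) → Matrix (Fin (N x)) (Fin r) ℝ} (h : MeanSqClose l A B)
    (h' : MeanSqClose l B D) : MeanSqClose l A D := fun k => by
  refine (tendsto_avg_add_sq (h k) (h' k)).congr fun x => ?_
  congr 1
  exact Finset.sum_congr rfl fun i _ => by ring

theorem MeanSqClose.bounded (h : MeanSqClose l A B) (hB : MeanSqBounded l B) :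
    MeanSqBounded l A := fun k => by
  obtain ⟨b, hb⟩ := hB k
  refine ⟨2 * 1 + 2 * b, ?_⟩
  filter_upwards [hb, (h k).eventually_le_const zero_lt_one] with x h1 h2
  have h3 := avg_add_sq_le (N x) (fun i => A x i k - B x i k) (fun i => B x i k)
  simp only [sub_add_cancel] at h3
  linarith

theorem tendsto_avg_sum_sq {s : Finset (Fin r)} {u : Fin r → (x : ι) → Fin (N x) → ℝ}
    (hu : ∀ a ∈ s, Tendsto (fun x => (N x : ℝ)⁻¹ * ∑ i, u a x i ^ 2) l (𝓝 0)) :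
    Tendsto (fun x => (N x : ℝ)⁻¹ * ∑ i, (∑ a ∈ s, u a x i) ^ 2) l (𝓝 0) := by
  induction s using Finset.induction_on with
  | empty => simp [tendsto_const_nhds]
  | insert a s ha ih =>
    simp only [Finset.sum_insert ha]
    exact tendsto_avg_add_sq (hu a (Finset.mem_insert_self _ _))
      (ih fun b hb => hu b (Finset.mem_insert_of_mem hb))

theorem tendsto_avg_mul_sq {a : ι → ℝ} {u : (x : ι) → Fin (N x) → ℝ} {b : ℝ}
    (ha : ∀ᶠ x in l, |a x| ≤ b)
    (hu : Tendsto (fun x => (N x : ℝ)⁻¹ * ∑ i, u x i ^ 2) l (𝓝 0)) :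
    Tendsto (fun x => (N x : ℝ)⁻¹ * ∑ i, (u x i * a x) ^ 2) l (𝓝 0) := by
  refine squeeze_zero' (.of_forall fun x => avg_sq_nonneg _ _) ?_
    (by simpa using hu.const_mul (b ^ 2))
  filter_upwards [ha] with x hx
  have h1 : a x ^ 2 ≤ b ^ 2 := by rw [← sq_abs]; exact pow_le_pow_left₀ (abs_nonneg _) hx 2
  have h2 : (N x : ℝ)⁻¹ * ∑ i, (u x i * a x) ^ 2 = a x ^ 2 * ((N x : ℝ)⁻¹ * ∑ i, u x i ^ 2) := by
    rw [mul_left_comm, Finset.mul_sum (a := a x ^ 2)]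
    congr 1
    exact Finset.sum_congr rfl fun i _ => by ring
  rw [h2]
  exact mul_le_mul_of_nonneg_right h1 (avg_sq_nonneg _ _)

theorem MeanSqClose.mul_right (h : MeanSqClose l A B) {R : ι → Matrix (Fin r) (Fin r) ℝ}
    (hR : ∃ b : ℝ, ∀ᶠ x in l, ∀ i j, |R x i j| ≤ b) :
    MeanSqClose l (fun x => A x * R x) (fun x => B x * R x) := fun k => by
  obtain ⟨b, hb⟩ := hR
  have := tendsto_avg_sum_sq (l := l) (s := Finset.univ)
    (u := fun a x i => (A x i a - B x i a) * R x a k)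
    (fun a _ => tendsto_avg_mul_sq (hb.mono fun x hx => hx a k) (h a))
  refine this.congr fun x => ?_
  congr 1
  refine Finset.sum_congr rfl fun i _ => ?_
  simp only [mul_apply, ← Finset.sum_sub_distrib, sub_mul]

theorem avg_diagonal_apply (n : ℕ) (w : Fin n → ℝ) (A B : Matrix (Fin n) (Fin r) ℝ)
    (k k' : Fin r) : ((n : ℝ)⁻¹ • (Aᵀ * diagonal w * B)) k k' =
      (n : ℝ)⁻¹ * ∑ i, w i * (A i k * B i k') := by
  rw [Matrix.smul_apply, mul_apply, smul_eq_mul]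
  congr 1
  refine Finset.sum_congr rfl fun i _ => ?_
  rw [mul_diagonal, transpose_apply]
  ring

theorem MeanSqClose.tendsto_gram_sub {w : (x : ι) → Fin (N x) → ℝ} {c : ℝ}
    (hw : ∀ᶠ x in l, ∀ i, |w x i| ≤ c)
    (h : MeanSqClose l A B) (h' : MeanSqClose l A' B')
    (hB : MeanSqBounded l B) (hB' : MeanSqBounded l B') :
    Tendsto (fun x => (N x : ℝ)⁻¹ • ((A x)ᵀ * diagonal (w x) * A' x) -
      (N x : ℝ)⁻¹ • ((B x)ᵀ * diagonal (w x) * B' x)) l (𝓝 0) := by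
  refine tendsto_matrix_iff.2 fun k k' => ?_
  have h1 := tendsto_avg_mul_of_tendsto_avg_sq hw (h k) ((h'.bounded hB') k')
  have h2 := tendsto_avg_mul_of_tendsto_avg_sq hw (h' k') (hB k)
  have h3 := h1.add h2
  rw [add_zero] at h3
  refine h3.congr fun x => ?_
  rw [Matrix.sub_apply, avg_diagonal_apply, avg_diagonal_apply, ← mul_sub, ← mul_add,
    ← Finset.sum_sub_distrib, ← Finset.sum_add_distrib]
  congr 1
  exact Finset.sum_congr rfl fun i _ => by ring

theorem tendsto_gram_weights_sub {w w' : (x : ι) → Fin (N x) → ℝ} {b : ℝ}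
    (hw : Tendsto (fun x => (N x : ℝ)⁻¹ * ∑ i, (w x i - w' x i) ^ 2) l (𝓝 0))
    (hb : ∀ᶠ x in l, ∀ i k, |B x i k| ≤ b) (hB' : MeanSqBounded l B') :
    Tendsto (fun x => (N x : ℝ)⁻¹ • ((B x)ᵀ * diagonal (w x) * B' x) -
      (N x : ℝ)⁻¹ • ((B x)ᵀ * diagonal (w' x) * B' x)) l (𝓝 0) := by
  refine tendsto_matrix_iff.2 fun k k' => ?_
  have h1 := tendsto_avg_mul_of_tendsto_avg_sq (w := fun x i => B x i k)
    (hb.mono fun x hx i => hx i k) hw (hB' k')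
  refine h1.congr fun x => ?_
  rw [Matrix.sub_apply, avg_diagonal_apply, avg_diagonal_apply, ← mul_sub,
    ← Finset.sum_sub_distrib]
  congr 1
  exact Finset.sum_congr rfl fun i _ => by ring

end MeanSquare

namespace FactorParam

theorem det_one_add_mul_gram {N r : ℕ} {θ : FactorParam N r} (hN : 0 < N)
    (M : Matrix (Fin r) (Fin r) ℝ) :
    (1 + M * θ.gram).det = (N : ℝ) ^ r * ((N : ℝ)⁻¹ • 1 + M * θ.loadingCov).det := by
  have hN' : (N : ℝ) ≠ 0 := by positivity
  have : 1 + M * θ.gram = (N : ℝ) • ((N : ℝ)⁻¹ • 1 + M * θ.loadingCov) := by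
    rw [loadingCov_eq, smul_add, smul_smul, mul_inv_cancel₀ hN', one_smul, Matrix.mul_smul,
      smul_smul, mul_inv_cancel₀ hN', one_smul]
  rw [this, det_smul, Fintype.card_fin]

theorem det_gram {N r : ℕ} {θ : FactorParam N r} (hN : 0 < N) :
    θ.gram.det = (N : ℝ) ^ r * θ.loadingCov.det := by
  have hN' : (N : ℝ) ≠ 0 := by positivity
  have : θ.gram = (N : ℝ) • θ.loadingCov := by
    rw [loadingCov_eq, smul_smul, mul_inv_cancel₀ hN', one_smul]
  rw [this, det_smul, Fintype.card_fin]

/-- The part of the loadings `Λs` that is not explained by `θ` is small when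
`Λs' Σ_zz⁻¹ Λs` is. -/
theorem sum_sq_sub_loading_mul_le {N r : ℕ} {θ : FactorParam N r} {c : ℝ}
    (hd : ∀ i, 0 < θ.idioVar i) (hdc : ∀ i, θ.idioVar i ≤ c) (hM : θ.factorCov.PosSemidef)
    (Λs : Matrix (Fin N) (Fin r) ℝ) (k : Fin r) :
    ∑ i, ((θ.loading * (θ.factorCov * θ.loadingᵀ * θ.sigmaZZ⁻¹ * Λs)) i k - Λs i k) ^ 2 ≤
      c * (Λsᵀ * θ.sigmaZZ⁻¹ * Λs) k k := by
  have hz : IsUnit θ.sigmaZZ.det := (isUnit_iff_isUnit_det _).1 (posDef_sigmaZZ hd hM).isUnit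
  have hzt : (θ.sigmaZZ⁻¹)ᵀ = θ.sigmaZZ⁻¹ := (posDef_sigmaZZ hd hM).inv.posSemidef.transpose_eq
  set Y := θ.sigmaZZ⁻¹ * Λs with hY
  have h1 : θ.loading * (θ.factorCov * θ.loadingᵀ * θ.sigmaZZ⁻¹ * Λs) - Λs =
      -(θ.sigmaEE * Y) := by
    have e : θ.sigmaZZ * Y = Λs := by rw [hY, ← Matrix.mul_assoc, mul_nonsing_inv _ hz,
      Matrix.one_mul]
    have e' : θ.loading * (θ.factorCov * θ.loadingᵀ * θ.sigmaZZ⁻¹ * Λs) =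
        θ.loading * θ.factorCov * θ.loadingᵀ * Y := by simp only [hY, Matrix.mul_assoc]
    have e'' : Λs = θ.loading * θ.factorCov * θ.loadingᵀ * Y + θ.sigmaEE * Y := by
      rw [← Matrix.add_mul]; exact e.symm
    rw [e']
    conv_lhs => rw [e'']
    abel
  have h2 : ∀ i, (θ.loading * (θ.factorCov * θ.loadingᵀ * θ.sigmaZZ⁻¹ * Λs)) i k - Λs i k =
      -(θ.idioVar i * Y i k) := fun i => by
    rw [← Matrix.sub_apply, h1, Matrix.neg_apply, sigmaEE, diagonal_mul]
  have h3 : Λsᵀ * θ.sigmaZZ⁻¹ * Λs = Yᵀ * θ.sigmaZZ * Y := by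
    rw [hY, transpose_mul, hzt, Matrix.mul_assoc _ θ.sigmaZZ, ← Matrix.mul_assoc θ.sigmaZZ,
      mul_nonsing_inv _ hz, Matrix.one_mul, Matrix.mul_assoc]
  have h4 : (Yᵀ * θ.sigmaZZ * Y) k k =
      (Yᵀ * (θ.loading * θ.factorCov * θ.loadingᵀ) * Y) k k + ∑ i, θ.idioVar i * Y i k ^ 2 := by
    rw [sigmaZZ, Matrix.mul_add, Matrix.add_mul, Matrix.add_apply]
    congr 1
    rw [mul_apply]
    refine Finset.sum_congr rfl fun i _ => ?_
    rw [sigmaEE, mul_diagonal, transpose_apply]; ring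
  have h5 := (hM.mul_mul_transpose θ.loading).transpose_mul_mul Y |>.diag_nonneg (i := k)
  have hc0 : ∀ i, θ.idioVar i ^ 2 ≤ c * θ.idioVar i := fun i => by nlinarith [hd i, hdc i]
  rw [h3, h4]
  rcases Nat.eq_zero_or_pos N with hN | hN
  · subst hN; simp [mul_apply]
  have hc : 0 ≤ c := (hd ⟨0, hN⟩).le.trans (hdc _)
  calc ∑ i, ((θ.loading * (θ.factorCov * θ.loadingᵀ * θ.sigmaZZ⁻¹ * Λs)) i k - Λs i k) ^ 2
      = ∑ i, θ.idioVar i ^ 2 * Y i k ^ 2 := Finset.sum_congr rfl fun i _ => by rw [h2]; ring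
    _ ≤ ∑ i, c * θ.idioVar i * Y i k ^ 2 :=
        Finset.sum_le_sum fun i _ => mul_le_mul_of_nonneg_right (hc0 i) (sq_nonneg _)
    _ = c * ∑ i, θ.idioVar i * Y i k ^ 2 := by
        rw [Finset.mul_sum]; exact Finset.sum_congr rfl fun i _ => by ring
    _ ≤ _ := mul_le_mul_of_nonneg_left (by linarith) hc

end FactorParam

/-- The indicator of the index `k`, the zero vector if `k` is out of range. -/
def indexVec (N k : ℕ) : Fin N → ℝ := fun i => if (i : ℕ) = k then 1 else 0

/-- True parameter values `θs` and second moment matrices `S` along a filter: the normalized moments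
converge, and the deviations `S - Σ_zz` are negligible on average and in each row. -/
structure FactorRegime {ι : Type*} {r : ℕ} (l : Filter ι) (N : ι → ℕ) (c : ℝ)
    (θs : (x : ι) → FactorParam (N x) r) (S : (x : ι) → Matrix (Fin (N x)) (Fin (N x)) ℝ)
    (Mbar Q : Matrix (Fin r) (Fin r) ℝ) : Prop where
  tendsto_dim : Tendsto N l atTop
  const_pos : 0 < c
  loading_sq_le : ∀ x i k, (θs x).loading i k ^ 2 ≤ c
  idioVar_mem : ∀ x i, (θs x).idioVar i ∈ Set.Icc c⁻¹ c
  factorCov_psd : ∀ x, (θs x).factorCov.PosSemidef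
  posDef_factor : Mbar.PosDef
  tendsto_factorCov : Tendsto (fun x => (θs x).factorCov) l (𝓝 Mbar)
  posDef_loading : Q.PosDef
  tendsto_loadingCov : Tendsto (fun x => (θs x).loadingCov) l (𝓝 Q)
  moment_psd : ∀ x, (S x).PosSemidef
  tendsto_sq : Tendsto (fun x => ((N x : ℝ) ^ 2)⁻¹ *
    ∑ i, ∑ j, (S x - (θs x).sigmaZZ) i j ^ 2) l (𝓝 0)
  tendsto_diag : Tendsto (fun x => (N x : ℝ)⁻¹ * ∑ i, |(S x - (θs x).sigmaZZ) i i|) l (𝓝 0)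
  tendsto_row : ∀ k : ℕ, Tendsto (fun x => (N x : ℝ)⁻¹ *
    ∑ i, (((S x - (θs x).sigmaZZ) *ᵥ indexVec (N x) k) i) ^ 2) l (𝓝 0)

/-- Parameter values in the basic parameter set that are at least as likely as the true ones. -/
structure DominatesTruth {ι : Type*} {r : ℕ} (l : Filter ι) (N : ι → ℕ) (c : ℝ)
    (θs : (x : ι) → FactorParam (N x) r) (S : (x : ι) → Matrix (Fin (N x)) (Fin (N x)) ℝ)
    (θ : (x : ι) → FactorParam (N x) r) : Prop where
  idioVar_mem : ∀ᶠ x in l, ∀ i, (θ x).idioVar i ∈ Set.Icc c⁻¹ c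
  factorCov_psd : ∀ᶠ x in l, (θ x).factorCov.PosSemidef
  logLik_le : ∀ᶠ x in l, FactorParam.logLik (S x) (θs x) ≤ FactorParam.logLik (S x) (θ x)

namespace FactorRegime

variable {ι : Type*} {r : ℕ} {l : Filter ι} {N : ι → ℕ} {c : ℝ}
  {θs : (x : ι) → FactorParam (N x) r} {S : (x : ι) → Matrix (Fin (N x)) (Fin (N x)) ℝ}
  {Mbar Q : Matrix (Fin r) (Fin r) ℝ} {θ : (x : ι) → FactorParam (N x) r}

section

variable (H : FactorRegime l N c θs S Mbar Q)
include H

theorem dim_pos : ∀ᶠ x in l, 0 < N x := H.tendsto_dim.eventually_gt_atTop 0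

theorem tendsto_inv_dim : Tendsto (fun x => (N x : ℝ)⁻¹) l (𝓝 0) :=
  tendsto_inv_atTop_zero.comp (tendsto_natCast_atTop_atTop.comp H.tendsto_dim)

theorem tendsto_det_one_add : Tendsto (fun x =>
    ((N x : ℝ)⁻¹ • 1 + (θs x).factorCov * (θs x).loadingCov).det) l (𝓝 (Mbar * Q).det) := by
  have h1 : Tendsto (fun x => (N x : ℝ)⁻¹ • (1 : Matrix (Fin r) (Fin r) ℝ)) l (𝓝 0) := by
    simpa using H.tendsto_inv_dim.smul_const (1 : Matrix (Fin r) (Fin r) ℝ)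
  simpa using (h1.add (H.tendsto_factorCov.mul H.tendsto_loadingCov)).matrix_det

theorem tendsto_logDet : Tendsto (fun x => (N x : ℝ)⁻¹ *
    Real.log (1 + (θs x).factorCov * (θs x).gram).det) l (𝓝 0) := by
  have hdet : 0 < (Mbar * Q).det := by
    rw [det_mul]; exact mul_pos H.posDef_factor.det_pos H.posDef_loading.det_pos
  have h1 := H.tendsto_det_one_add
  have h2 := (H.tendsto_inv_dim.mul (h1.log hdet.ne'))
  have h3 : Tendsto (fun x => (N x : ℝ)⁻¹ * (r * Real.log (N x))) l (𝓝 0) := by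
    have h4 : Tendsto (fun y : ℝ => Real.log y / y) atTop (𝓝 0) :=
      Real.isLittleO_log_id_atTop.tendsto_div_nhds_zero
    have h5 := (h4.comp (tendsto_natCast_atTop_atTop.comp H.tendsto_dim)).const_mul (r : ℝ)
    rw [mul_zero] at h5
    refine h5.congr fun x => ?_
    simp only [Function.comp_apply, div_eq_mul_inv]
    ring
  have h6 := h3.add h2
  rw [zero_mul, add_zero] at h6
  refine h6.congr' ?_
  filter_upwards [H.dim_pos, h1.eventually_const_lt hdet] with x hx hx2
  have hN : (0 : ℝ) < N x := by exact_mod_cast hx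
  rw [FactorParam.det_one_add_mul_gram hx, Real.log_mul (by positivity) hx2.ne', Real.log_pow]
  ring

theorem tendsto_divergence (hθ : DominatesTruth l N c θs S θ) :
    Tendsto (fun x => (N x : ℝ)⁻¹ * ∑ i, ((θs x).idioVar i / (θ x).idioVar i - 1 -
        Real.log ((θs x).idioVar i / (θ x).idioVar i))) l (𝓝 0) ∧
      Tendsto (fun x => (N x : ℝ)⁻¹ *
        ((θs x).factorCov * ((θs x).loadingᵀ * (θ x).sigmaZZ⁻¹ * (θs x).loading)).trace)
        l (𝓝 0) := by
  have hc := H.const_pos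
  have hbound : Tendsto (fun x => (N x : ℝ)⁻¹ * (2 * (c * ∑ i, |(S x - (θs x).sigmaZZ) i i| +
        √(∑ i, ∑ j, (S x - (θs x).sigmaZZ) i j ^ 2) * (c * √r)) + c ^ 2 * r +
        Real.log (1 + (θs x).factorCov * (θs x).gram).det)) l (𝓝 0) := by
    have h1 := (((H.tendsto_diag.const_mul c).add (H.tendsto_sq.sqrt.mul_const (c * √r))).const_mul
      2).add ((H.tendsto_inv_dim.mul_const (c ^ 2 * r)).add H.tendsto_logDet)
    simp only [mul_zero, Real.sqrt_zero, zero_mul, add_zero] at h1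
    refine h1.congr fun x => ?_
    have : √(((N x : ℝ) ^ 2)⁻¹ * ∑ i, ∑ j, (S x - (θs x).sigmaZZ) i j ^ 2) =
        (N x : ℝ)⁻¹ * √(∑ i, ∑ j, (S x - (θs x).sigmaZZ) i j ^ 2) := by
      rw [Real.sqrt_mul (by positivity), ← inv_pow, Real.sqrt_sq (by positivity)]
    rw [this]
    ring
  have hpos : ∀ᶠ x in l, (∀ i, 0 < (θ x).idioVar i) := hθ.idioVar_mem.mono fun x hx i =>
    (inv_pos.2 hc).trans_le (hx i).1
  have hspos : ∀ x i, 0 < (θs x).idioVar i := fun x i =>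
    (inv_pos.2 hc).trans_le (H.idioVar_mem x i).1
  have hA : ∀ᶠ x in l, 0 ≤ ∑ i, ((θs x).idioVar i / (θ x).idioVar i - 1 -
        Real.log ((θs x).idioVar i / (θ x).idioVar i)) := hpos.mono fun x hx =>
    Finset.sum_nonneg fun i _ => sub_one_sub_log_nonneg (div_pos (hspos x i) (hx i))
  have hB : ∀ᶠ x in l, 0 ≤
      ((θs x).factorCov * ((θs x).loadingᵀ * (θ x).sigmaZZ⁻¹ * (θs x).loading)).trace := by
    filter_upwards [hpos, hθ.factorCov_psd] with x h1 h2
    exact (H.factorCov_psd x).trace_mul_nonneg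
      ((FactorParam.posDef_sigmaZZ h1 h2).inv.posSemidef.transpose_mul_mul _)
  have hall := H.dim_pos.and (hθ.idioVar_mem.and (hθ.factorCov_psd.and hθ.logLik_le))
  have hN : ∀ x, (0 : ℝ) ≤ (N x : ℝ)⁻¹ := fun x => by positivity
  constructor
  · refine squeeze_zero' (hA.mono fun x hx => mul_nonneg (hN x) hx) ?_ hbound
    filter_upwards [hall, hB] with x h1 h2
    have := FactorParam.divergence_le hc h1.1 (H.idioVar_mem x) h1.2.1 (H.factorCov_psd x) h1.2.2.1
      h1.2.2.2
    exact mul_le_mul_of_nonneg_left (by linarith) (hN x)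
  · refine squeeze_zero' (hB.mono fun x hx => mul_nonneg (hN x) hx) ?_ hbound
    filter_upwards [hall, hA] with x h1 h2
    have := FactorParam.divergence_le hc h1.1 (H.idioVar_mem x) h1.2.1 (H.factorCov_psd x) h1.2.2.1
      h1.2.2.2
    exact mul_le_mul_of_nonneg_left (by linarith) (hN x)

/-- The idiosyncratic variances are estimated consistently on average. -/
theorem tendsto_idioVar (hθ : DominatesTruth l N c θs S θ) :
    Tendsto (fun x => (N x : ℝ)⁻¹ * ∑ i, ((θ x).idioVar i - (θs x).idioVar i) ^ 2) l (𝓝 0) := by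
  have hc := H.const_pos
  have h1 := (H.tendsto_divergence hθ).1.const_mul (c ^ 2 * (2 * (c ^ 2 + 1)))
  rw [mul_zero] at h1
  refine squeeze_zero' (.of_forall fun x => avg_sq_nonneg _ _) ?_ h1
  filter_upwards [hθ.idioVar_mem] with x hx
  have e : c ^ 2 * (2 * (c ^ 2 + 1)) * ((N x : ℝ)⁻¹ * ∑ i, ((θs x).idioVar i / (θ x).idioVar i - 1 -
        Real.log ((θs x).idioVar i / (θ x).idioVar i))) = (N x : ℝ)⁻¹ * ∑ i, c ^ 2 *
        (2 * (c ^ 2 + 1)) * ((θs x).idioVar i / (θ x).idioVar i - 1 -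
        Real.log ((θs x).idioVar i / (θ x).idioVar i)) := by
    rw [← Finset.mul_sum]; ring
  rw [e]
  refine mul_le_mul_of_nonneg_left (Finset.sum_le_sum fun i _ => ?_) (by positivity)
  set d := (θ x).idioVar i
  set s := (θs x).idioVar i
  have hd : 0 < d := (inv_pos.2 hc).trans_le (hx i).1
  have hs : 0 < s := (inv_pos.2 hc).trans_le (H.idioVar_mem x i).1
  have hdc : d ≤ c := (hx i).2
  have hsc : s ≤ c := (H.idioVar_mem x i).2
  have hcd : 1 ≤ c * d := by
    have := mul_le_mul_of_nonneg_left (hx i).1 hc.le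
    rwa [mul_inv_cancel₀ hc.ne'] at this
  have hy : 0 < s / d := div_pos hs hd
  have hy2 : s / d ≤ c ^ 2 := by
    rw [div_le_iff₀ hd]; nlinarith
  have h2 := sq_sub_one_div_le_sub_one_sub_log hy
  rw [div_le_iff₀ (by positivity)] at h2
  have h3 := sub_one_sub_log_nonneg hy
  set φ := s / d - 1 - Real.log (s / d)
  have h4 : (d - s) ^ 2 = d ^ 2 * (s / d - 1) ^ 2 := by field_simp; ring
  have h5 : (s / d - 1) ^ 2 ≤ 2 * (c ^ 2 + 1) * φ := by nlinarith
  rw [h4]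
  calc d ^ 2 * (s / d - 1) ^ 2 ≤ c ^ 2 * (2 * (c ^ 2 + 1) * φ) := by gcongr
    _ = _ := by ring

theorem tendsto_loading_inv_loading (hθ : DominatesTruth l N c θs S θ) :
    Tendsto (fun x => (N x : ℝ)⁻¹ • ((θs x).loadingᵀ * (θ x).sigmaZZ⁻¹ * (θs x).loading))
      l (𝓝 0) := by
  have hc := H.const_pos
  obtain ⟨b, hb, hbx⟩ := H.tendsto_factorCov.eventually_posDef_bound H.posDef_factor
  have hpsd : ∀ᶠ x in l, ((θs x).loadingᵀ * (θ x).sigmaZZ⁻¹ * (θs x).loading).PosSemidef := by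
    filter_upwards [hθ.idioVar_mem, hθ.factorCov_psd] with x h1 h2
    have hz := FactorParam.posDef_sigmaZZ (fun i => (inv_pos.2 hc).trans_le (h1 i).1) h2
    exact hz.inv.posSemidef.transpose_mul_mul _
  have hN : ∀ x, (0 : ℝ) ≤ (N x : ℝ)⁻¹ := fun x => by positivity
  refine tendsto_zero_of_trace (hpsd.mono fun x hx => hx.smul (hN x)) ?_
  have h1 := (H.tendsto_divergence hθ).2.const_mul b⁻¹
  rw [mul_zero] at h1
  refine squeeze_zero' (hpsd.mono fun x hx => (hx.smul (hN x)).trace_nonneg) ?_ h1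
  filter_upwards [hpsd, hbx] with x h2 h3
  have h4 := h2.mul_trace_le_trace_mul h3
  rw [trace_smul, smul_eq_mul, mul_left_comm]
  refine mul_le_mul_of_nonneg_left ?_ (by positivity)
  rwa [le_inv_mul_iff₀ hb]

/-- The loading matrices agree on average up to a linear transformation. -/
theorem meanSqClose_loading_mul (hθ : DominatesTruth l N c θs S θ) :
    MeanSqClose l (fun x => (θ x).loading * ((θ x).factorCov * (θ x).loadingᵀ * (θ x).sigmaZZ⁻¹ *
      (θs x).loading)) (fun x => (θs x).loading) := fun k => by
  have hc := H.const_pos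
  have h1 := (tendsto_matrix_iff.1 (H.tendsto_loading_inv_loading hθ) k k).const_mul c
  simp only [Matrix.zero_apply, mul_zero] at h1
  refine squeeze_zero' (.of_forall fun x => avg_sq_nonneg _ _) ?_ h1
  filter_upwards [hθ.idioVar_mem, hθ.factorCov_psd] with x h2 h3
  have := FactorParam.sum_sq_sub_loading_mul_le (fun i => (inv_pos.2 hc).trans_le (h2 i).1)
    (fun i => (h2 i).2) h3 (θs x).loading k
  rw [Matrix.smul_apply, smul_eq_mul, mul_left_comm]
  exact mul_le_mul_of_nonneg_left this (by positivity)

end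

end FactorRegime

theorem sq_inv_sub_inv_le {a b c : ℝ} (hc : 0 < c) (ha : c⁻¹ ≤ a) (hb : c⁻¹ ≤ b) :
    (a⁻¹ - b⁻¹) ^ 2 ≤ c ^ 4 * (a - b) ^ 2 := by
  have ha0 : 0 < a := (inv_pos.2 hc).trans_le ha
  have hb0 : 0 < b := (inv_pos.2 hc).trans_le hb
  have ha1 : a⁻¹ ≤ c := inv_le_of_inv_le₀ hc ha
  have hb1 : b⁻¹ ≤ c := inv_le_of_inv_le₀ hc hb
  have h : a⁻¹ - b⁻¹ = -(a⁻¹ * b⁻¹ * (a - b)) := by field_simp; ring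
  have h2 : a⁻¹ * b⁻¹ ≤ c * c := mul_le_mul ha1 hb1 (inv_pos.2 hb0).le hc.le
  have h3 : (a⁻¹ * b⁻¹) ^ 2 ≤ (c * c) ^ 2 := pow_le_pow_left₀ (by positivity) h2 2
  calc (a⁻¹ - b⁻¹) ^ 2 = (a⁻¹ * b⁻¹) ^ 2 * (a - b) ^ 2 := by rw [h]; ring
    _ ≤ (c * c) ^ 2 * (a - b) ^ 2 := mul_le_mul_of_nonneg_right h3 (sq_nonneg _)
    _ = _ := by ring

theorem neg_le_quadratic {n : Type*} [Fintype n] {b : ℝ} (hb : 0 < b) {U : Matrix n n ℝ}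
    (hU : ∀ q : n → ℝ, b * (q ⬝ᵥ q) ≤ q ⬝ᵥ (U *ᵥ q)) (q w : n → ℝ) :
    b / 2 * (q ⬝ᵥ q) - 2 / b * (w ⬝ᵥ w) ≤ q ⬝ᵥ (U *ᵥ q) + 2 * (q ⬝ᵥ w) := by
  have h1 : 0 ≤ ∑ i, (b * q i + 2 * w i) ^ 2 := Finset.sum_nonneg fun _ _ => sq_nonneg _
  have h2 : ∑ i, (b * q i + 2 * w i) ^ 2 =
      b ^ 2 * (q ⬝ᵥ q) + 4 * b * (q ⬝ᵥ w) + 4 * (w ⬝ᵥ w) := by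
    simp only [dotProduct, Finset.mul_sum, ← Finset.sum_add_distrib]
    exact Finset.sum_congr rfl fun i _ => by ring
  have h3 := hU q
  rw [h2] at h1
  have h4 : 0 ≤ b / 2 * (q ⬝ᵥ q) + 2 * (q ⬝ᵥ w) + 2 / b * (w ⬝ᵥ w) := by
    have : b / 2 * (q ⬝ᵥ q) + 2 * (q ⬝ᵥ w) + 2 / b * (w ⬝ᵥ w) =
      (b ^ 2 * (q ⬝ᵥ q) + 4 * b * (q ⬝ᵥ w) + 4 * (w ⬝ᵥ w)) / (2 * b) := by field_simp; ring
    rw [this]; positivity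
  linarith

theorem sq_le_dotProduct_self {n : Type*} [Fintype n] (q : n → ℝ) (j : n) : q j ^ 2 ≤ q ⬝ᵥ q := by
  have := Finset.single_le_sum (f := fun j => q j ^ 2) (fun _ _ => sq_nonneg _) (Finset.mem_univ j)
  simpa [dotProduct, sq] using this

namespace FactorParam

theorem gls_eq {N r : ℕ} {θ : FactorParam N r} (hN : 0 < N) :
    θ.gls = θ.loadingCov⁻¹ * ((N : ℝ)⁻¹ • (θ.loadingᵀ * θ.sigmaEE⁻¹)) := by
  have hN' : (N : ℝ) ≠ 0 := by positivity
  have hinv : ((N : ℝ)⁻¹ • θ.gram)⁻¹ = (N : ℝ) • θ.gram⁻¹ := by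
    by_cases hu : IsUnit θ.gram.det
    · have := Matrix.inv_smul' θ.gram (Units.mk0 (N : ℝ)⁻¹ (inv_ne_zero hN')) hu
      simpa [Units.smul_def] using this
    · have h2 : ¬ IsUnit ((N : ℝ)⁻¹ • θ.gram).det := by
        rw [det_smul]
        intro h
        exact hu (isUnit_of_mul_isUnit_right h)
      rw [nonsing_inv_apply_not_isUnit _ hu, nonsing_inv_apply_not_isUnit _ h2, smul_zero]
  rw [gls, loadingCov_eq, hinv, Matrix.mul_smul, Matrix.smul_mul, smul_smul,
    inv_mul_cancel₀ hN', one_smul, Matrix.mul_assoc]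

end FactorParam

theorem Filter.Tendsto.matrix_mulVec {ι m n : Type*} [Fintype n] {l : Filter ι}
    {A : ι → Matrix m n ℝ} {A₀ : Matrix m n ℝ} {v : ι → n → ℝ} {v₀ : n → ℝ}
    (hA : Tendsto A l (𝓝 A₀)) (hv : Tendsto v l (𝓝 v₀)) :
    Tendsto (fun x => A x *ᵥ v x) l (𝓝 (A₀ *ᵥ v₀)) :=
  ((continuous_fst.matrix_mulVec continuous_snd).tendsto (A₀, v₀)).comp (hA.prodMk_nhds hv)

theorem indexVec_val {N : ℕ} (i : Fin N) : indexVec N (i : ℕ) = Pi.single i 1 := by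
  ext j
  simp [indexVec, Pi.single_apply, Fin.ext_iff]

theorem sum_indexVec_sq_le (N k : ℕ) : ∑ i, indexVec N k i ^ 2 ≤ 1 := by
  by_cases hk : k < N
  · have : indexVec N k = Pi.single (⟨k, hk⟩ : Fin N) 1 := indexVec_val ⟨k, hk⟩
    rw [this]
    simp [Pi.single_apply]
  · have : ∀ i : Fin N, indexVec N k i = 0 := fun i => by
      have := i.2
      simp only [indexVec, ite_eq_right_iff]
      omega
    simp [this]

namespace FactorRegime

variable {ι : Type*} {r : ℕ} {l : Filter ι} {N : ι → ℕ} {c : ℝ}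
  {θs : (x : ι) → FactorParam (N x) r} {S : (x : ι) → Matrix (Fin (N x)) (Fin (N x)) ℝ}
  {Mbar Q : Matrix (Fin r) (Fin r) ℝ} {θ : (x : ι) → FactorParam (N x) r}

section

variable (H : FactorRegime l N c θs S Mbar Q)
include H

theorem idioVar_pos (x : ι) (i : Fin (N x)) : 0 < (θs x).idioVar i :=
  (inv_pos.2 H.const_pos).trans_le (H.idioVar_mem x i).1

theorem abs_loading_le (x : ι) (i : Fin (N x)) (k : Fin r) : |(θs x).loading i k| ≤ √c :=
  Real.abs_le_sqrt (H.loading_sq_le x i k)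

theorem meanSqBounded_loading : MeanSqBounded l fun x => (θs x).loading := fun k => by
  refine ⟨c, ?_⟩
  filter_upwards [H.dim_pos] with x hx
  have hN : (0 : ℝ) < N x := by exact_mod_cast hx
  rw [inv_mul_le_iff₀ hN]
  calc ∑ i, (θs x).loading i k ^ 2 ≤ ∑ _i : Fin (N x), c :=
        Finset.sum_le_sum fun i _ => H.loading_sq_le x i k
    _ = N x * c := by simp

theorem tendsto_weighted_gram
    (hd : ∀ᶠ x in l, ∀ i, (θ x).idioVar i ∈ Set.Icc c⁻¹ c)
    (hvar : Tendsto (fun x => (N x : ℝ)⁻¹ * ∑ i, ((θ x).idioVar i - (θs x).idioVar i) ^ 2) l (𝓝 0))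
    {A B : (x : ι) → Matrix (Fin (N x)) (Fin r) ℝ}
    (hA : MeanSqClose l A fun x => (θs x).loading) (hB : MeanSqClose l B fun x => (θs x).loading) :
    Tendsto (fun x => (N x : ℝ)⁻¹ • ((A x)ᵀ * (θ x).sigmaEE⁻¹ * B x)) l (𝓝 Q) := by
  have hc := H.const_pos
  have hbd := H.meanSqBounded_loading
  have hw : ∀ᶠ x in l, ∀ i, |((θ x).idioVar i)⁻¹| ≤ c := by
    filter_upwards [hd] with x hx i
    rw [abs_of_pos (inv_pos.2 ((inv_pos.2 hc).trans_le (hx i).1))]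
    exact inv_le_of_inv_le₀ hc (hx i).1
  have h1 := hA.tendsto_gram_sub hw hB hbd hbd
  have hdiff : Tendsto (fun x => (N x : ℝ)⁻¹ *
      ∑ i, (((θ x).idioVar i)⁻¹ - ((θs x).idioVar i)⁻¹) ^ 2) l (𝓝 0) := by
    refine squeeze_zero' (.of_forall fun x => avg_sq_nonneg _ _) ?_
      (by simpa using hvar.const_mul (c ^ 4))
    filter_upwards [hd] with x hx
    have e : c ^ 4 * ((N x : ℝ)⁻¹ * ∑ i, ((θ x).idioVar i - (θs x).idioVar i) ^ 2) =
        (N x : ℝ)⁻¹ * ∑ i, c ^ 4 * ((θ x).idioVar i - (θs x).idioVar i) ^ 2 := by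
      rw [← Finset.mul_sum]; ring
    rw [e]
    exact mul_le_mul_of_nonneg_left (Finset.sum_le_sum fun i _ =>
      sq_inv_sub_inv_le hc (hx i).1 (H.idioVar_mem x i).1) (by positivity)
  have h2 := tendsto_gram_weights_sub hdiff (.of_forall H.abs_loading_le) hbd
  have h3 := (h1.add h2).add H.tendsto_loadingCov
  rw [add_zero, zero_add] at h3
  refine h3.congr' ?_
  filter_upwards [hd] with x hx
  rw [FactorParam.sigmaEE_inv fun i => (inv_pos.2 hc).trans_le (hx i).1, FactorParam.loadingCov,
    FactorParam.sigmaEE_inv (H.idioVar_pos x)]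
  abel

/-- The deviations remain negligible when the idiosyncratic variances are included. -/
theorem tendsto_common_sq : Tendsto (fun x => ((N x : ℝ) ^ 2)⁻¹ * ∑ i, ∑ j,
    (S x - (θs x).loading * (θs x).factorCov * (θs x).loadingᵀ) i j ^ 2) l (𝓝 0) := by
  have hc := H.const_pos
  have h1 := (H.tendsto_sq.const_mul 2).add (H.tendsto_inv_dim.mul_const (2 * c ^ 2))
  rw [mul_zero, zero_mul, add_zero] at h1
  refine squeeze_zero' (.of_forall fun x => by positivity) ?_ h1
  filter_upwards [H.dim_pos] with x hx
  have hN : (0 : ℝ) < N x := by exact_mod_cast hx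
  have h2 : ∀ i j, (S x - (θs x).loading * (θs x).factorCov * (θs x).loadingᵀ) i j ^ 2 ≤
      2 * (S x - (θs x).sigmaZZ) i j ^ 2 + 2 * (if i = j then c ^ 2 else 0) := fun i j => by
    have e : (S x - (θs x).loading * (θs x).factorCov * (θs x).loadingᵀ) i j =
        (S x - (θs x).sigmaZZ) i j + (θs x).sigmaEE i j := by
      simp only [FactorParam.sigmaZZ, Matrix.sub_apply, Matrix.add_apply]; ring
    have h3 : (θs x).sigmaEE i j ^ 2 ≤ if i = j then c ^ 2 else 0 := by
      rw [FactorParam.sigmaEE, diagonal_apply]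
      split_ifs
      · exact pow_le_pow_left₀ (H.idioVar_pos x i).le (H.idioVar_mem x i).2 2
      · simp
    rw [e]
    nlinarith [sq_nonneg ((S x - (θs x).sigmaZZ) i j - (θs x).sigmaEE i j)]
  have h4 := Finset.sum_le_sum fun i (_ : i ∈ Finset.univ) =>
    Finset.sum_le_sum fun j (_ : j ∈ Finset.univ) => h2 i j
  have h5 : ∑ i : Fin (N x), ∑ j, (2 * (S x - (θs x).sigmaZZ) i j ^ 2 +
      2 * (if i = j then c ^ 2 else 0)) =
      2 * ∑ i, ∑ j, (S x - (θs x).sigmaZZ) i j ^ 2 + N x * (2 * c ^ 2) := by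
    simp [Finset.sum_add_distrib, ← Finset.mul_sum]
  rw [h5] at h4
  calc _ ≤ ((N x : ℝ) ^ 2)⁻¹ * (2 * ∑ i, ∑ j, (S x - (θs x).sigmaZZ) i j ^ 2 +
        N x * (2 * c ^ 2)) := mul_le_mul_of_nonneg_left h4 (by positivity)
    _ = _ := by field_simp

theorem tendsto_common_row (k : ℕ) : Tendsto (fun x => (N x : ℝ)⁻¹ * ∑ i,
    (((S x - (θs x).loading * (θs x).factorCov * (θs x).loadingᵀ) *ᵥ indexVec (N x) k) i) ^ 2)
    l (𝓝 0) := by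
  have hc := H.const_pos
  have h1 : Tendsto (fun x => (N x : ℝ)⁻¹ * ∑ i, (((θs x).sigmaEE *ᵥ indexVec (N x) k) i) ^ 2)
      l (𝓝 0) := by
    refine squeeze_zero (fun x => avg_sq_nonneg _ _) (fun x => ?_)
      (by simpa using H.tendsto_inv_dim.mul_const (c ^ 2))
    refine mul_le_mul_of_nonneg_left ?_ (by positivity)
    calc ∑ i, (((θs x).sigmaEE *ᵥ indexVec (N x) k) i) ^ 2
        ≤ ∑ i, c ^ 2 * indexVec (N x) k i ^ 2 := Finset.sum_le_sum fun i _ => by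
          rw [FactorParam.sigmaEE, mulVec_diagonal, mul_pow]
          exact mul_le_mul_of_nonneg_right
            (pow_le_pow_left₀ (H.idioVar_pos x i).le (H.idioVar_mem x i).2 2) (sq_nonneg _)
      _ ≤ c ^ 2 := by
          rw [← Finset.mul_sum]
          exact mul_le_of_le_one_right (sq_nonneg c) (sum_indexVec_sq_le _ _)
  refine (tendsto_avg_add_sq (H.tendsto_row k) h1).congr fun x => ?_
  congr 1
  refine Finset.sum_congr rfl fun i _ => ?_
  have e : S x - (θs x).loading * (θs x).factorCov * (θs x).loadingᵀ =
      (S x - (θs x).sigmaZZ) + (θs x).sigmaEE := by rw [FactorParam.sigmaZZ]; abel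
  rw [e, add_mulVec, Pi.add_apply]

end

/-- Along the filter, `θ` has consistent idiosyncratic variances and loadings (on average). -/
structure AvgConsistent (l : Filter ι) (N : ι → ℕ) (c : ℝ) (θs θ : (x : ι) → FactorParam (N x) r) :
    Prop where
  idioVar_mem : ∀ᶠ x in l, ∀ i, (θ x).idioVar i ∈ Set.Icc c⁻¹ c
  tendsto_idioVar : Tendsto (fun x => (N x : ℝ)⁻¹ *
    ∑ i, ((θ x).idioVar i - (θs x).idioVar i) ^ 2) l (𝓝 0)
  loading : MeanSqClose l (fun x => (θ x).loading) fun x => (θs x).loading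

section

variable (H : FactorRegime l N c θs S Mbar Q) (hθ : AvgConsistent l N c θs θ)
include H hθ

theorem tendsto_loadingCov_of_avgConsistent : Tendsto (fun x => (θ x).loadingCov) l (𝓝 Q) :=
  H.tendsto_weighted_gram hθ.idioVar_mem hθ.tendsto_idioVar hθ.loading hθ.loading

theorem idioVar_pos_of_avgConsistent : ∀ᶠ x in l, ∀ i, 0 < (θ x).idioVar i :=
  hθ.idioVar_mem.mono fun _ hx i => (inv_pos.2 H.const_pos).trans_le (hx i).1

theorem tendsto_inv_loadingCov : Tendsto (fun x => (θ x).loadingCov⁻¹) l (𝓝 Q⁻¹) :=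
  (H.tendsto_loadingCov_of_avgConsistent hθ).matrix_inv H.posDef_loading.det_pos.ne'

theorem tendsto_gls_mul_loading :
    Tendsto (fun x => (θ x).gls * (θs x).loading) l (𝓝 1) := by
  have h1 := H.tendsto_weighted_gram hθ.idioVar_mem hθ.tendsto_idioVar hθ.loading
    (B := fun x => (θs x).loading) (fun k => by simp [tendsto_const_nhds])
  have h2 := (H.tendsto_inv_loadingCov hθ).mul h1
  rw [nonsing_inv_mul _ H.posDef_loading.det_pos.ne'.isUnit] at h2
  refine h2.congr' ?_
  filter_upwards [H.dim_pos] with x hx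
  rw [FactorParam.gls_eq hx, Matrix.mul_assoc (θ x).loadingCov⁻¹, Matrix.smul_mul]

theorem meanSqBounded_weighted : MeanSqBounded l fun x => (θ x).sigmaEE⁻¹ * (θ x).loading :=
  fun k => by
  have hc := H.const_pos
  obtain ⟨b, hb⟩ := hθ.loading.bounded H.meanSqBounded_loading k
  refine ⟨c ^ 2 * b, ?_⟩
  filter_upwards [hb, hθ.idioVar_mem] with x h1 h2
  rw [FactorParam.sigmaEE_inv fun i => (inv_pos.2 hc).trans_le (h2 i).1]
  refine le_trans ?_ (mul_le_mul_of_nonneg_left h1 (sq_nonneg c))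
  rw [mul_left_comm (c ^ 2), Finset.mul_sum (a := c ^ 2)]
  refine mul_le_mul_of_nonneg_left (Finset.sum_le_sum fun i _ => ?_) (by positivity)
  rw [diagonal_mul, mul_pow]
  refine mul_le_mul_of_nonneg_right (pow_le_pow_left₀ ?_ ?_ 2) (sq_nonneg _)
  · exact (inv_pos.2 ((inv_pos.2 hc).trans_le (h2 i).1)).le
  · exact inv_le_of_inv_le₀ hc (h2 i).1

theorem tendsto_gls_noise_gls : Tendsto (fun x => (θ x).gls *
    (S x - (θs x).loading * (θs x).factorCov * (θs x).loadingᵀ) * (θ x).glsᵀ) l (𝓝 0) := by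
  have hbd := H.meanSqBounded_weighted hθ
  have h1 : Tendsto (fun x => ((N x : ℝ) ^ 2)⁻¹ • (((θ x).sigmaEE⁻¹ * (θ x).loading)ᵀ *
      (S x - (θs x).loading * (θs x).factorCov * (θs x).loadingᵀ) *
      ((θ x).sigmaEE⁻¹ * (θ x).loading))) l (𝓝 0) := by
    refine tendsto_matrix_iff.2 fun k k' => ?_
    refine (tendsto_avg_avg_mul H.tendsto_common_sq (hbd k) (hbd k')).congr fun x => ?_
    rw [Matrix.smul_apply, smul_eq_mul, mul_apply]
    congr 1
    rw [Finset.sum_comm]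
    refine Finset.sum_congr rfl fun j _ => ?_
    rw [mul_apply, Finset.sum_mul]
    rfl
  have hki := H.tendsto_inv_loadingCov hθ
  have h2 := (hki.mul h1).mul hki.matrix_transpose
  rw [mul_zero, zero_mul] at h2
  refine h2.congr' ?_
  filter_upwards [H.dim_pos, H.idioVar_pos_of_avgConsistent hθ] with x hx hd
  have hDt : ((θ x).sigmaEE⁻¹)ᵀ = (θ x).sigmaEE⁻¹ :=
    (FactorParam.posDef_sigmaEE hd).inv.posSemidef.transpose_eq
  rw [FactorParam.gls_eq hx]
  simp only [transpose_mul, transpose_smul, transpose_transpose, hDt, Matrix.mul_smul,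
    Matrix.smul_mul, smul_smul, Matrix.mul_assoc]
  congr 1
  rw [sq, mul_inv]

theorem tendsto_gls_noise_row (k : ℕ) : Tendsto (fun x => (θ x).gls *ᵥ
    ((S x - (θs x).loading * (θs x).factorCov * (θs x).loadingᵀ) *ᵥ indexVec (N x) k)) l (𝓝 0) := by
  have hbd := H.meanSqBounded_weighted hθ
  have h1 : Tendsto (fun x => (N x : ℝ)⁻¹ • (((θ x).sigmaEE⁻¹ * (θ x).loading)ᵀ *ᵥ
      ((S x - (θs x).loading * (θs x).factorCov * (θs x).loadingᵀ) *ᵥ indexVec (N x) k)))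
      l (𝓝 0) := by
    refine tendsto_pi_nhds.2 fun a => ?_
    have := tendsto_avg_mul_of_tendsto_avg_sq (w := fun _ _ => 1) (c := 1)
      (.of_forall fun x i => by simp) (H.tendsto_common_row k) (hbd a)
    refine this.congr fun x => ?_
    rw [Pi.smul_apply, smul_eq_mul]
    congr 1
    refine Finset.sum_congr rfl fun i _ => ?_
    rw [one_mul, mul_comm]
    rfl
  have hki := H.tendsto_inv_loadingCov hθ
  have h2 := hki.matrix_mulVec h1
  rw [mulVec_zero] at h2
  refine h2.congr' ?_
  filter_upwards [H.dim_pos, H.idioVar_pos_of_avgConsistent hθ] with x hx hd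
  have hDt : ((θ x).sigmaEE⁻¹)ᵀ = (θ x).sigmaEE⁻¹ :=
    (FactorParam.posDef_sigmaEE hd).inv.posSemidef.transpose_eq
  rw [FactorParam.gls_eq hx, ← mulVec_mulVec, transpose_mul, hDt, smul_mulVec]

/-- The second moments of the estimated factor scores converge to those of the factors. -/
theorem tendsto_scoreCov : Tendsto (fun x => (θ x).gls * S x * (θ x).glsᵀ) l (𝓝 Mbar) := by
  have h1 := H.tendsto_gls_mul_loading hθ
  have h2 := ((h1.mul H.tendsto_factorCov).mul h1.matrix_transpose).add (H.tendsto_gls_noise_gls hθ)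
  simp only [one_mul, transpose_one, mul_one, add_zero] at h2
  refine h2.congr fun x => ?_
  have e : (θ x).gls * (θs x).loading * (θs x).factorCov * ((θ x).gls * (θs x).loading)ᵀ =
      (θ x).gls * ((θs x).loading * (θs x).factorCov * (θs x).loadingᵀ) * (θ x).glsᵀ := by
    simp only [transpose_mul, Matrix.mul_assoc]
  rw [e, ← Matrix.add_mul, ← Matrix.mul_add, add_sub_cancel]

theorem tendsto_score_row (k : ℕ) : Tendsto (fun x =>
    ((θ x).gls * S x * (θ x).glsᵀ) *ᵥ ((θs x).loadingᵀ *ᵥ indexVec (N x) k) -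
      (θ x).gls *ᵥ (S x *ᵥ indexVec (N x) k)) l (𝓝 0) := by
  have h1 := H.tendsto_gls_mul_loading hθ
  have h2 := (H.tendsto_scoreCov hθ).sub (h1.mul H.tendsto_factorCov)
  rw [one_mul, sub_self] at h2
  have hlam : ∀ x j, |((θs x).loadingᵀ *ᵥ indexVec (N x) k) j| ≤ √c := fun x j => by
    by_cases hk : k < N x
    · have : indexVec (N x) k = Pi.single (⟨k, hk⟩ : Fin (N x)) 1 := indexVec_val ⟨k, hk⟩
      rw [this, mulVec_single_one]
      exact H.abs_loading_le x _ _
    · have : indexVec (N x) k = 0 := by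
        ext i
        have := i.2
        simp only [indexVec, Pi.zero_apply, ite_eq_right_iff]
        omega
      rw [this, mulVec_zero]
      simp
  have h3 : Tendsto (fun x => ((θ x).gls * S x * (θ x).glsᵀ - (θ x).gls * (θs x).loading *
      (θs x).factorCov) *ᵥ ((θs x).loadingᵀ *ᵥ indexVec (N x) k)) l (𝓝 0) := by
    refine tendsto_pi_nhds.2 fun a => ?_
    have : ∀ b ∈ Finset.univ, Tendsto (fun x => ((θ x).gls * S x * (θ x).glsᵀ - (θ x).gls *
        (θs x).loading * (θs x).factorCov) a b * ((θs x).loadingᵀ *ᵥ indexVec (N x) k) b) l (𝓝 0) :=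
      fun b _ => (tendsto_matrix_iff.1 h2 a b).zero_mul_isBoundedUnder_le
        ⟨√c, by simpa using Eventually.of_forall fun x => hlam x b⟩
    have h := tendsto_finsetSum Finset.univ this
    rw [Finset.sum_const_zero] at h
    exact h
  have h4 := h3.sub (H.tendsto_gls_noise_row hθ k)
  rw [sub_zero] at h4
  refine h4.congr fun x => ?_
  rw [sub_mulVec, sub_mulVec, mulVec_sub]
  have e : ((θ x).gls * (θs x).loading * (θs x).factorCov) *ᵥ
      ((θs x).loadingᵀ *ᵥ indexVec (N x) k) = (θ x).gls *ᵥ (((θs x).loading * (θs x).factorCov *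
      (θs x).loadingᵀ) *ᵥ indexVec (N x) k) := by
    simp only [mulVec_mulVec, Matrix.mul_assoc]
  rw [e]
  abel

end

end FactorRegime

namespace FactorParam

/-- The parameter value with the first `m` loadings and the factor covariance of `θs`, and the
remaining loadings and the idiosyncratic variances of `θ`. -/
def splice {N r : ℕ} (m : ℕ) (θs θ : FactorParam N r) : FactorParam N r :=
  ⟨fun i => if (i : ℕ) < m then θs.loading i else θ.loading i, θ.idioVar, θs.factorCov⟩

end FactorParam

/-- Positive semidefinite matrices `Hx` converge to `Mbar⁻¹` when the divergence
`tr (Hx Ux) - log det (Hx Ux) - r` tends to zero and `Ux` tends to `Mbar`. -/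
theorem tendsto_inv_of_divergence {ι : Type*} {r : ℕ} {l : Ultrafilter ι}
    {Hx Ux : ι → Matrix (Fin r) (Fin r) ℝ} {Mbar : Matrix (Fin r) (Fin r) ℝ} (hM : Mbar.PosDef)
    (hH : ∀ᶠ x in l, (Hx x).PosDef) (hU : ∀ x, (Ux x).PosSemidef)
    (hUlim : Tendsto Ux l (𝓝 Mbar)) {δ : ι → ℝ} (hδ : Tendsto δ l (𝓝 0))
    (hle : ∀ᶠ x in l, (Hx x * Ux x).trace - Real.log (Hx x).det - Real.log (Ux x).det - r ≤ δ x) :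
    Tendsto Hx l (𝓝 Mbar⁻¹) := by
  choose V hV using fun x => (hU x).exists_transpose_mul_self
  have hVbdd : ∃ b : ℝ, ∀ᶠ x in l, ∀ i j, |V x i j| ≤ b := by
    obtain ⟨c, -, hc⟩ : ∃ c : ℝ, 0 < c ∧ ∀ᶠ x in l, (Ux x).trace ≤ c :=
      ⟨|Mbar.trace| + 1, by positivity, hUlim.matrix_trace.eventually_le_const
        (lt_of_le_of_lt (le_abs_self _) (lt_add_one _))⟩
    refine ⟨√c, ?_⟩
    filter_upwards [hc] with x hx i j
    refine Real.abs_le_sqrt (le_trans ?_ hx)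
    have h1 : Ux x j j = ∑ a, V x a j ^ 2 := by rw [hV x]; simp [mul_apply, sq]
    have h2 : V x i j ^ 2 ≤ Ux x j j := by
      rw [h1]
      exact Finset.single_le_sum (f := fun a => V x a j ^ 2) (fun _ _ => sq_nonneg _)
        (Finset.mem_univ i)
    exact h2.trans (Finset.single_le_sum (f := fun k => Ux x k k) (fun k _ => (hU x).diag_nonneg)
      (Finset.mem_univ j))
  obtain ⟨V₀, hV₀⟩ := l.exists_tendsto_matrix hVbdd
  have hV₀M : Mbar = V₀ᵀ * V₀ :=
    tendsto_nhds_unique hUlim ((hV₀.matrix_transpose.mul hV₀).congr fun x => (hV x).symm)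
  have hV₀det : V₀.det ≠ 0 := by
    have := hM.det_pos.ne'
    rw [hV₀M, det_mul] at this
    exact right_ne_zero_of_mul this
  have hVdet : ∀ᶠ x in l, (V x).det ≠ 0 := hV₀.matrix_det.eventually_ne hV₀det
  have hX : Tendsto (fun x => V x * Hx x * (V x)ᵀ) l (𝓝 1) := by
    have hb : Tendsto (fun x => √(12 * δ x)) l (𝓝 0) := by
      simpa using (hδ.const_mul 12).sqrt
    have h0 : Tendsto (fun x => V x * Hx x * (V x)ᵀ - 1) l (𝓝 0) := by
      refine tendsto_matrix_iff.2 fun i j => squeeze_zero_norm' ?_ hb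
      filter_upwards [hH, hVdet, hle, hδ.eventually_le_const zero_lt_one] with x h1 h2 h3 h4
      have hXpd : (V x * Hx x * (V x)ᵀ).PosDef := by
        have hp := h1.posSemidef.mul_mul_transpose (V x)
        refine hp.posDef_iff_det_ne_zero.2 ?_
        rw [det_mul, det_mul, det_transpose]
        exact mul_ne_zero (mul_ne_zero h2 h1.det_pos.ne') h2
      refine hXpd.abs_sub_one_apply_le h4 (le_trans (le_of_eq ?_) h3) i j
      have e1 : (V x * Hx x * (V x)ᵀ).trace = (Hx x * Ux x).trace := by
        rw [hV x, Matrix.mul_assoc, trace_mul_comm, Matrix.mul_assoc]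
      have e2 : (V x * Hx x * (V x)ᵀ).det = (Hx x).det * (Ux x).det := by
        rw [hV x, det_mul, det_mul, det_mul, det_transpose]; ring
      have e3 : (Ux x).det ≠ 0 := by
        rw [hV x, det_mul, det_transpose]; exact mul_ne_zero h2 h2
      rw [e1, e2, Real.log_mul h1.det_pos.ne' e3, Fintype.card_fin]
      ring
    simpa using h0.add_const 1
  have hVi := hV₀.matrix_inv hV₀det
  have h1 := (hVi.mul hX).mul hVi.matrix_transpose
  have e : V₀⁻¹ * 1 * (V₀⁻¹)ᵀ = Mbar⁻¹ := by
    rw [hV₀M, Matrix.mul_inv_rev, Matrix.mul_one, transpose_nonsing_inv]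
  rw [e] at h1
  refine h1.congr' ?_
  filter_upwards [hVdet] with x hx
  have hu : IsUnit (V x).det := hx.isUnit
  have hut : IsUnit ((V x)ᵀ).det := by rwa [det_transpose]
  rw [transpose_nonsing_inv]
  calc (V x)⁻¹ * (V x * Hx x * (V x)ᵀ) * ((V x)ᵀ)⁻¹
      = ((V x)⁻¹ * V x) * Hx x * ((V x)ᵀ * ((V x)ᵀ)⁻¹) := by simp only [Matrix.mul_assoc]
    _ = Hx x := by rw [nonsing_inv_mul _ hu, mul_nonsing_inv _ hut, Matrix.one_mul, Matrix.mul_one]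

namespace FactorParam

theorem factorCov_eq {N r : ℕ} {θ : FactorParam N r} (hd : ∀ i, 0 < θ.idioVar i)
    (hM : θ.factorCov.PosSemidef) (hK : IsUnit θ.gram.det) (hH : IsUnit θ.modelGram.det) :
    θ.factorCov = θ.modelGram⁻¹ - θ.gram⁻¹ := by
  have h1 := modelGram_mul hd hM
  have h2 : 1 + θ.factorCov * θ.gram = θ.modelGram⁻¹ * θ.gram := by
    have h2 := congrArg (θ.modelGram⁻¹ * ·) h1
    simpa only [← Matrix.mul_assoc, nonsing_inv_mul _ hH, Matrix.one_mul] using h2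
  have h3 := congrArg (· * θ.gram⁻¹) h2
  simp only [Matrix.add_mul, Matrix.mul_assoc, mul_nonsing_inv _ hK, Matrix.one_mul,
    Matrix.mul_one] at h3
  rw [← h3]
  abel

theorem gram_inv {N r : ℕ} {θ : FactorParam N r} (hN : 0 < N) (hK : IsUnit θ.loadingCov.det) :
    θ.gram⁻¹ = (N : ℝ)⁻¹ • θ.loadingCov⁻¹ := by
  have hN' : (N : ℝ) ≠ 0 := by positivity
  have : θ.gram = (N : ℝ) • θ.loadingCov := by
    rw [loadingCov_eq, smul_smul, mul_inv_cancel₀ hN', one_smul]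
  refine inv_eq_right_inv ?_
  rw [this, Matrix.smul_mul, Matrix.mul_smul, smul_smul, mul_inv_cancel₀ hN', one_smul,
    mul_nonsing_inv _ hK]

end FactorParam

namespace FactorRegime

variable {ι : Type*} {r : ℕ} {N : ι → ℕ} {c : ℝ}
  {θs : (x : ι) → FactorParam (N x) r} {S : (x : ι) → Matrix (Fin (N x)) (Fin (N x)) ℝ}
  {Mbar Q : Matrix (Fin r) (Fin r) ℝ} {θ : (x : ι) → FactorParam (N x) r}

theorem splice_avgConsistent {l : Filter ι} (hθ : AvgConsistent l N c θs θ) (m : ℕ) :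
    AvgConsistent l N c θs fun x => FactorParam.splice m (θs x) (θ x) where
  idioVar_mem := hθ.idioVar_mem
  tendsto_idioVar := hθ.tendsto_idioVar
  loading := fun k => by
    refine squeeze_zero (fun x => avg_sq_nonneg _ _) (fun x => ?_) (hθ.loading k)
    refine mul_le_mul_of_nonneg_left (Finset.sum_le_sum fun i _ => ?_) (by positivity)
    simp only [FactorParam.splice]
    split_ifs
    · simpa using sq_nonneg _
    · exact le_rfl

section

variable {l : Filter ι} (H : FactorRegime l N c θs S Mbar Q)
include H

theorem eventually_posDef_factorCov : ∀ᶠ x in l, (θs x).factorCov.PosDef := by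
  obtain ⟨b, hb, hbx⟩ := H.tendsto_factorCov.eventually_posDef_bound H.posDef_factor
  exact hbx.mono fun x hx => posDef_of_bound (H.factorCov_psd x).isHermitian hb hx

variable (hθ : AvgConsistent l N c θs θ)
include hθ

theorem eventually_posDef_gram : ∀ᶠ x in l, (θ x).gram.PosDef := by
  filter_upwards [(H.tendsto_loadingCov_of_avgConsistent hθ).matrix_det.eventually_ne
    H.posDef_loading.det_pos.ne', H.idioVar_pos_of_avgConsistent hθ, H.dim_pos] with x h1 h2 h3
  refine (FactorParam.gram_posSemidef h2).posDef_iff_det_ne_zero.2 ?_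
  rw [FactorParam.det_gram h3]
  exact mul_ne_zero (by positivity) h1

/-- The limit of the right-hand side of the profile inequality. -/
theorem tendsto_profile_bound (m : ℕ) : Tendsto (fun x =>
    Real.log (1 + (θs x).factorCov * (FactorParam.splice m (θs x) (θ x)).gram).det -
      Real.log (θ x).gram.det +
      (((θs x).factorCov)⁻¹ * ((θ x).gls * S x * (θ x).glsᵀ)).trace) l
    (𝓝 (Real.log Mbar.det + r)) := by
  have hMu : IsUnit Mbar.det := H.posDef_factor.det_pos.ne'.isUnit
  have hQ := H.posDef_loading.det_pos
  have h1 : Tendsto (fun x => (N x : ℝ)⁻¹ • (1 : Matrix (Fin r) (Fin r) ℝ)) l (𝓝 0) := by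
    simpa using H.tendsto_inv_dim.smul_const (1 : Matrix (Fin r) (Fin r) ℝ)
  have h2 := (h1.add (H.tendsto_factorCov.mul (H.tendsto_loadingCov_of_avgConsistent
    (splice_avgConsistent hθ m)))).matrix_det
  have h3 := (H.tendsto_loadingCov_of_avgConsistent hθ).matrix_det
  rw [zero_add, det_mul] at h2
  have hMQ : 0 < Mbar.det * Q.det := mul_pos H.posDef_factor.det_pos hQ
  have h4 := ((h2.log hMQ.ne').sub (h3.log hQ.ne')).add
    (((H.tendsto_factorCov.matrix_inv hMu.ne_zero).mul (H.tendsto_scoreCov hθ)).matrix_trace)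
  rw [nonsing_inv_mul _ hMu, trace_one, Fintype.card_fin,
    Real.log_mul H.posDef_factor.det_pos.ne' hQ.ne', add_sub_cancel_right] at h4
  refine h4.congr' ?_
  filter_upwards [H.dim_pos, h2.eventually_const_lt hMQ, h3.eventually_const_lt hQ] with x hN h5 h6
  have hNr : ((N x : ℝ) ^ r) ≠ 0 := by positivity
  rw [FactorParam.det_one_add_mul_gram hN, FactorParam.det_gram hN,
    Real.log_mul hNr h5.ne', Real.log_mul hNr h6.ne']
  ring

end

/-- If replacing the factor covariance and the first `m` loadings by the true ones does not increase
the likelihood, then the factor covariance and these loadings are consistent. -/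
theorem consistent_of_splice {l : Ultrafilter ι} (H : FactorRegime (l : Filter ι) N c θs S Mbar Q)
    (hθ : AvgConsistent (l : Filter ι) N c θs θ) (hpsd : ∀ᶠ x in l, (θ x).factorCov.PosSemidef)
    (m : ℕ) (hle : ∀ᶠ x in l, FactorParam.logLik (S x) (FactorParam.splice m (θs x) (θ x)) ≤
      FactorParam.logLik (S x) (θ x)) :
    Tendsto (fun x => (θ x).factorCov) l (𝓝 Mbar) ∧
      ∃ η : ι → ℝ, Tendsto η l (𝓝 0) ∧ ∀ᶠ x in l, ∀ i : Fin (N x), (i : ℕ) < m → ∀ j,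
        ((θ x).loading i j - (θs x).loading i j) ^ 2 ≤ η x := by
  have hc := H.const_pos
  set U : ι → Matrix (Fin r) (Fin r) ℝ := fun x => (θ x).gls * S x * (θ x).glsᵀ with hU
  have hUlim : Tendsto U l (𝓝 Mbar) := H.tendsto_scoreCov hθ
  have hUpsd : ∀ x, (U x).PosSemidef := fun x => (H.moment_psd x).mul_mul_transpose _
  obtain ⟨b, hb, hbx⟩ := hUlim.eventually_posDef_bound H.posDef_factor
  set w : ℕ → ι → Fin r → ℝ := fun k x =>
    U x *ᵥ ((θs x).loadingᵀ *ᵥ indexVec (N x) k) - (θ x).gls *ᵥ (S x *ᵥ indexVec (N x) k) with hw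
  have hwlim : ∀ k, Tendsto (w k) l (𝓝 0) := fun k => H.tendsto_score_row hθ k
  set ηw : ι → ℝ := fun x => ∑ k ∈ Finset.range m, w k x ⬝ᵥ w k x with hηw
  have hηwlim : Tendsto ηw l (𝓝 0) := by
    have h1 : ∀ k ∈ Finset.range m, Tendsto (fun x => w k x ⬝ᵥ w k x) l (𝓝 0) := fun k _ => by
      have h2 : ∀ j ∈ Finset.univ, Tendsto (fun x => w k x j * w k x j) l (𝓝 0) := fun j _ => by
        have := tendsto_pi_nhds.1 (hwlim k) j
        simpa using this.mul this
      have h := tendsto_finsetSum Finset.univ h2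
      rw [Finset.sum_const_zero] at h
      exact h
    have h := tendsto_finsetSum (Finset.range m) h1
    rwa [Finset.sum_const_zero] at h
  have hηw0 : ∀ x, 0 ≤ ηw x := fun x => Finset.sum_nonneg fun k _ =>
    Finset.sum_nonneg fun j _ => mul_self_nonneg _
  set δ : ι → ℝ := fun x =>
    (Real.log (1 + (θs x).factorCov * (FactorParam.splice m (θs x) (θ x)).gram).det -
      Real.log (θ x).gram.det + (((θs x).factorCov)⁻¹ * U x).trace) - r - Real.log (U x).det +
      m * (c * (2 / b)) * ηw x with hδ
  have hδlim : Tendsto δ l (𝓝 0) := by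
    have h1 := (((H.tendsto_profile_bound hθ m).sub_const (r : ℝ)).sub
      (hUlim.matrix_det.log H.posDef_factor.det_pos.ne')).add
      (hηwlim.const_mul (m * (c * (2 / b))))
    have e : Real.log Mbar.det + r - r - Real.log Mbar.det + m * (c * (2 / b)) * 0 = 0 := by ring
    rw [e] at h1
    exact h1
  have hHpd : ∀ᶠ x in l, (θ x).modelGram.PosDef := by
    filter_upwards [hpsd, H.eventually_posDef_gram hθ, H.idioVar_pos_of_avgConsistent hθ]
      with x h1 h2 h3
    refine (FactorParam.modelGram_posSemidef h3 h1).posDef_iff_det_ne_zero.2 fun h0 => ?_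
    have h4 := congrArg det (FactorParam.modelGram_mul h3 h1)
    rw [det_mul, h0, zero_mul] at h4
    exact h2.det_pos.ne h4
  have hmain : ∀ᶠ x in l,
      ((θ x).modelGram * U x).trace - Real.log (θ x).modelGram.det - Real.log (U x).det - r ≤ δ x ∧
      ∀ i : Fin (N x), (i : ℕ) < m → c⁻¹ * (b / 2) *
        (((θ x).loading i - (θs x).loading i) ⬝ᵥ ((θ x).loading i - (θs x).loading i)) ≤ δ x := by
    filter_upwards [hpsd, H.eventually_posDef_gram hθ, hθ.idioVar_mem, H.dim_pos, hle, hbx,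
      H.eventually_posDef_factorCov, hHpd] with x hps hK hd hN hle hbx hMs hHp
    have hdp : ∀ i, 0 < (θ x).idioVar i := fun i => (inv_pos.2 hc).trans_le (hd i).1
    have hineq := FactorParam.profile_le hN hdp hps hK (H.moment_psd x) hMs m (θs x).loading
      (θ' := FactorParam.splice m (θs x) (θ x)) rfl hle
    change ((θ x).modelGram * U x).trace - _ + _ ≤ _ - _ + (_ * U x).trace at hineq
    set q : Fin (N x) → Fin r → ℝ := fun i => (θ x).loading i - (θs x).loading i with hq
    have hwi : ∀ i : Fin (N x), U x *ᵥ (θs x).loading i - (θ x).gls *ᵥ (S x).col i = w i x :=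
      fun i => by
        rw [hw]
        simp only [indexVec_val, mulVec_single_one]
        rfl
    have hterm : ∀ i : Fin (N x), (i : ℕ) < m →
        c⁻¹ * (b / 2) * (q i ⬝ᵥ q i) - c * (2 / b) * ηw x ≤ ((θ x).idioVar i)⁻¹ *
          (q i ⬝ᵥ (U x *ᵥ q i) + 2 * (q i ⬝ᵥ (U x *ᵥ (θs x).loading i -
            (θ x).gls *ᵥ (S x).col i))) := fun i hi => by
      rw [hwi i]
      have h1 := neg_le_quadratic hb hbx (q i) (w i x)
      have h2 : w i x ⬝ᵥ w i x ≤ ηw x :=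
        Finset.single_le_sum (f := fun k => w k x ⬝ᵥ w k x)
          (fun k _ => Finset.sum_nonneg fun j _ => mul_self_nonneg _) (Finset.mem_range.2 hi)
      have h3 : ((θ x).idioVar i)⁻¹ ≤ c := inv_le_of_inv_le₀ hc (hd i).1
      have h4 : c⁻¹ ≤ ((θ x).idioVar i)⁻¹ := by
        rw [inv_le_inv₀ hc (hdp i)]; exact (hd i).2
      have h5 : 0 < ((θ x).idioVar i)⁻¹ := inv_pos.2 (hdp i)
      have h6 : 0 ≤ q i ⬝ᵥ q i := Finset.sum_nonneg fun j _ => mul_self_nonneg _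
      have h7 : 0 ≤ w i x ⬝ᵥ w i x := Finset.sum_nonneg fun j _ => mul_self_nonneg _
      have h8 : c⁻¹ * (b / 2 * (q i ⬝ᵥ q i)) ≤ ((θ x).idioVar i)⁻¹ * (b / 2 * (q i ⬝ᵥ q i)) :=
        mul_le_mul_of_nonneg_right h4 (by positivity)
      have h9 : ((θ x).idioVar i)⁻¹ * (2 / b * (w i x ⬝ᵥ w i x)) ≤ c * (2 / b * ηw x) :=
        mul_le_mul h3 (mul_le_mul_of_nonneg_left h2 (by positivity)) (by positivity) hc.le
      have h10 := mul_le_mul_of_nonneg_left h1 h5.le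
      linarith
    set s := Finset.univ.filter (fun i : Fin (N x) => (i : ℕ) < m) with hs
    have hcard : (s.card : ℝ) ≤ m := by
      have : s.card ≤ (Finset.range m).card :=
        Finset.card_le_card_of_injOn (fun i => (i : ℕ))
          (fun i hi => by simpa [hs] using hi) (fun i _ j _ h => Fin.ext h)
      rw [Finset.card_range] at this
      exact_mod_cast this
    set F : Fin (N x) → ℝ := fun i => ((θ x).idioVar i)⁻¹ *
          (q i ⬝ᵥ (U x *ᵥ q i) + 2 * (q i ⬝ᵥ (U x *ᵥ (θs x).loading i -
            (θ x).gls *ᵥ (S x).col i))) with hF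
    set κ := c * (2 / b) * ηw x with hκ
    have hκ0 : 0 ≤ κ := mul_nonneg (by positivity) (hηw0 x)
    have hqq : ∀ i, 0 ≤ c⁻¹ * (b / 2) * (q i ⬝ᵥ q i) := fun i =>
      mul_nonneg (by positivity) (Finset.sum_nonneg fun j _ => mul_self_nonneg _)
    have hFκ : ∀ i ∈ s, 0 ≤ F i + κ := fun i hi => by
      have := hterm i (by simpa [hs] using hi)
      linarith [hqq i]
    have hsum : ∑ i ∈ s, (F i + κ) ≤ ∑ i ∈ s, F i + m * κ := by
      rw [Finset.sum_add_distrib, Finset.sum_const, nsmul_eq_mul]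
      exact add_le_add_right (mul_le_mul_of_nonneg_right hcard hκ0) _
    have hmκ : (m : ℝ) * κ = m * (c * (2 / b)) * ηw x := by rw [hκ]; ring
    have hUdet : 0 < (U x).det := (posDef_of_bound (hUpsd x).isHermitian hb hbx).det_pos
    have hdiv : 0 ≤ ((θ x).modelGram * U x).trace - Real.log (θ x).modelGram.det -
        Real.log (U x).det - r := by
      obtain ⟨V, hV⟩ := (hUpsd x).exists_transpose_mul_self
      have hVdet : V.det ≠ 0 := by
        rw [hV, det_mul] at hUdet
        exact right_ne_zero_of_mul hUdet.ne'
      have hXpd : (V * (θ x).modelGram * Vᵀ).PosDef := by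
        refine (hHp.posSemidef.mul_mul_transpose V).posDef_iff_det_ne_zero.2 ?_
        rw [det_mul, det_mul, det_transpose]
        exact mul_ne_zero (mul_ne_zero hVdet hHp.det_pos.ne') hVdet
      have h1 := hXpd.trace_sub_log_det_nonneg
      have e1 : (V * (θ x).modelGram * Vᵀ).trace = ((θ x).modelGram * U x).trace := by
        rw [hV, Matrix.mul_assoc, trace_mul_comm, Matrix.mul_assoc]
      have e2 : (V * (θ x).modelGram * Vᵀ).det = (θ x).modelGram.det * (U x).det := by
        rw [hV, det_mul, det_mul, det_mul, det_transpose]; ring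
      rw [e1, e2, Real.log_mul hHp.det_pos.ne' hUdet.ne', Fintype.card_fin] at h1
      linarith
    have hδx : δ x = (Real.log (1 + (θs x).factorCov *
        (FactorParam.splice m (θs x) (θ x)).gram).det - Real.log (θ x).gram.det +
        (((θs x).factorCov)⁻¹ * U x).trace) - r - Real.log (U x).det +
        m * (c * (2 / b)) * ηw x := rfl
    have hineq' : ((θ x).modelGram * U x).trace - Real.log (θ x).modelGram.det + ∑ i ∈ s, F i ≤
        Real.log (1 + (θs x).factorCov * (FactorParam.splice m (θs x) (θ x)).gram).det -
          Real.log (θ x).gram.det + (((θs x).factorCov)⁻¹ * U x).trace := hineq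
    constructor
    · have := Finset.sum_nonneg hFκ
      rw [hδx]
      linarith
    · intro i hi
      have h1 := Finset.single_le_sum hFκ (by simpa [hs] using hi : i ∈ s)
      have h2 := hterm i hi
      rw [hδx]
      linarith
  constructor
  · have hHlim : Tendsto (fun x => (θ x).modelGram) l (𝓝 Mbar⁻¹) :=
      tendsto_inv_of_divergence H.posDef_factor hHpd hUpsd hUlim hδlim (hmain.mono fun x hx => hx.1)
    have hMi : Mbar⁻¹.det ≠ 0 := H.posDef_factor.inv.det_pos.ne'
    have h1 := (hHlim.matrix_inv hMi).sub
      (H.tendsto_inv_dim.smul (H.tendsto_inv_loadingCov hθ))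
    rw [zero_smul, sub_zero, nonsing_inv_nonsing_inv _ H.posDef_factor.det_pos.ne'.isUnit] at h1
    refine h1.congr' ?_
    filter_upwards [hpsd, H.eventually_posDef_gram hθ, H.idioVar_pos_of_avgConsistent hθ, hHpd,
      H.dim_pos, (H.tendsto_loadingCov_of_avgConsistent hθ).matrix_det.eventually_ne
        H.posDef_loading.det_pos.ne'] with x h2 h3 h4 h5 h6 h7
    rw [FactorParam.factorCov_eq h4 h2 h3.det_pos.ne'.isUnit h5.det_pos.ne'.isUnit,
      FactorParam.gram_inv h6 h7.isUnit]
  · refine ⟨fun x => (c⁻¹ * (b / 2))⁻¹ * δ x, by simpa using hδlim.const_mul (c⁻¹ * (b / 2))⁻¹, ?_⟩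
    filter_upwards [hmain] with x hx i hi j
    rw [le_inv_mul_iff₀ (by positivity)]
    refine le_trans (mul_le_mul_of_nonneg_left ?_ (by positivity)) (hx.2 i hi)
    exact sq_le_dotProduct_self ((θ x).loading i - (θs x).loading i) j

end FactorRegime

section LinearAlgebra

variable {r : ℕ}

/-- A nonsingular matrix that intertwines two diagonal matrices with decreasing entries is
diagonal. -/
theorem eq_zero_of_intertwines {A : Matrix (Fin r) (Fin r) ℝ} {d₁ d₂ : Fin r → ℝ}
    (h₁ : StrictAnti d₁) (h₂ : Antitone d₂) (hA : A.det ≠ 0)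
    (h : diagonal d₂ * A = A * diagonal d₁) {i j : Fin r} (hij : i ≠ j) : A i j = 0 := by
  have key : ∀ i j, A i j ≠ 0 → d₂ i = d₁ j := fun i j hne => by
    have := congrFun (congrFun h i) j
    rw [diagonal_mul, mul_diagonal, mul_comm] at this
    exact mul_left_cancel₀ hne this
  have hrow : ∀ i, ∃ j, A i j ≠ 0 := fun i => by
    by_contra! hz
    exact hA (det_eq_zero_of_row_eq_zero i hz)
  have hcol : ∀ j, ∃ i, A i j ≠ 0 := fun j => by
    by_contra! hz
    exact hA (det_eq_zero_of_column_eq_zero j hz)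
  choose σ hσ using hrow
  have huniq : ∀ i j, A i j ≠ 0 → j = σ i := fun i j hne =>
    h₁.injective ((key i j hne).symm.trans (key i _ (hσ i)))
  have hmono : Monotone σ := fun i i' hii => by
    rw [← h₁.le_iff_ge, ← key i _ (hσ i), ← key i' _ (hσ i')]
    exact h₂ hii
  have hsurj : Function.Surjective σ := fun j => by
    obtain ⟨i, hi⟩ := hcol j
    exact ⟨i, (huniq i j hi).symm⟩
  have hstrict : StrictMono σ :=
    hmono.strictMono_of_injective (Finite.injective_iff_surjective.2 hsurj)
  have hid : ∀ i, σ i = i := fun i => by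
    have := Subsingleton.elim (hstrict.orderIsoOfSurjective σ hsurj) (OrderIso.refl (Fin r))
    exact congrArg (fun e : Fin r ≃o Fin r => e i) this
  by_contra hne
  exact hij ((huniq i j hne).trans (hid i)).symm

/-- A nonsingular lower triangular matrix `A` with `A M A'` diagonal, `M` positive diagonal, is
diagonal. -/
theorem eq_zero_of_lowerTriangular {A M : Matrix (Fin r) (Fin r) ℝ}
    (hA : ∀ i j, i < j → A i j = 0) (hdet : A.det ≠ 0) (hM : M.IsDiag) (hMpos : ∀ i, 0 < M i i)
    (h : (A * M * Aᵀ).IsDiag) {i j : Fin r} (hij : i ≠ j) : A i j = 0 := by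
  rcases lt_or_gt_of_ne hij with hlt | hlt
  · exact hA i j hlt
  have hu : IsUnit A.det := hdet.isUnit
  have : Invertible A := A.invertibleOfIsUnitDet hu
  have htri : A.BlockTriangular OrderDual.toDual := fun a b hab => hA a b hab
  have hinv := blockTriangular_inv_of_blockTriangular htri
  have e1 : A * M = (A * M * Aᵀ) * (A⁻¹)ᵀ := by
    rw [Matrix.mul_assoc _ Aᵀ, ← transpose_mul, nonsing_inv_mul _ hu, transpose_one, Matrix.mul_one]
  have e2 := congrFun (congrFun e1 i) j
  rw [← hM.diagonal_diag, mul_diagonal, diag_apply] at e2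
  rw [hM.diagonal_diag, ← h.diagonal_diag, diagonal_mul, transpose_apply,
    hinv (show OrderDual.toDual i < OrderDual.toDual j from hlt), mul_zero] at e2
  exact (mul_eq_zero.1 e2).resolve_right (hMpos j).ne'

theorem lowerTriangular_mul_inv {A B : Matrix (Fin r) (Fin r) ℝ}
    (hA : ∀ i j, i < j → A i j = 0) (hdet : A.det ≠ 0) (hB : ∀ i j, i < j → B i j = 0) :
    ∀ i j, i < j → (A⁻¹ * B) i j = 0 := by
  have : Invertible A := A.invertibleOfIsUnitDet hdet.isUnit
  have htri : A.BlockTriangular OrderDual.toDual := fun a b hab => hA a b hab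
  have htriB : B.BlockTriangular OrderDual.toDual := fun a b hab => hB a b hab
  exact fun i j hij => (blockTriangular_inv_of_blockTriangular htri).mul htriB hij

theorem det_of_lowerTriangular' {A : Matrix (Fin r) (Fin r) ℝ}
    (hA : ∀ i j, i < j → A i j = 0) : A.det = ∏ i, A i i :=
  det_of_isLowerTriangular A fun a b hab => hA a b hab

end LinearAlgebra

namespace Matrix

theorem isDiag_of_tendsto {ι n : Type*} {l : Filter ι} [l.NeBot] {A : ι → Matrix n n ℝ}
    {A₀ : Matrix n n ℝ} (h : Tendsto A l (𝓝 A₀)) (hA : ∀ᶠ x in l, (A x).IsDiag) : A₀.IsDiag :=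
  fun i j hij => tendsto_nhds_unique (tendsto_matrix_iff.1 h i j)
    (tendsto_const_nhds.congr' (hA.mono fun _ hx => (hx hij).symm))

end Matrix

/-- The top square block of a loading matrix, completed by zeros. -/
def topBlock {N r : ℕ} (Λ : Matrix (Fin N) (Fin r) ℝ) : Matrix (Fin r) (Fin r) ℝ :=
  fun k j => if h : (k : ℕ) < N then Λ ⟨k, h⟩ j else 0

theorem topBlock_apply {N r : ℕ} (hN : r ≤ N) (Λ : Matrix (Fin N) (Fin r) ℝ) (k j : Fin r) :
    topBlock Λ k j = Λ (Fin.castLE hN k) j := by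
  rw [topBlock, dif_pos (k.2.trans_le hN)]
  rfl

theorem topBlock_mul {N r : ℕ} (Λ : Matrix (Fin N) (Fin r) ℝ) (A : Matrix (Fin r) (Fin r) ℝ) :
    topBlock (Λ * A) = topBlock Λ * A := by
  ext k j
  simp only [topBlock, mul_apply]
  split_ifs <;> simp

namespace FactorParam

variable {N r : ℕ} {θ : FactorParam N r} {A : Matrix (Fin r) (Fin r) ℝ}

/-- Change of factor coordinates. -/
noncomputable def transform (θ : FactorParam N r) (A : Matrix (Fin r) (Fin r) ℝ) :
    FactorParam N r :=
  ⟨θ.loading * A, θ.idioVar, A⁻¹ * θ.factorCov * (A⁻¹)ᵀ⟩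

theorem sigmaZZ_transform (hA : IsUnit A.det) : (θ.transform A).sigmaZZ = θ.sigmaZZ := by
  have h1 : A * (A⁻¹ * θ.factorCov * (A⁻¹)ᵀ) * Aᵀ = θ.factorCov := by
    calc A * (A⁻¹ * θ.factorCov * (A⁻¹)ᵀ) * Aᵀ = (A * A⁻¹) * θ.factorCov * (A * A⁻¹)ᵀ := by
          simp only [transpose_mul, Matrix.mul_assoc]
      _ = _ := by rw [mul_nonsing_inv _ hA, transpose_one, Matrix.one_mul, Matrix.mul_one]
  have h2 : θ.loading * A * (A⁻¹ * θ.factorCov * (A⁻¹)ᵀ) * (θ.loading * A)ᵀ =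
      θ.loading * θ.factorCov * θ.loadingᵀ := by
    conv_rhs => rw [← h1]
    simp only [transpose_mul, Matrix.mul_assoc]
  rw [sigmaZZ, sigmaZZ, sigmaEE, sigmaEE, transform, h2]

theorem logLik_transform (hA : IsUnit A.det) (S : Matrix (Fin N) (Fin N) ℝ) :
    logLik S (θ.transform A) = logLik S θ := by
  rw [logLik, logLik, sigmaZZ_transform hA]

theorem factorCov_transform_conj (hA : IsUnit A.det) :
    A * (θ.transform A).factorCov * Aᵀ = θ.factorCov := by
  rw [transform]
  calc A * (A⁻¹ * θ.factorCov * (A⁻¹)ᵀ) * Aᵀ = (A * A⁻¹) * θ.factorCov * (A * A⁻¹)ᵀ := by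
        simp only [transpose_mul, Matrix.mul_assoc]
    _ = _ := by rw [mul_nonsing_inv _ hA, transpose_one, Matrix.one_mul, Matrix.mul_one]

theorem loadingCov_mk_mul (M : Matrix (Fin r) (Fin r) ℝ) :
    (FactorParam.mk (θ.loading * A) θ.idioVar M).loadingCov = Aᵀ * θ.loadingCov * A := by
  simp only [loadingCov, sigmaEE, transpose_mul, Matrix.mul_smul, Matrix.smul_mul,
    Matrix.mul_assoc]

theorem loadingCov_transform : (θ.transform A).loadingCov = Aᵀ * θ.loadingCov * A :=
  loadingCov_mk_mul _

theorem splice_zero (θs : FactorParam N r) :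
    splice 0 θs θ = ⟨θ.loading, θ.idioVar, θs.factorCov⟩ := by
  simp [splice]

theorem splice_restricted_of_topBlock {ic : IdentCond} (θs : FactorParam N r)
    (hic : ic = .ic1 ∨ ic = .ic4 ∨ ic = .ic5) (h : θs.Restricted ic) :
    (splice r θs θ).Restricted ic := by
  have hlt : ∀ (i : Fin N) (k : Fin r), (i : ℕ) ≤ (k : ℕ) → (i : ℕ) < r := fun i k hik =>
    hik.trans_lt k.2
  rcases hic with rfl | rfl | rfl
  · intro i k hi
    simpa [splice, hi] using h i k hi
  · refine ⟨h.1, fun i k hik => ?_, fun i k hik => ?_⟩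
    · simpa [splice, hlt i k hik.le] using h.2.1 i k hik
    · simpa [splice, hlt i k hik.le] using h.2.2 i k hik
  · refine ⟨h.1, fun i k hik => ?_, fun i k hik => ?_⟩
    · simpa [splice, hlt i k hik.le] using h.2.1 i k hik
    · simpa [splice, hlt i k hik.le] using h.2.2 i k hik

end FactorParam

section MeanSquare

variable {ι : Type*} {l : Filter ι} {N : ι → ℕ} {r : ℕ}
  {A B : (x : ι) → Matrix (Fin (N x)) (Fin r) ℝ}

theorem MeanSqBounded.mul_tendsto (hB : MeanSqBounded l B) {R : ι → Matrix (Fin r) (Fin r) ℝ}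
    {R₀ : Matrix (Fin r) (Fin r) ℝ} (hR : Tendsto R l (𝓝 R₀)) :
    MeanSqClose l (fun x => B x * R x) (fun x => B x * R₀) := fun k => by
  have h1 : ∀ a ∈ Finset.univ, Tendsto (fun x => (N x : ℝ)⁻¹ *
      ∑ i, (B x i a * (R x a k - R₀ a k)) ^ 2) l (𝓝 0) := fun a _ => by
    obtain ⟨b, hb⟩ := hB a
    have h2 := (tendsto_matrix_iff.1 hR a k).sub_const (R₀ a k)
    rw [sub_self] at h2
    have h3 := (h2.pow 2).mul_const b
    rw [zero_pow two_ne_zero, zero_mul] at h3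
    refine squeeze_zero' (.of_forall fun x => avg_sq_nonneg _ _) ?_ h3
    filter_upwards [hb] with x hx
    have e : (N x : ℝ)⁻¹ * ∑ i, (B x i a * (R x a k - R₀ a k)) ^ 2 =
        (R x a k - R₀ a k) ^ 2 * ((N x : ℝ)⁻¹ * ∑ i, B x i a ^ 2) := by
      rw [mul_left_comm, Finset.mul_sum (a := (R x a k - R₀ a k) ^ 2)]
      congr 1
      exact Finset.sum_congr rfl fun i _ => by ring
    rw [e]
    exact mul_le_mul_of_nonneg_left hx (sq_nonneg _)
  refine (tendsto_avg_sum_sq h1).congr fun x => ?_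
  congr 1
  refine Finset.sum_congr rfl fun i _ => ?_
  simp only [mul_apply, ← Finset.sum_sub_distrib, mul_sub]

theorem Filter.Tendsto.eventually_bounded {m n : Type*} [Finite m] [Finite n]
    {R : ι → Matrix m n ℝ} {R₀ : Matrix m n ℝ} (hR : Tendsto R l (𝓝 R₀)) :
    ∃ b : ℝ, ∀ᶠ x in l, ∀ i j, |R x i j| ≤ b := by
  cases nonempty_fintype m
  cases nonempty_fintype n
  refine ⟨∑ i, ∑ j, |R₀ i j| + 1, eventually_all.2 fun i => eventually_all.2 fun j => ?_⟩
  refine (tendsto_matrix_iff.1 hR i j).abs.eventually_le_const (lt_of_le_of_lt ?_ (lt_add_one _))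
  exact (Finset.single_le_sum (f := fun j => |R₀ i j|) (fun _ _ => abs_nonneg _)
    (Finset.mem_univ j)).trans (Finset.single_le_sum (f := fun i => ∑ j, |R₀ i j|)
    (fun _ _ => Finset.sum_nonneg fun _ _ => abs_nonneg _) (Finset.mem_univ i))

/-- A linear transformation with a nonsingular limit can be moved to the other side. -/
theorem MeanSqClose.of_mul_tendsto (hB : MeanSqBounded l B) {R : ι → Matrix (Fin r) (Fin r) ℝ}
    {R₀ : Matrix (Fin r) (Fin r) ℝ} (h : MeanSqClose l (fun x => A x * R x) B)
    (hR : Tendsto R l (𝓝 R₀)) (hR₀ : R₀.det ≠ 0) :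
    MeanSqClose l A fun x => B x * R₀⁻¹ := by
  have hi := hR.matrix_inv hR₀
  have h1 := (h.mul_right hi.eventually_bounded).trans (hB.mul_tendsto hi)
  refine fun k => (h1 k).congr' ?_
  filter_upwards [hR.matrix_det.eventually_ne hR₀] with x hx
  rw [Matrix.mul_assoc, mul_nonsing_inv _ hx.isUnit, Matrix.mul_one]

end MeanSquare

theorem antitone_of_tendsto {ι n : Type*} [PartialOrder n] {l : Filter ι} [l.NeBot] {d : ι → n → ℝ}
    {d₀ : n → ℝ} (h : ∀ k, Tendsto (fun x => d x k) l (𝓝 (d₀ k)))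
    (hd : ∀ᶠ x in l, StrictAnti (d x)) : Antitone d₀ := fun i j hij =>
  le_of_tendsto_of_tendsto (h j) (h i) (hd.mono fun _ hx => hx.antitone hij)

/-- An orthogonal conjugation between diagonal matrices with decreasing entries is a change of
signs. -/
theorem exists_eq_diagonal_of_conj {r : ℕ} {A D E : Matrix (Fin r) (Fin r) ℝ}
    (hA : A * Aᵀ = 1) (hD : D.IsDiag) (hDs : StrictAnti fun k => D k k) (hE : E.IsDiag)
    (hEs : Antitone fun k => E k k) (h : A * D * Aᵀ = E) :
    ∃ a : Fin r → ℝ, A = diagonal a ∧ ∀ k, a k ^ 2 = 1 := by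
  have hA' : Aᵀ * A = 1 := mul_eq_one_comm.1 hA
  have hdet : A.det ≠ 0 := fun h0 => by
    have := congrArg det hA
    rw [det_mul, h0, zero_mul, det_one] at this
    exact zero_ne_one this
  have h1 : diagonal (fun k => E k k) * A = A * diagonal fun k => D k k := by
    have e1 : diagonal (fun k => E k k) = E := hE.diagonal_diag
    have e2 : diagonal (fun k => D k k) = D := hD.diagonal_diag
    rw [e1, e2, ← h, Matrix.mul_assoc, hA', Matrix.mul_one]
  have hdiag : A.IsDiag := fun i j hij => eq_zero_of_intertwines hDs hEs hdet h1 hij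
  refine ⟨A.diag, hdiag.diagonal_diag.symm, fun k => ?_⟩
  have h2 := congrFun (congrFun hA k) k
  rw [← hdiag.diagonal_diag, diagonal_transpose, diagonal_mul_diagonal, diagonal_apply_eq,
    one_apply_eq] at h2
  rw [sq]
  exact h2

namespace FactorRegime

variable {ι : Type*} {r : ℕ} {N : ι → ℕ} {c C : ℝ}
  {θs : (x : ι) → FactorParam (N x) r} {S : (x : ι) → Matrix (Fin (N x)) (Fin (N x)) ℝ}
  {Mbar Q : Matrix (Fin r) (Fin r) ℝ} {θ : (x : ι) → FactorParam (N x) r}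
  {A : ι → Matrix (Fin r) (Fin r) ℝ}

section General

variable {l : Filter ι} (H : FactorRegime l N c θs S Mbar Q)
include H

theorem eventually_det_ne_zero (hθ : AvgConsistent l N c θs fun x => (θ x).transform (A x)) :
    ∀ᶠ x in l, (A x).det ≠ 0 := by
  filter_upwards [(H.tendsto_loadingCov_of_avgConsistent hθ).matrix_det.eventually_ne
    H.posDef_loading.det_pos.ne'] with x hx h0
  rw [FactorParam.loadingCov_transform, det_mul, h0, mul_zero] at hx
  exact hx rfl

/-- If the coordinate change tends to the identity, the loadings and the factor covariance are
consistent. -/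
theorem consistent_of_tendsto_one (hθ : AvgConsistent l N c θs fun x => (θ x).transform (A x))
    (hA : Tendsto A l (𝓝 1))
    (hM : Tendsto (fun x => ((θ x).transform (A x)).factorCov) l (𝓝 Mbar)) :
    MeanSqClose l (fun x => (θ x).loading) (fun x => (θs x).loading) ∧
      Tendsto (fun x => (θ x).factorCov) l (𝓝 Mbar) := by
  constructor
  · have h1 : MeanSqClose l (fun x => (θ x).loading * A x) fun x => (θs x).loading := hθ.loading
    have := h1.of_mul_tendsto H.meanSqBounded_loading hA (by simp)
    simpa using this
  · have h1 := (hA.mul hM).mul hA.matrix_transpose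
    rw [one_mul, transpose_one, mul_one] at h1
    refine h1.congr' ?_
    filter_upwards [H.eventually_det_ne_zero hθ] with x hx
    exact FactorParam.factorCov_transform_conj hx.isUnit

/-- Matching column signs exclude sign changes. -/
theorem eq_one_of_sameColumnSigns [l.NeBot]
    (hθ : AvgConsistent l N c θs fun x => (θ x).transform (A x)) {a : Fin r → ℝ}
    (hA : Tendsto A l (𝓝 (diagonal a))) (ha : ∀ k, a k ^ 2 = 1)
    (hsign : ∀ᶠ x in l, (θ x).SameColumnSigns (θs x)) : diagonal a = 1 := by
  have hc := H.const_pos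
  have haa : diagonal a * diagonal a = 1 := by
    rw [diagonal_mul_diagonal, ← diagonal_one]
    congr 1
    ext k
    rw [← sq, ha]
  have hinv : (diagonal a)⁻¹ = diagonal a := inv_eq_right_inv haa
  have hdet : (diagonal a).det ≠ 0 := fun h0 => by
    have := congrArg det haa
    rw [det_mul, h0, zero_mul, det_one] at this
    exact zero_ne_one this
  have h1 : MeanSqClose l (fun x => (θ x).loading * A x) fun x => (θs x).loading := hθ.loading
  have hclose := h1.of_mul_tendsto H.meanSqBounded_loading hA hdet
  rw [hinv] at hclose
  rw [← diagonal_one]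
  congr 1
  ext k
  rcases sq_eq_one_iff.1 (ha k) with h | h
  · exact h
  exfalso
  have h2 : Tendsto (fun x => (N x : ℝ)⁻¹ * ∑ i, (1 : ℝ) *
      (((θ x).loading i k + (θs x).loading i k) * (θs x).loading i k)) l (𝓝 0) := by
    refine tendsto_avg_mul_of_tendsto_avg_sq (w := fun _ _ => 1) (c := 1)
      (.of_forall fun x i => by simp) ((hclose k).congr fun x => ?_)
      (H.meanSqBounded_loading k)
    congr 1
    refine Finset.sum_congr rfl fun i _ => ?_
    change ((θ x).loading i k - ((θs x).loading * diagonal a) i k) ^ 2 = _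
    rw [mul_diagonal, h]
    ring
  have hQ : 0 < Q k k := H.posDef_loading.diag_pos
  have h3 : ∀ᶠ x in l, c⁻¹ * (θs x).loadingCov k k ≤ (N x : ℝ)⁻¹ * ∑ i, (1 : ℝ) *
      (((θ x).loading i k + (θs x).loading i k) * (θs x).loading i k) := by
    filter_upwards [hsign] with x hx
    have e : (θs x).loadingCov k k = (N x : ℝ)⁻¹ *
        ∑ i, ((θs x).idioVar i)⁻¹ * ((θs x).loading i k * (θs x).loading i k) := by
      rw [FactorParam.loadingCov, FactorParam.sigmaEE_inv (H.idioVar_pos x), avg_diagonal_apply]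
    rw [e, mul_left_comm]
    refine mul_le_mul_of_nonneg_left ?_ (by positivity)
    have h4 : c⁻¹ * ∑ i, ((θs x).idioVar i)⁻¹ * ((θs x).loading i k * (θs x).loading i k) ≤
        ∑ i, (θs x).loading i k * (θs x).loading i k := by
      rw [Finset.mul_sum]
      refine Finset.sum_le_sum fun i _ => ?_
      rw [← mul_assoc]
      refine mul_le_of_le_one_left (mul_self_nonneg _) ?_
      rw [inv_mul_le_iff₀ hc, mul_one]
      exact inv_le_of_inv_le₀ hc (H.idioVar_mem x i).1
    refine h4.trans ?_
    have h5 := hx k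
    have h6 : ∑ i, (1 : ℝ) * (((θ x).loading i k + (θs x).loading i k) * (θs x).loading i k) =
        ∑ i, (θ x).loading i k * (θs x).loading i k +
          ∑ i, (θs x).loading i k * (θs x).loading i k := by
      rw [← Finset.sum_add_distrib]
      exact Finset.sum_congr rfl fun i _ => by ring
    rw [h6]
    linarith
  have h4 := le_of_tendsto_of_tendsto
    ((tendsto_matrix_iff.1 H.tendsto_loadingCov k k).const_mul c⁻¹) h2 h3
  have : 0 < c⁻¹ * Q k k := by positivity
  linarith

end General

/-- Coordinates in which the normalized loading matrices agree exactly. -/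
theorem exists_normalizing {l : Ultrafilter ι} (H : FactorRegime (l : Filter ι) N c θs S Mbar Q)
    (hθ : AvgConsistent (l : Filter ι) N c θs fun x => (θ x).transform (A x))
    (hK : ∀ᶠ x in l, (θ x).loadingCov.IsDiag ∧ ∀ k, 0 < (θ x).loadingCov k k)
    (hKs : ∀ᶠ x in l, (θs x).loadingCov.IsDiag) :
    ∃ B : ι → Matrix (Fin r) (Fin r) ℝ,
      AvgConsistent (l : Filter ι) N c θs (fun x => (θ x).transform (B x)) ∧
      ∀ᶠ x in l, (B x)ᵀ * (θ x).loadingCov * B x = (θs x).loadingCov := by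
  have hQd : Q.IsDiag := isDiag_of_tendsto H.tendsto_loadingCov hKs
  have hQpos : ∀ k, 0 < Q k k := fun k => H.posDef_loading.diag_pos
  set p : ι → Matrix (Fin r) (Fin r) ℝ := fun x => diagonal fun k => √((θ x).loadingCov k k) with hp
  set s : ι → Matrix (Fin r) (Fin r) ℝ := fun x => diagonal fun k => √((θs x).loadingCov k k)
    with hs
  set q : Matrix (Fin r) (Fin r) ℝ := diagonal fun k => √(Q k k) with hq
  have hslim : Tendsto s l (𝓝 q) := by
    refine (continuous_id.matrix_diagonal.tendsto _).comp (tendsto_pi_nhds.2 fun k => ?_)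
    exact (tendsto_matrix_iff.1 H.tendsto_loadingCov k k).sqrt
  have hqdet : q.det ≠ 0 := by
    rw [hq, det_diagonal]
    exact Finset.prod_ne_zero_iff.2 fun k _ => (Real.sqrt_pos.2 (hQpos k)).ne'
  have hqq : q * q = Q := by
    rw [hq, diagonal_mul_diagonal]
    have : (fun k => √(Q k k) * √(Q k k)) = Q.diag := by
      ext k; exact Real.mul_self_sqrt (hQpos k).le
    rw [this, hQd.diagonal_diag]
  have hqt : qᵀ = q := diagonal_transpose _
  have hst : ∀ x, (s x)ᵀ = s x := fun x => diagonal_transpose _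
  have hpt : ∀ x, (p x)ᵀ = p x := fun x => diagonal_transpose _
  have hsdet : ∀ᶠ x in l, (s x).det ≠ 0 := hslim.matrix_det.eventually_ne hqdet
  have hsi := hslim.matrix_inv hqdet
  have hpp : ∀ᶠ x in l, p x * p x = (θ x).loadingCov ∧ (p x).det ≠ 0 := by
    filter_upwards [hK] with x hx
    constructor
    · rw [hp, diagonal_mul_diagonal]
      have : (fun k => √((θ x).loadingCov k k) * √((θ x).loadingCov k k)) =
          (θ x).loadingCov.diag := by
        ext k; exact Real.mul_self_sqrt (hx.2 k).le
      rw [this, hx.1.diagonal_diag]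
    · rw [hp, det_diagonal]
      exact Finset.prod_ne_zero_iff.2 fun k _ => (Real.sqrt_pos.2 (hx.2 k)).ne'
  have hss : ∀ᶠ x in l, s x * s x = (θs x).loadingCov := by
    filter_upwards [hKs] with x hx
    rw [hs, diagonal_mul_diagonal]
    have : (fun k => √((θs x).loadingCov k k) * √((θs x).loadingCov k k)) =
        (θs x).loadingCov.diag := by
      ext k
      refine Real.mul_self_sqrt ?_
      rw [FactorParam.loadingCov_eq, Matrix.smul_apply, smul_eq_mul]
      exact mul_nonneg (by positivity) (FactorParam.gram_posSemidef (H.idioVar_pos x)).diag_nonneg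
    rw [this, hx.diagonal_diag]
  set O : ι → Matrix (Fin r) (Fin r) ℝ := fun x => p x * A x * (s x)⁻¹ with hO
  have hOO : Tendsto (fun x => (O x)ᵀ * O x) l (𝓝 1) := by
    have h1 := (hsi.matrix_transpose.mul (H.tendsto_loadingCov_of_avgConsistent hθ)).mul hsi
    have e : (q⁻¹)ᵀ * Q * q⁻¹ = 1 := by
      rw [transpose_nonsing_inv, hqt, ← hqq, ← Matrix.mul_assoc, nonsing_inv_mul _ hqdet.isUnit,
        Matrix.one_mul, mul_nonsing_inv _ hqdet.isUnit]
    rw [e] at h1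
    refine h1.congr' ?_
    filter_upwards [hpp] with x hx
    rw [FactorParam.loadingCov_transform, ← hx.1, hO]
    simp only [transpose_mul, hpt, Matrix.mul_assoc]
  have hObdd : ∃ b : ℝ, ∀ᶠ x in l, ∀ i j, |(O x)ᵀ i j| ≤ b := by
    refine Filter.Tendsto.eventually_bounded_of_conj (M := fun _ => 1) tendsto_const_nhds
      PosDef.one ?_
    obtain ⟨b, hb⟩ := hOO.eventually_bounded
    refine ⟨b, hb.mono fun x hx i => ?_⟩
    rw [Matrix.mul_one, transpose_transpose]
    exact (le_abs_self _).trans (hx i i)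
  obtain ⟨O₀t, hO₀t⟩ := l.exists_tendsto_matrix hObdd
  set O₀ := O₀tᵀ with hO₀def
  have hO₀ : Tendsto O l (𝓝 O₀) := hO₀t.matrix_transpose
  have horth : O₀ᵀ * O₀ = 1 := tendsto_nhds_unique (hO₀.matrix_transpose.mul hO₀) hOO
  have hO₀det : O₀.det ≠ 0 := fun h0 => by
    have := congrArg det horth
    rw [det_mul, h0, mul_zero, det_one] at this
    exact zero_ne_one this
  set B : ι → Matrix (Fin r) (Fin r) ℝ := fun x => (p x)⁻¹ * O₀ * s x with hB
  refine ⟨B, ⟨hθ.idioVar_mem, hθ.tendsto_idioVar, ?_⟩, ?_⟩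
  · have hR : Tendsto (fun x => (s x)⁻¹ * (O x)⁻¹ * O₀ * s x) l (𝓝 1) := by
      have h1 := ((hsi.mul (hO₀.matrix_inv hO₀det)).mul_const O₀).mul hslim
      rwa [Matrix.mul_assoc q⁻¹, nonsing_inv_mul _ hO₀det.isUnit, Matrix.mul_one,
        nonsing_inv_mul _ hqdet.isUnit] at h1
    have h1 : MeanSqClose (l : Filter ι) (fun x => (θ x).loading * A x) fun x => (θs x).loading :=
      hθ.loading
    have h2 := (h1.mul_right hR.eventually_bounded).trans
      (H.meanSqBounded_loading.mul_tendsto hR)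
    simp only [Matrix.mul_one] at h2
    refine fun k => (h2 k).congr' ?_
    filter_upwards [hpp, hsdet, H.eventually_det_ne_zero hθ] with x hx hsx hAx
    have e : A x * ((s x)⁻¹ * (O x)⁻¹ * O₀ * s x) = B x := by
      have e1 : (O x)⁻¹ = s x * (A x)⁻¹ * (p x)⁻¹ := by
        rw [hO, Matrix.mul_inv_rev, Matrix.mul_inv_rev, nonsing_inv_nonsing_inv _ hsx.isUnit,
          Matrix.mul_assoc]
      rw [e1, hB]
      calc A x * ((s x)⁻¹ * (s x * (A x)⁻¹ * (p x)⁻¹) * O₀ * s x)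
          = A x * (((s x)⁻¹ * s x) * (A x)⁻¹) * ((p x)⁻¹ * O₀ * s x) := by
            simp only [Matrix.mul_assoc]
        _ = _ := by
            rw [nonsing_inv_mul _ hsx.isUnit, Matrix.one_mul, mul_nonsing_inv _ hAx.isUnit,
              Matrix.one_mul]
    rw [Matrix.mul_assoc, e]
    rfl
  · filter_upwards [hpp, hss] with x hx hsx
    have hpi : ((p x)⁻¹)ᵀ = (p x)⁻¹ := by rw [transpose_nonsing_inv, hpt]
    rw [hB, ← hx.1, ← hsx]
    simp only [transpose_mul, hst, hpi]
    calc s x * (O₀ᵀ * (p x)⁻¹) * (p x * p x) * ((p x)⁻¹ * O₀ * s x)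
        = s x * (O₀ᵀ * (((p x)⁻¹ * p x) * (p x * (p x)⁻¹)) * O₀) * s x := by
          simp only [Matrix.mul_assoc]
      _ = _ := by
          rw [nonsing_inv_mul _ hx.2.isUnit, mul_nonsing_inv _ hx.2.isUnit, Matrix.mul_one,
            Matrix.mul_one, horth, Matrix.mul_one]

section Estimate

variable {l : Ultrafilter ι} {ic : IdentCond}
  (H : FactorRegime (l : Filter ι) N (C ^ 2) θs S Mbar Q)
include H

/-- The change of coordinates is bounded. -/
theorem exists_tendsto_transform (hmle : ∀ᶠ x in l, (θ x).IsMLE C ic (S x))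
    (hθ : AvgConsistent (l : Filter ι) N (C ^ 2) θs fun x => (θ x).transform (A x))
    (hM : Tendsto (fun x => ((θ x).transform (A x)).factorCov) l (𝓝 Mbar)) :
    ∃ A₀ : Matrix (Fin r) (Fin r) ℝ, Tendsto A l (𝓝 A₀) ∧
      Tendsto (fun x => (θ x).factorCov) l (𝓝 (A₀ * Mbar * A₀ᵀ)) := by
  have hdet := H.eventually_det_ne_zero hθ
  have hbdd : ∃ b : ℝ, ∀ᶠ x in l, ∀ i j, |A x i j| ≤ b := by
    refine hM.eventually_bounded_of_conj H.posDef_factor ⟨C, ?_⟩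
    filter_upwards [hmle, hdet] with x h1 h2 i
    rw [FactorParam.factorCov_transform_conj h2.isUnit]
    exact (h1.1.factorCov_mem i i).2
  obtain ⟨A₀, hA₀⟩ := l.exists_tendsto_matrix hbdd
  refine ⟨A₀, hA₀, ((hA₀.mul hM).mul hA₀.matrix_transpose).congr' ?_⟩
  filter_upwards [hdet] with x hx
  exact FactorParam.factorCov_transform_conj hx.isUnit

variable (hD : ∀ k k', |Mbar k k'| < C)
include hD

theorem eventually_admissible {θ' : (x : ι) → FactorParam (N x) r}
    (hd : ∀ᶠ x in l, ∀ i, (θ' x).idioVar i ∈ Set.Icc (C ^ 2)⁻¹ (C ^ 2))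
    (hM : ∀ x, (θ' x).factorCov = (θs x).factorCov)
    (hr : ∀ᶠ x in l, (θ' x).Restricted ic) : ∀ᶠ x in l, (θ' x).Admissible C ic := by
  have hbd : ∀ᶠ x in l, ∀ k k', |(θs x).factorCov k k'| ≤ C :=
    eventually_all.2 fun k => eventually_all.2 fun k' =>
      (tendsto_matrix_iff.1 H.tendsto_factorCov k k').abs.eventually_le_const (hD k k')
  filter_upwards [hd, hr, hbd] with x h1 h2 h3
  exact ⟨h1, by rw [hM]; exact H.factorCov_psd x,
    fun k k' => by rw [hM]; exact abs_le.1 (h3 k k'), h2⟩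

variable (hmle : ∀ᶠ x in l, (θ x).IsMLE C ic (S x))
include hmle

theorem consistent_of_splice_restricted (m : ℕ)
    (hθ : AvgConsistent (l : Filter ι) N (C ^ 2) θs fun x => (θ x).transform (A x))
    (hr : ∀ᶠ x in l, (FactorParam.splice m (θs x) ((θ x).transform (A x))).Restricted ic) :
    Tendsto (fun x => ((θ x).transform (A x)).factorCov) l (𝓝 Mbar) ∧
      ∃ η : ι → ℝ, Tendsto η l (𝓝 0) ∧ ∀ᶠ x in l, ∀ i : Fin (N x), (i : ℕ) < m → ∀ j,
        (((θ x).transform (A x)).loading i j - (θs x).loading i j) ^ 2 ≤ η x := by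
  refine H.consistent_of_splice hθ ?_ m ?_
  · filter_upwards [hmle] with x hx
    exact hx.1.factorCov_psd.mul_mul_transpose _
  · have hadm := H.eventually_admissible hD
      (θ' := fun x => FactorParam.splice m (θs x) ((θ x).transform (A x)))
      (hmle.mono fun x hx => hx.1.idioVar_mem) (fun _ => rfl) hr
    filter_upwards [hmle, hadm, H.eventually_det_ne_zero hθ] with x h1 h2 h3
    rw [FactorParam.logLik_transform h3.isUnit]
    exact h1.2 _ h2

variable (htrue : ∀ᶠ x in l, (θs x).Restricted ic)
include htrue

theorem dominatesTruth : DominatesTruth (l : Filter ι) N (C ^ 2) θs S θ where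
  idioVar_mem := hmle.mono fun _ hx => hx.1.idioVar_mem
  factorCov_psd := hmle.mono fun _ hx => hx.1.factorCov_psd
  logLik_le := by
    filter_upwards [H.eventually_admissible hD (.of_forall H.idioVar_mem) (fun _ => rfl) htrue,
      hmle] with x h1 h2
    exact h2.2 _ h1

theorem exists_avgConsistent : ∃ A : ι → Matrix (Fin r) (Fin r) ℝ,
    AvgConsistent (l : Filter ι) N (C ^ 2) θs fun x => (θ x).transform (A x) := by
  have hdom := H.dominatesTruth hD hmle htrue
  exact ⟨fun x => (θ x).factorCov * (θ x).loadingᵀ * (θ x).sigmaZZ⁻¹ * (θs x).loading,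
    hdom.idioVar_mem, H.tendsto_idioVar (θ := θ) hdom, H.meanSqClose_loading_mul hdom⟩

/-- Under the restrictions on the top block of the loadings, this block is consistent. -/
theorem tendsto_topBlock (hic : ic = .ic1 ∨ ic = .ic4 ∨ ic = .ic5)
    (hθ : AvgConsistent (l : Filter ι) N (C ^ 2) θs fun x => (θ x).transform (A x)) :
    Tendsto (fun x => ((θ x).transform (A x)).factorCov) l (𝓝 Mbar) ∧
      Tendsto (fun x => topBlock (θ x).loading * A x - topBlock (θs x).loading) l (𝓝 0) := by
  obtain ⟨hM, η, hη, hηx⟩ := H.consistent_of_splice_restricted hD hmle r hθ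
    (htrue.mono fun x hx => FactorParam.splice_restricted_of_topBlock _ hic hx)
  refine ⟨hM, tendsto_matrix_iff.2 fun k j => ?_⟩
  refine squeeze_zero_norm' ?_ (by simpa using hη.sqrt : Tendsto (fun x => √(η x)) l (𝓝 0))
  filter_upwards [hηx, H.tendsto_dim.eventually_ge_atTop r] with x hx hN
  rw [Matrix.sub_apply, ← topBlock_mul, topBlock_apply hN, topBlock_apply hN]
  exact Real.abs_le_sqrt (hx (Fin.castLE hN k) k.2 j)

end Estimate

end FactorRegime

/-- A limiting change of coordinates between lower triangular matrices which also preserves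
diagonality of a covariance is diagonal. -/
theorem isDiag_of_tendsto_lowerTriangular {ι : Type*} {r : ℕ} {l : Filter ι} [l.NeBot]
    {A L : ι → Matrix (Fin r) (Fin r) ℝ} {A₀ T M : Matrix (Fin r) (Fin r) ℝ}
    (hA : Tendsto A l (𝓝 A₀)) (hLA : Tendsto (fun x => L x * A x) l (𝓝 T)) (hA₀ : A₀.det ≠ 0)
    (hTdet : T.det ≠ 0) (hT : ∀ i j, i < j → T i j = 0)
    (hL : ∀ᶠ x in l, ∀ i j, i < j → L x i j = 0) (hM : M.IsDiag) (hMpos : ∀ i, 0 < M i i)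
    (h : (A₀ * M * A₀ᵀ).IsDiag) :
    A₀.IsDiag ∧ Tendsto L l (𝓝 (T * A₀⁻¹)) := by
  have hlim : Tendsto L l (𝓝 (T * A₀⁻¹)) := by
    refine (hLA.mul (hA.matrix_inv hA₀)).congr' ?_
    filter_upwards [hA.matrix_det.eventually_ne hA₀] with x hx
    rw [Matrix.mul_assoc, mul_nonsing_inv _ hx.isUnit, Matrix.mul_one]
  have hlow : ∀ i j, i < j → (T * A₀⁻¹) i j = 0 := fun i j hij =>
    tendsto_nhds_unique (tendsto_matrix_iff.1 hlim i j)
      (tendsto_const_nhds.congr' (hL.mono fun x hx => (hx i j hij).symm))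
  have hdet : (T * A₀⁻¹).det ≠ 0 := by
    rw [det_mul]
    exact mul_ne_zero hTdet (A₀.isUnit_nonsing_inv_det hA₀.isUnit).ne_zero
  have hA₀low : ∀ i j, i < j → A₀ i j = 0 := by
    have := lowerTriangular_mul_inv hlow hdet hT
    have e : (T * A₀⁻¹)⁻¹ * T = A₀ := by
      rw [Matrix.mul_inv_rev, nonsing_inv_nonsing_inv _ hA₀.isUnit, Matrix.mul_assoc,
        nonsing_inv_mul _ hTdet.isUnit, Matrix.mul_one]
    rwa [e] at this
  exact ⟨fun i j hij => eq_zero_of_lowerTriangular hA₀low hA₀ hM hMpos h hij, hlim⟩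

namespace FactorRegime

variable {ι : Type*} {r : ℕ} {N : ι → ℕ} {C : ℝ} {l : Ultrafilter ι}
  {θs : (x : ι) → FactorParam (N x) r} {S : (x : ι) → Matrix (Fin (N x)) (Fin (N x)) ℝ}
  {Mbar Q : Matrix (Fin r) (Fin r) ℝ} {θ : (x : ι) → FactorParam (N x) r}
  (H : FactorRegime (l : Filter ι) N (C ^ 2) θs S Mbar Q) (hD : ∀ k k', |Mbar k k'| < C)
include H

theorem exists_tendsto_topBlock :
    ∃ T : Matrix (Fin r) (Fin r) ℝ, Tendsto (fun x => topBlock (θs x).loading) l (𝓝 T) := by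
  refine l.exists_tendsto_matrix ⟨√(C ^ 2), ?_⟩
  filter_upwards [H.tendsto_dim.eventually_ge_atTop r] with x hN k j
  rw [topBlock_apply hN]
  exact H.abs_loading_le x _ _

include hD

theorem consistent_ic1 (hmle : ∀ᶠ x in l, (θ x).IsMLE C .ic1 (S x))
    (htrue : ∀ᶠ x in l, (θs x).Restricted .ic1) :
    MeanSqClose (l : Filter ι) (fun x => (θ x).loading) (fun x => (θs x).loading) ∧
      Tendsto (fun x => (θ x).factorCov) l (𝓝 Mbar) := by
  obtain ⟨A, hA⟩ := H.exists_avgConsistent hD hmle htrue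
  obtain ⟨hM, htop⟩ := H.tendsto_topBlock hD hmle htrue (.inl rfl) hA
  have hone : ∀ {θ' : (x : ι) → FactorParam (N x) r}, (∀ᶠ x in l, (θ' x).Restricted .ic1) →
      ∀ᶠ x in l, topBlock (θ' x).loading = 1 := fun h => by
    filter_upwards [h, H.tendsto_dim.eventually_ge_atTop r] with x hx hN
    ext k j
    rw [topBlock_apply hN, hx _ _ k.2, one_apply]
    simp [Fin.ext_iff]
  refine H.consistent_of_tendsto_one hA ?_ hM
  have h1 := htop.add_const 1
  rw [zero_add] at h1
  refine h1.congr' ?_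
  filter_upwards [hone htrue, hone (hmle.mono fun x hx => hx.1.restricted)] with x h1 h2
  rw [h1, h2, Matrix.one_mul, sub_add_cancel]

theorem consistent_ic4 (hmle : ∀ᶠ x in l, (θ x).IsMLE C .ic4 (S x))
    (htrue : ∀ᶠ x in l, (θs x).Restricted .ic4) :
    MeanSqClose (l : Filter ι) (fun x => (θ x).loading) (fun x => (θs x).loading) ∧
      Tendsto (fun x => (θ x).factorCov) l (𝓝 Mbar) := by
  obtain ⟨A, hA⟩ := H.exists_avgConsistent hD hmle htrue
  obtain ⟨hM, htop⟩ := H.tendsto_topBlock hD hmle htrue (.inr (.inl rfl)) hA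
  obtain ⟨A₀, hA₀, hM₀⟩ := H.exists_tendsto_transform hmle hA hM
  obtain ⟨T, hT⟩ := H.exists_tendsto_topBlock
  have hLA := htop.add hT
  simp only [sub_add_cancel, zero_add] at hLA
  have htri : ∀ {θ' : (x : ι) → FactorParam (N x) r}, (∀ᶠ x in l, (θ' x).Restricted .ic4) →
      ∀ᶠ x in l, (∀ i j, i < j → topBlock (θ' x).loading i j = 0) ∧
        ∀ k, topBlock (θ' x).loading k k = 1 := fun h => by
    filter_upwards [h, H.tendsto_dim.eventually_ge_atTop r] with x hx hN
    exact ⟨fun i j hij => by rw [topBlock_apply hN]; exact hx.2.2 _ _ hij,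
      fun k => by rw [topBlock_apply hN]; exact hx.2.1 _ _ rfl⟩
  have hθ := htri (hmle.mono fun x hx => hx.1.restricted)
  have hs := htri htrue
  have hTlow : ∀ i j, i < j → T i j = 0 := fun i j hij =>
    tendsto_nhds_unique (tendsto_matrix_iff.1 hT i j)
      (tendsto_const_nhds.congr' (hs.mono fun x hx => (hx.1 i j hij).symm))
  have hTone : ∀ k, T k k = 1 := fun k => tendsto_nhds_unique (tendsto_matrix_iff.1 hT k k)
      (tendsto_const_nhds.congr' (hs.mono fun x hx => (hx.2 k).symm))
  have hTdet : T.det = 1 := by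
    rw [det_of_lowerTriangular' hTlow]
    exact Finset.prod_eq_one fun k _ => hTone k
  have hA₀det : A₀.det = 1 := by
    rw [← hTdet]
    refine tendsto_nhds_unique hA₀.matrix_det (hLA.matrix_det.congr' ?_)
    filter_upwards [hθ] with x hx
    rw [det_mul, det_of_lowerTriangular' hx.1, Finset.prod_eq_one fun k _ => hx.2 k, one_mul]
  obtain ⟨hdiag, hlim⟩ := isDiag_of_tendsto_lowerTriangular hA₀ hLA (hA₀det ▸ one_ne_zero)
    (hTdet ▸ one_ne_zero) hTlow (hθ.mono fun x hx => hx.1)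
    (isDiag_of_tendsto H.tendsto_factorCov (htrue.mono fun x hx => hx.1))
    (fun k => H.posDef_factor.diag_pos)
    (isDiag_of_tendsto hM₀ (hmle.mono fun x hx => hx.1.restricted.1))
  have hone : A₀ = 1 := by
    rw [← hdiag.diagonal_diag, ← diagonal_one]
    congr 1
    ext k
    have h1 : (T * A₀⁻¹) k k = 1 := tendsto_nhds_unique (tendsto_matrix_iff.1 hlim k k)
      (tendsto_const_nhds.congr' (hθ.mono fun x hx => (hx.2 k).symm))
    have h2 : (T * A₀⁻¹ * A₀) k k = 1 := by
      rw [Matrix.mul_assoc, nonsing_inv_mul _ (by rw [hA₀det]; exact isUnit_one), Matrix.mul_one,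
        hTone]
    rw [← hdiag.diagonal_diag, mul_diagonal, hdiag.diagonal_diag, h1, one_mul] at h2
    exact h2
  exact H.consistent_of_tendsto_one hA (hone ▸ hA₀) hM

theorem consistent_ic5 (hmle : ∀ᶠ x in l, (θ x).IsMLE C .ic5 (S x))
    (htrue : ∀ᶠ x in l, (θs x).Restricted .ic5)
    (hsign : ∀ᶠ x in l, (θ x).SameColumnSigns (θs x)) {δ : ℝ} (hδ : 0 < δ)
    (hdiagδ : ∀ᶠ x in l, ∀ (i : Fin (N x)) (k : Fin r), (i : ℕ) = k → δ ≤ |(θs x).loading i k|) :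
    MeanSqClose (l : Filter ι) (fun x => (θ x).loading) (fun x => (θs x).loading) ∧
      Tendsto (fun x => (θ x).factorCov) l (𝓝 Mbar) := by
  obtain ⟨A, hA⟩ := H.exists_avgConsistent hD hmle htrue
  obtain ⟨hM, htop⟩ := H.tendsto_topBlock hD hmle htrue (.inr (.inr rfl)) hA
  obtain ⟨A₀, hA₀, hM₀⟩ := H.exists_tendsto_transform hmle hA hM
  obtain ⟨T, hT⟩ := H.exists_tendsto_topBlock
  have hLA := htop.add hT
  simp only [sub_add_cancel, zero_add] at hLA
  have htri : ∀ {θ' : (x : ι) → FactorParam (N x) r}, (∀ᶠ x in l, (θ' x).Restricted .ic5) →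
      ∀ᶠ x in l, ∀ i j, i < j → topBlock (θ' x).loading i j = 0 := fun h => by
    filter_upwards [h, H.tendsto_dim.eventually_ge_atTop r] with x hx hN i j hij
    rw [topBlock_apply hN]
    exact hx.2.2 _ _ hij
  have hθ := htri (hmle.mono fun x hx => hx.1.restricted)
  have hTlow : ∀ i j, i < j → T i j = 0 := fun i j hij =>
    tendsto_nhds_unique (tendsto_matrix_iff.1 hT i j)
      (tendsto_const_nhds.congr' ((htri htrue).mono fun x hx => (hx i j hij).symm))
  have hTdet : T.det ≠ 0 := by
    rw [det_of_lowerTriangular' hTlow]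
    refine Finset.prod_ne_zero_iff.2 fun k _ => abs_pos.1 (hδ.trans_le ?_)
    refine ge_of_tendsto (tendsto_matrix_iff.1 hT k k).abs ?_
    filter_upwards [hdiagδ, H.tendsto_dim.eventually_ge_atTop r] with x hx hN
    rw [topBlock_apply hN]
    exact hx _ _ rfl
  have hMbar : Mbar = 1 := tendsto_nhds_unique H.tendsto_factorCov
    (tendsto_const_nhds.congr' (htrue.mono fun x hx => hx.1.symm))
  have hAA : A₀ * A₀ᵀ = 1 := by
    have h1 : A₀ * Mbar * A₀ᵀ = 1 := tendsto_nhds_unique hM₀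
      (tendsto_const_nhds.congr' (hmle.mono fun x hx => hx.1.restricted.1.symm))
    rwa [hMbar, Matrix.mul_one] at h1
  have hA₀det : A₀.det ≠ 0 := (isUnit_det_of_right_inverse hAA).ne_zero
  obtain ⟨hdiag, -⟩ := isDiag_of_tendsto_lowerTriangular (M := 1) hA₀ hLA hA₀det hTdet hTlow hθ
    isDiag_one (fun k => by simp) (by rw [Matrix.mul_one, hAA]; exact isDiag_one)
  have hsq : ∀ k, A₀.diag k ^ 2 = 1 := fun k => by
    have h2 := congrFun (congrFun hAA k) k
    rw [← hdiag.diagonal_diag, diagonal_transpose, diagonal_mul_diagonal, diagonal_apply_eq,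
      one_apply_eq] at h2
    rw [sq]
    exact h2
  have hA₀' := hA₀
  rw [← hdiag.diagonal_diag] at hA₀'
  rw [H.eq_one_of_sameColumnSigns hA hA₀' hsq hsign] at hA₀'
  exact H.consistent_of_tendsto_one hA hA₀' hM

theorem consistent_ic2 (hmle : ∀ᶠ x in l, (θ x).IsMLE C .ic2 (S x))
    (htrue : ∀ᶠ x in l, (θs x).Restricted .ic2)
    (hsign : ∀ᶠ x in l, (θ x).SameColumnSigns (θs x))
    (hinj : Function.Injective fun k => Mbar k k) :
    MeanSqClose (l : Filter ι) (fun x => (θ x).loading) (fun x => (θs x).loading) ∧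
      Tendsto (fun x => (θ x).factorCov) l (𝓝 Mbar) := by
  obtain ⟨A, hA⟩ := H.exists_avgConsistent hD hmle htrue
  have hres : ∀ᶠ x in l, (θ x).Restricted .ic2 := hmle.mono fun x hx => hx.1.restricted
  obtain ⟨B, hB, hBK⟩ := H.exists_normalizing hA
    (hres.mono fun x hx => by rw [hx.2]; exact ⟨isDiag_one, fun k => by simp⟩)
    (htrue.mono fun x hx => by rw [hx.2]; exact isDiag_one)
  obtain ⟨hM, -⟩ := H.consistent_of_splice_restricted hD hmle 0 hB (by
    filter_upwards [htrue, hBK] with x h1 h2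
    rw [FactorParam.splice_zero]
    exact ⟨h1.1, (FactorParam.loadingCov_mk_mul _).trans (h2.trans h1.2)⟩)
  obtain ⟨A₀, hA₀, hM₀⟩ := H.exists_tendsto_transform hmle hB hM
  have hAA : A₀ᵀ * A₀ = 1 := by
    refine tendsto_nhds_unique (hA₀.matrix_transpose.mul hA₀) (tendsto_const_nhds.congr' ?_)
    filter_upwards [hBK, hres, htrue] with x h1 h2 h3
    rw [h2.2, h3.2, Matrix.mul_one] at h1
    exact h1.symm
  obtain ⟨a, rfl, ha⟩ := exists_eq_diagonal_of_conj (mul_eq_one_comm.1 hAA)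
    (isDiag_of_tendsto H.tendsto_factorCov (htrue.mono fun x hx => hx.1.1))
    ((antitone_of_tendsto (fun k => tendsto_matrix_iff.1 H.tendsto_factorCov k k)
      (htrue.mono fun x hx => hx.1.2.2)).strictAnti_of_injective hinj)
    (isDiag_of_tendsto hM₀ (hres.mono fun x hx => hx.1.1))
    (antitone_of_tendsto (fun k => tendsto_matrix_iff.1 hM₀ k k)
      (hres.mono fun x hx => hx.1.2.2)) rfl
  rw [H.eq_one_of_sameColumnSigns hB hA₀ ha hsign] at hA₀
  exact H.consistent_of_tendsto_one hB hA₀ hM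

theorem consistent_ic3 (hmle : ∀ᶠ x in l, (θ x).IsMLE C .ic3 (S x))
    (htrue : ∀ᶠ x in l, (θs x).Restricted .ic3)
    (hsign : ∀ᶠ x in l, (θ x).SameColumnSigns (θs x))
    (hinj : Function.Injective fun k => Q k k) :
    MeanSqClose (l : Filter ι) (fun x => (θ x).loading) (fun x => (θs x).loading) ∧
      Tendsto (fun x => (θ x).factorCov) l (𝓝 Mbar) := by
  obtain ⟨A, hA⟩ := H.exists_avgConsistent hD hmle htrue
  have hres : ∀ᶠ x in l, (θ x).Restricted .ic3 := hmle.mono fun x hx => hx.1.restricted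
  obtain ⟨B, hB, hBK⟩ := H.exists_normalizing hA
    (hres.mono fun x hx => ⟨hx.2.1, hx.2.2.1⟩) (htrue.mono fun x hx => hx.2.1)
  obtain ⟨hM, -⟩ := H.consistent_of_splice_restricted hD hmle 0 hB (by
    filter_upwards [htrue, hBK] with x h1 h2
    rw [FactorParam.splice_zero]
    have e : (FactorParam.mk ((θ x).transform (B x)).loading ((θ x).transform (B x)).idioVar
        (θs x).factorCov).loadingCov = (θs x).loadingCov :=
      (FactorParam.loadingCov_mk_mul _).trans h2
    refine ⟨h1.1, ?_⟩
    rw [e]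
    exact h1.2)
  obtain ⟨A₀, hA₀, hM₀⟩ := H.exists_tendsto_transform hmle hB hM
  have hMbar : Mbar = 1 := tendsto_nhds_unique H.tendsto_factorCov
    (tendsto_const_nhds.congr' (htrue.mono fun x hx => hx.1.symm))
  have hAA : A₀ * A₀ᵀ = 1 := by
    have h1 : A₀ * Mbar * A₀ᵀ = 1 := tendsto_nhds_unique hM₀
      (tendsto_const_nhds.congr' (hres.mono fun x hx => hx.1.symm))
    rwa [hMbar, Matrix.mul_one] at h1
  have hA₀det : A₀.det ≠ 0 := (isUnit_det_of_right_inverse hAA).ne_zero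
  have hinv : A₀⁻¹ = A₀ᵀ := inv_eq_right_inv hAA
  have hK : Tendsto (fun x => (θ x).loadingCov) l (𝓝 (A₀ * Q * A₀ᵀ)) := by
    have hi := hA₀.matrix_inv hA₀det
    have h1 := (hi.matrix_transpose.mul H.tendsto_loadingCov).mul hi
    rw [hinv, transpose_transpose] at h1
    refine h1.congr' ?_
    filter_upwards [hBK, hA₀.matrix_det.eventually_ne hA₀det] with x h2 h3
    have e1 := mul_nonsing_inv _ h3.isUnit
    have e2 : ((B x)⁻¹)ᵀ * (B x)ᵀ = 1 := by rw [← transpose_mul, e1, transpose_one]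
    rw [← h2]
    calc ((B x)⁻¹)ᵀ * ((B x)ᵀ * (θ x).loadingCov * B x) * (B x)⁻¹
        = (((B x)⁻¹)ᵀ * (B x)ᵀ) * (θ x).loadingCov * (B x * (B x)⁻¹) := by
          simp only [Matrix.mul_assoc]
      _ = _ := by rw [e1, e2, Matrix.one_mul, Matrix.mul_one]
  obtain ⟨a, rfl, ha⟩ := exists_eq_diagonal_of_conj hAA
    (isDiag_of_tendsto H.tendsto_loadingCov (htrue.mono fun x hx => hx.2.1))
    ((antitone_of_tendsto (fun k => tendsto_matrix_iff.1 H.tendsto_loadingCov k k)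
      (htrue.mono fun x hx => hx.2.2.2)).strictAnti_of_injective hinj)
    (isDiag_of_tendsto hK (hres.mono fun x hx => hx.2.1))
    (antitone_of_tendsto (fun k => tendsto_matrix_iff.1 hK k k)
      (hres.mono fun x hx => hx.2.2.2)) rfl
  rw [H.eq_one_of_sameColumnSigns hB hA₀ ha hsign] at hA₀
  exact H.consistent_of_tendsto_one hB hA₀ hM

end FactorRegime

section ProbFilter

variable {Ω ι : Type*} [MeasurableSpace Ω] {μ : Measure Ω} {l : Filter ι}

/-- The events whose probability tends to one along `l`. Convergence along this filter is
convergence in probability. -/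
def probFilter (μ : Measure Ω) (l : Filter ι) : Filter (ι × Ω) where
  sets := {s | Tendsto (fun x => μ {ω | (x, ω) ∉ s}) l (𝓝 0)}
  univ_sets := by simpa using tendsto_const_nhds
  sets_of_superset {s t} hs hst := tendsto_of_tendsto_of_tendsto_of_le_of_le tendsto_const_nhds hs
    (fun _ => zero_le) fun x => measure_mono fun ω hω h => hω (hst h)
  inter_sets {s t} hs ht := by
    have h := Tendsto.add hs ht
    rw [add_zero] at h
    refine tendsto_of_tendsto_of_tendsto_of_le_of_le tendsto_const_nhds h (fun _ => zero_le)
      fun x => (measure_mono fun ω hω => ?_).trans (measure_union_le _ _)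
    by_contra hn
    simp only [Set.mem_union, Set.mem_ofPred_eq, not_or, not_not] at hn
    exact hω ⟨hn.1, hn.2⟩

theorem eventually_probFilter {p : ι × Ω → Prop} :
    (∀ᶠ y in probFilter μ l, p y) ↔ Tendsto (fun x => μ {ω | ¬ p (x, ω)}) l (𝓝 0) := Iff.rfl

theorem tendsto_fst_probFilter : Tendsto Prod.fst (probFilter μ l) l := fun s hs => by
  refine eventually_probFilter.2 (tendsto_const_nhds.congr' ?_)
  filter_upwards [hs] with x hx
  simp [hx]

theorem tendstoInMeasure_iff_tendsto_probFilter {X : ι → Ω → ℝ} :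
    TendstoInMeasure μ X l (fun _ => 0) ↔
      Tendsto (fun y : ι × Ω => X y.1 y.2) (probFilter μ l) (𝓝 0) := by
  rw [EMetric.tendsto_nhds]
  refine forall₂_congr fun ε _ => ?_
  rw [eventually_probFilter]
  simp only [not_lt]

/-- Markov's inequality. -/
theorem tendsto_probFilter_of_integral_le [IsFiniteMeasure μ] {X : ι → Ω → ℝ} {b : ι → ℝ}
    (hX : ∀ x ω, 0 ≤ X x ω) (hint : ∀ᶠ x in l, Integrable (X x) μ)
    (hle : ∀ᶠ x in l, ∫ ω, X x ω ∂μ ≤ b x) (hb : Tendsto b l (𝓝 0)) :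
    Tendsto (fun y : ι × Ω => X y.1 y.2) (probFilter μ l) (𝓝 0) := by
  rw [Metric.tendsto_nhds]
  intro ε hε
  rw [eventually_probFilter]
  have h1 : Tendsto (fun x => ε⁻¹ * b x) l (𝓝 0) := by simpa using hb.const_mul ε⁻¹
  have h2 : Tendsto (fun x => ENNReal.ofReal (ε⁻¹ * b x)) l (𝓝 0) := by
    simpa using ENNReal.tendsto_ofReal h1
  refine tendsto_of_tendsto_of_tendsto_of_le_of_le' tendsto_const_nhds h2
    (.of_forall fun _ => zero_le) ?_
  filter_upwards [hint, hle] with x hi hx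
  have h3 := mul_meas_ge_le_integral_of_nonneg (.of_forall (hX x)) hi ε
  rw [← ENNReal.ofReal_toReal (measure_ne_top μ _)]
  refine ENNReal.ofReal_le_ofReal ?_
  have e : {ω | ¬ dist (X x ω) 0 < ε} = {ω | ε ≤ X x ω} := by
    ext ω
    simp [abs_of_nonneg (hX x ω)]
  rw [e, inv_mul_eq_div, le_div_iff₀' hε]
  exact h3.trans hx

end ProbFilter

section Moments

variable {Ω : Type*} [MeasurableSpace Ω] {μ : Measure Ω}

theorem integral_avg_le {n : ℕ} {Z : Fin n → Ω → ℝ} {b : ℝ} (hb : 0 ≤ b)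
    (hint : ∀ i, Integrable (Z i) μ) (hle : ∀ i, ∫ ω, Z i ω ∂μ ≤ b) :
    ∫ ω, (n : ℝ)⁻¹ * ∑ i, Z i ω ∂μ ≤ b := by
  rw [integral_const_mul, integral_finsetSum _ fun i _ => hint i]
  calc (n : ℝ)⁻¹ * ∑ i, ∫ ω, Z i ω ∂μ ≤ (n : ℝ)⁻¹ * ∑ _i : Fin n, b :=
        mul_le_mul_of_nonneg_left (Finset.sum_le_sum fun i _ => hle i) (by positivity)
    _ = ((n : ℝ)⁻¹ * n) * b := by simp [mul_assoc]
    _ ≤ 1 * b := mul_le_mul_of_nonneg_right inv_mul_le_one hb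
    _ = b := one_mul b

/-- The second moment of the mean of pairwise independent centered variables. -/
theorem integral_sq_avg_le [IsProbabilityMeasure μ] {X : ℕ → Ω → ℝ}
    (hX : ∀ t, MemLp (X t) 2 μ) (h0 : ∀ t, ∫ ω, X t ω ∂μ = 0)
    (hindep : Pairwise fun s t => X s ⟂ᵢ[μ] X t) {T : ℕ} {b : ℝ}
    (hb : (T : ℝ)⁻¹ * ∑ t : Fin T, ∫ ω, X t ω ^ 2 ∂μ ≤ b) :
    ∫ ω, ((T : ℝ)⁻¹ * ∑ t : Fin T, X t ω) ^ 2 ∂μ ≤ (T : ℝ)⁻¹ * b := by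
  have hvar := IndepFun.variance_sum (X := fun t : Fin T => X t) (s := Finset.univ) (μ := μ)
    (fun t _ => hX t) fun s _ t _ hst => hindep (Fin.val_ne_of_ne hst)
  have hmem : MemLp (fun ω => ∑ t : Fin T, X t ω) 2 μ := memLp_finsetSum _ fun t _ => hX t
  have e : (∑ t : Fin T, X t) = fun ω => ∑ t : Fin T, X t ω := by ext ω; simp
  rw [e, variance_of_integral_eq_zero hmem.aestronglyMeasurable.aemeasurable (by
    rw [integral_finsetSum _ fun (t : Fin T) _ => (hX t).integrable one_le_two]
    exact Finset.sum_eq_zero fun t _ => h0 t)] at hvar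
  simp only [mul_pow, integral_const_mul, hvar]
  rw [sq, mul_assoc]
  refine mul_le_mul_of_nonneg_left (le_trans (le_of_eq ?_) hb) (by positivity)
  congr 1
  exact Finset.sum_congr rfl fun t _ =>
    variance_of_integral_eq_zero (hX t).aestronglyMeasurable.aemeasurable (h0 t)

end Moments

namespace AssumptionB

variable {Ω : Type*} [MeasurableSpace Ω] {μ : Measure Ω}
  {e : ℕ → ℕ → Ω → ℝ} {σsq : ℕ → ℝ} (hB : AssumptionB μ e σsq)
include hB

theorem integrable_sq_mul_sq (i j t : ℕ) : Integrable (fun ω => (e i t ω * e j t ω) ^ 2) μ := by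
  obtain ⟨K, hK⟩ := hB.fourth_moment
  refine ((hK i t).1.add (hK j t).1).mono'
    ((hB.measurable i t).mul (hB.measurable j t) |>.pow_const 2).aestronglyMeasurable
    (.of_forall fun ω => ?_)
  rw [Real.norm_of_nonneg (by positivity)]
  change _ ≤ e i t ω ^ 4 + e j t ω ^ 4
  nlinarith [sq_nonneg (e i t ω ^ 2 - e j t ω ^ 2), sq_nonneg (e i t ω ^ 2),
    sq_nonneg (e j t ω ^ 2)]

theorem memLp_mul (i j t : ℕ) : MemLp (fun ω => e i t ω * e j t ω) 2 μ :=
  (memLp_two_iff_integrable_sq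
    ((hB.measurable i t).mul (hB.measurable j t)).aestronglyMeasurable).2
    (hB.integrable_sq_mul_sq i j t)

theorem integral_sq (i t : ℕ) : ∫ ω, e i t ω ^ 2 ∂μ = σsq i := by
  have := hB.covariance i i t
  rw [if_pos rfl] at this
  simpa only [sq] using this

theorem exists_integral_sq_mul_sq_le :
    ∃ K : ℝ, 0 ≤ K ∧ ∀ i j t, ∫ ω, (e i t ω * e j t ω) ^ 2 ∂μ ≤ K := by
  obtain ⟨K, hK⟩ := hB.fourth_moment
  refine ⟨2 * K ^ 4, by positivity, fun i j t => ?_⟩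
  calc ∫ ω, (e i t ω * e j t ω) ^ 2 ∂μ ≤ ∫ ω, (e i t ω ^ 4 + e j t ω ^ 4) ∂μ := by
        refine integral_mono (hB.integrable_sq_mul_sq i j t) ((hK i t).1.add (hK j t).1)
          fun ω => ?_
        change (e i t ω * e j t ω) ^ 2 ≤ e i t ω ^ 4 + e j t ω ^ 4
        nlinarith [sq_nonneg (e i t ω ^ 2 - e j t ω ^ 2), sq_nonneg (e i t ω ^ 2),
          sq_nonneg (e j t ω ^ 2)]
    _ ≤ 2 * K ^ 4 := by
        rw [integral_add (hK i t).1 (hK j t).1]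
        linarith [(hK i t).2, (hK j t).2]

variable [IsProbabilityMeasure μ]

theorem memLp_two (i t : ℕ) : MemLp (e i t) 2 μ := by
  refine (memLp_two_iff_integrable_sq (hB.measurable i t).aestronglyMeasurable).2 ?_
  simpa only [sq] using (hB.memLp_mul i i t).integrable one_le_two

theorem integral_sq_mean_le (i T : ℕ) {c : ℝ} (hc : σsq i ≤ c) (hc0 : 0 ≤ c) :
    ∫ ω, ((T : ℝ)⁻¹ * ∑ t : Fin T, e i t ω) ^ 2 ∂μ ≤ (T : ℝ)⁻¹ * c := by
  refine integral_sq_avg_le (hB.memLp_two i) (hB.mean_zero i) (fun s t hst => ?_) ?_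
  · exact hB.indep.indepFun (i := (i, s)) (j := (i, t)) (by simpa using hst)
  · simp only [hB.integral_sq]
    calc (T : ℝ)⁻¹ * ∑ _t : Fin T, σsq i = ((T : ℝ)⁻¹ * T) * σsq i := by simp [mul_assoc]
      _ ≤ ((T : ℝ)⁻¹ * T) * c := mul_le_mul_of_nonneg_left hc (by positivity)
      _ ≤ 1 * c := mul_le_mul_of_nonneg_right inv_mul_le_one hc0
      _ = c := one_mul c

end AssumptionB

/-- The centered contribution of period `t` to the `(i, j)` entry of the sample moment matrix
around its expectation, for the common components `g`. -/
def momentNoise {Ω : Type*} (g : ℕ → ℕ → ℝ) (e : ℕ → ℕ → Ω → ℝ) (σsq : ℕ → ℝ) (i j t : ℕ)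
    (ω : Ω) : ℝ :=
  g i t * e j t ω + g j t * e i t ω + (e i t ω * e j t ω - if i = j then σsq i else 0)

namespace AssumptionB

variable {Ω : Type*} [MeasurableSpace Ω] {μ : Measure Ω}
  {e : ℕ → ℕ → Ω → ℝ} {σsq : ℕ → ℝ} (hB : AssumptionB μ e σsq) (g : ℕ → ℕ → ℝ)
include hB

theorem indepFun_momentNoise (i j : ℕ) :
    Pairwise fun s t => momentNoise g e σsq i j s ⟂ᵢ[μ] momentNoise g e σsq i j t := by
  intro s t hst
  have h := hB.indep.indepFun_prodMk_prodMk (fun p => hB.measurable p.1 p.2)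
    (i, s) (j, s) (i, t) (j, t) (by simp [hst]) (by simp [hst]) (by simp [hst]) (by simp [hst])
  exact h.comp (φ := fun p : ℝ × ℝ => g i s * p.2 + g j s * p.1 +
      (p.1 * p.2 - if i = j then σsq i else 0))
    (ψ := fun p : ℝ × ℝ => g i t * p.2 + g j t * p.1 +
      (p.1 * p.2 - if i = j then σsq i else 0)) (by fun_prop) (by fun_prop)

variable [IsProbabilityMeasure μ]

theorem memLp_momentNoise (i j t : ℕ) : MemLp (momentNoise g e σsq i j t) 2 μ :=
  (((hB.memLp_two j t).const_mul (g i t)).add ((hB.memLp_two i t).const_mul (g j t))).add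
    ((hB.memLp_mul i j t).sub (memLp_const _))

theorem integral_momentNoise (i j t : ℕ) : ∫ ω, momentNoise g e σsq i j t ω ∂μ = 0 := by
  have h1 : Integrable (fun ω => g i t * e j t ω) μ :=
    ((hB.memLp_two j t).const_mul (g i t)).integrable one_le_two
  have h2 : Integrable (fun ω => g j t * e i t ω) μ :=
    ((hB.memLp_two i t).const_mul (g j t)).integrable one_le_two
  have h3 := (hB.memLp_mul i j t).integrable one_le_two
  have h12 : Integrable (fun ω => g i t * e j t ω + g j t * e i t ω) μ := h1.add h2
  have h34 : Integrable (fun ω => e i t ω * e j t ω - if i = j then σsq i else 0) μ :=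
    h3.sub (integrable_const _)
  unfold momentNoise
  rw [integral_add h12 h34, integral_add h1 h2,
    integral_sub h3 (integrable_const _), integral_const_mul, integral_const_mul,
    hB.mean_zero, hB.mean_zero, hB.covariance]
  simp

theorem integral_sq_momentNoise_le {c K : ℝ} (hσ : ∀ i, |σsq i| ≤ c)
    (hK : ∀ i j t, ∫ ω, (e i t ω * e j t ω) ^ 2 ∂μ ≤ K) (i j t : ℕ) :
    ∫ ω, momentNoise g e σsq i j t ω ^ 2 ∂μ ≤
      4 * (c * g i t ^ 2 + c * g j t ^ 2 + K + c ^ 2) := by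
  have hi := (hB.memLp_two i t).integrable_sq
  have hj := (hB.memLp_two j t).integrable_sq
  have hij := hB.integrable_sq_mul_sq i j t
  have hj' : Integrable (fun ω => g i t ^ 2 * e j t ω ^ 2) μ := hj.const_mul _
  have hi' : Integrable (fun ω => g j t ^ 2 * e i t ω ^ 2) μ := hi.const_mul _
  have h1 : Integrable (fun ω => g i t ^ 2 * e j t ω ^ 2 + g j t ^ 2 * e i t ω ^ 2) μ :=
    hj'.add hi'
  have h2 : Integrable (fun ω => g i t ^ 2 * e j t ω ^ 2 + g j t ^ 2 * e i t ω ^ 2 +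
    (e i t ω * e j t ω) ^ 2) μ := h1.add hij
  have hd : (if i = j then σsq i else 0) ^ 2 ≤ c ^ 2 := by
    split_ifs
    · exact sq_le_sq.2 ((hσ i).trans (le_abs_self c))
    · nlinarith [sq_nonneg c]
  calc ∫ ω, momentNoise g e σsq i j t ω ^ 2 ∂μ
      ≤ ∫ ω, 4 * (g i t ^ 2 * e j t ω ^ 2 + g j t ^ 2 * e i t ω ^ 2 +
          (e i t ω * e j t ω) ^ 2 + c ^ 2) ∂μ := by
        refine integral_mono (hB.memLp_momentNoise g i j t).integrable_sq
          ((h2.add (integrable_const _)).const_mul 4) fun ω => ?_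
        change momentNoise g e σsq i j t ω ^ 2 ≤ 4 * (g i t ^ 2 * e j t ω ^ 2 +
          g j t ^ 2 * e i t ω ^ 2 + (e i t ω * e j t ω) ^ 2 + c ^ 2)
        unfold momentNoise
        set a := g i t * e j t ω with ha
        set b := g j t * e i t ω with hb
        set d := e i t ω * e j t ω with hd'
        set s := if i = j then σsq i else 0
        have e1 : g i t ^ 2 * e j t ω ^ 2 = a ^ 2 := by rw [ha]; ring
        have e2 : g j t ^ 2 * e i t ω ^ 2 = b ^ 2 := by rw [hb]; ring
        rw [e1, e2]
        nlinarith [sq_nonneg (a - b), sq_nonneg (a - d), sq_nonneg (a + s), sq_nonneg (b - d),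
          sq_nonneg (b + s), sq_nonneg (d + s)]
    _ = 4 * (g i t ^ 2 * σsq j + g j t ^ 2 * σsq i + ∫ ω, (e i t ω * e j t ω) ^ 2 ∂μ + c ^ 2) := by
        rw [integral_const_mul, integral_add h2 (integrable_const _), integral_add h1 hij,
          integral_add hj' hi', integral_const_mul, integral_const_mul, hB.integral_sq,
          hB.integral_sq]
        simp
    _ ≤ _ := by
        have h1 := mul_le_mul_of_nonneg_left ((le_abs_self _).trans (hσ j)) (sq_nonneg (g i t))
        have h2 := mul_le_mul_of_nonneg_left ((le_abs_self _).trans (hσ i)) (sq_nonneg (g j t))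
        have h3 := hK i j t
        linarith

theorem integral_sq_avg_momentNoise_le {c K G : ℝ} (hc : 0 ≤ c) (hσ : ∀ i, |σsq i| ≤ c)
    (hK0 : 0 ≤ K) (hK : ∀ i j t, ∫ ω, (e i t ω * e j t ω) ^ 2 ∂μ ≤ K) {T : ℕ} {i j : ℕ}
    (hi : (T : ℝ)⁻¹ * ∑ t : Fin T, g i t ^ 2 ≤ G) (hj : (T : ℝ)⁻¹ * ∑ t : Fin T, g j t ^ 2 ≤ G) :
    ∫ ω, ((T : ℝ)⁻¹ * ∑ t : Fin T, momentNoise g e σsq i j t ω) ^ 2 ∂μ ≤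
      (T : ℝ)⁻¹ * (4 * (c * G + c * G + K + c ^ 2)) := by
  refine integral_sq_avg_le (hB.memLp_momentNoise g i j) (hB.integral_momentNoise g i j)
    (hB.indepFun_momentNoise g i j) ?_
  calc (T : ℝ)⁻¹ * ∑ t : Fin T, ∫ ω, momentNoise g e σsq i j t ω ^ 2 ∂μ
      ≤ (T : ℝ)⁻¹ * ∑ t : Fin T, 4 * (c * g i t ^ 2 + c * g j t ^ 2 + K + c ^ 2) :=
        mul_le_mul_of_nonneg_left (Finset.sum_le_sum fun t _ =>
          hB.integral_sq_momentNoise_le g hσ hK i j t) (by positivity)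
    _ = 4 * (c * ((T : ℝ)⁻¹ * ∑ t : Fin T, g i t ^ 2) + c * ((T : ℝ)⁻¹ * ∑ t : Fin T, g j t ^ 2) +
          ((T : ℝ)⁻¹ * T) * (K + c ^ 2)) := by
        simp only [← Finset.mul_sum, Finset.sum_add_distrib, Finset.sum_const, Finset.card_univ,
          Fintype.card_fin, nsmul_eq_mul]
        ring
    _ ≤ 4 * (c * G + c * G + 1 * (K + c ^ 2)) := by
        gcongr
        exact inv_mul_le_one
    _ = _ := by ring

end AssumptionB

section SampleMoments

variable {n T : ℕ}

theorem sampleMean_apply (x : Fin T → Fin n → ℝ) (i : Fin n) :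
    sampleMean x i = (T : ℝ)⁻¹ * ∑ t, x t i := by
  simp [sampleMean]

theorem sampleCov_apply (x : Fin T → Fin n → ℝ) (i j : Fin n) : sampleCov x i j =
    (T : ℝ)⁻¹ * ∑ t, (x t i - sampleMean x i) * (x t j - sampleMean x j) := by
  simp [sampleCov, Matrix.sum_apply, vecMulVec_apply]

theorem posSemidef_sampleCov (x : Fin T → Fin n → ℝ) : (sampleCov x).PosSemidef :=
  (posSemidef_sum _ fun t _ => posSemidef_vecMulVec_self_star (x t - sampleMean x)).smul
    (by positivity)

theorem sum_sub_sampleMean (x : Fin T → Fin n → ℝ) : ∑ t, (x t - sampleMean x) = 0 := by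
  rcases T.eq_zero_or_pos with rfl | hT
  · simp
  · have : (T : ℝ) ≠ 0 := by positivity
    simp only [Finset.sum_sub_distrib, Finset.sum_const, Finset.card_univ, Fintype.card_fin,
      sampleMean]
    rw [← Nat.cast_smul_eq_nsmul ℝ, smul_smul, mul_inv_cancel₀ this, one_smul, sub_self]

theorem mul_sampleCov_mul_apply {m : ℕ} (x : Fin T → Fin n → ℝ) (Λ : Matrix (Fin m) (Fin n) ℝ)
    (i j : Fin m) : (Λ * sampleCov x * Λᵀ) i j =
      (T : ℝ)⁻¹ * ∑ t, (Λ i ⬝ᵥ (x t - sampleMean x)) * (Λ j ⬝ᵥ (x t - sampleMean x)) := by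
  have h : ∀ d : Fin n → ℝ, Λ * vecMulVec d d * Λᵀ = vecMulVec (Λ *ᵥ d) (Λ *ᵥ d) := fun d => by
    rw [mul_vecMulVec, vecMulVec_mul, vecMul_transpose]
  rw [sampleCov, Matrix.mul_smul, Matrix.smul_mul, Matrix.mul_sum, Matrix.sum_mul,
    Matrix.smul_apply, Matrix.sum_apply, smul_eq_mul]
  simp only [h, vecMulVec_apply]
  rfl

theorem avg_sq_dotProduct_le {c : ℝ} {v : Fin n → ℝ} (hv : ∑ k, v k ^ 2 ≤ c)
    (x : Fin T → Fin n → ℝ) : (T : ℝ)⁻¹ * ∑ t, (v ⬝ᵥ (x t - sampleMean x)) ^ 2 ≤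
      c * (sampleCov x).trace := by
  have e : (sampleCov x).trace =
      (T : ℝ)⁻¹ * ∑ t, ∑ k, (x t - sampleMean x) k ^ 2 := by
    simp only [trace, diag_apply, sampleCov_apply, ← Finset.mul_sum]
    rw [Finset.sum_comm]
    congr 1
    exact Finset.sum_congr rfl fun t _ => Finset.sum_congr rfl fun k _ => (sq _).symm
  rw [e, mul_left_comm]
  refine mul_le_mul_of_nonneg_left ?_ (by positivity)
  rw [Finset.mul_sum]
  refine Finset.sum_le_sum fun t _ => (Finset.sum_mul_sq_le_sq_mul_sq _ _ _).trans ?_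
  exact mul_le_mul_of_nonneg_right hv (Finset.sum_nonneg fun k _ => sq_nonneg _)

theorem avg_mul_centered_add (hT : 0 < T) {a b : Fin T → ℝ} (u v : Fin T → ℝ)
    (ha : ∑ t, a t = 0) (hb : ∑ t, b t = 0) :
    (T : ℝ)⁻¹ * ∑ t, (a t + (u t - (T : ℝ)⁻¹ * ∑ s, u s)) * (b t + (v t - (T : ℝ)⁻¹ * ∑ s, v s)) =
      (T : ℝ)⁻¹ * ∑ t, a t * b t + (T : ℝ)⁻¹ * ∑ t, (a t * v t + b t * u t + u t * v t) -
        ((T : ℝ)⁻¹ * ∑ s, u s) * ((T : ℝ)⁻¹ * ∑ s, v s) := by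
  have hT' : (T : ℝ) ≠ 0 := by positivity
  set U := (T : ℝ)⁻¹ * ∑ s, u s with hU
  set V := (T : ℝ)⁻¹ * ∑ s, v s with hV
  have e : ∑ t, (a t + (u t - U)) * (b t + (v t - V)) =
      ∑ t, a t * b t + ∑ t, (a t * v t + b t * u t + u t * v t) - V * ∑ t, a t - U * ∑ t, b t -
        V * ∑ t, u t - U * ∑ t, v t + T * (U * V) := by
    simp only [Finset.mul_sum, ← Finset.sum_add_distrib, ← Finset.sum_sub_distrib]
    have : (T : ℝ) * (U * V) = ∑ _t : Fin T, U * V := by simp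
    rw [this, ← Finset.sum_add_distrib]
    exact Finset.sum_congr rfl fun t _ => by ring
  have eu : ∑ t, u t = T * U := by rw [hU, mul_inv_cancel_left₀ hT']
  have ev : ∑ t, v t = T * V := by rw [hV, mul_inv_cancel_left₀ hT']
  rw [e, ha, hb, eu, ev]
  field_simp
  ring

end SampleMoments

section Observation

variable {Ω : Type*} {r : ℕ} {α : ℕ → ℝ} {lam f : ℕ → ℕ → ℕ → Fin r → ℝ} {e : ℕ → ℕ → Ω → ℝ}
  {σsq : ℕ → ℝ}

/-- The centered common component `λ_i'(f_t - f̄)`. -/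
noncomputable def commonPart {r : ℕ} (lam f : ℕ → ℕ → ℕ → Fin r → ℝ) (N T i t : ℕ) : ℝ :=
  lam N T i ⬝ᵥ (f N T t - sampleMean fun t : Fin T => f N T t)

theorem sum_commonPart (N T i : ℕ) : ∑ t : Fin T, commonPart lam f N T i t = 0 := by
  simp only [commonPart]
  rw [← dotProduct_sum, sum_sub_sampleMean fun t : Fin T => f N T t, dotProduct_zero]

theorem observation_sub_sampleMean {N T : ℕ} (hT : 0 < T) (ω : Ω) (t : Fin T) (i : Fin N) :
    observation α lam f e N T ω t i - sampleMean (observation α lam f e N T ω) i =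
      commonPart lam f N T i t + (e i t ω - (T : ℝ)⁻¹ * ∑ s : Fin T, e i s ω) := by
  have hT' : (T : ℝ) ≠ 0 := by positivity
  have h1 : lam N T i ⬝ᵥ (sampleMean fun t : Fin T => f N T t) =
      (T : ℝ)⁻¹ * ∑ s : Fin T, lam N T i ⬝ᵥ f N T s := by
    rw [sampleMean, dotProduct_smul, dotProduct_sum, smul_eq_mul]
  have h2 : (T : ℝ)⁻¹ * ∑ _s : Fin T, α i = α i := by
    simp [inv_mul_cancel_left₀ hT']
  rw [sampleMean_apply]
  simp only [observation, commonPart, Finset.sum_add_distrib, dotProduct_sub, h1, mul_add, h2]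
  ring

theorem sampleCov_observation_sub_apply {N T : ℕ} (hT : 0 < T) (ω : Ω) (i j : Fin N) :
    (sampleCov (observation α lam f e N T ω) - (trueParam lam f σsq N T).sigmaZZ) i j =
      (T : ℝ)⁻¹ * ∑ t : Fin T, momentNoise (commonPart lam f N T) e σsq i j t ω -
        ((T : ℝ)⁻¹ * ∑ t : Fin T, e i t ω) * ((T : ℝ)⁻¹ * ∑ t : Fin T, e j t ω) := by
  have hT' : (T : ℝ) ≠ 0 := by positivity
  have h1 : (T : ℝ)⁻¹ * ∑ _t : Fin T, (if (i : ℕ) = j then σsq i else 0) =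
      (trueParam lam f σsq N T).sigmaEE i j := by
    simp only [FactorParam.sigmaEE, trueParam, diagonal_apply, Finset.sum_const, Finset.card_univ,
      Fintype.card_fin, nsmul_eq_mul, inv_mul_cancel_left₀ hT', Fin.ext_iff]
  have h2 : ((trueParam lam f σsq N T).loading * (trueParam lam f σsq N T).factorCov *
      (trueParam lam f σsq N T).loadingᵀ) i j =
        (T : ℝ)⁻¹ * ∑ t : Fin T, commonPart lam f N T i t * commonPart lam f N T j t :=
    mul_sampleCov_mul_apply (fun t : Fin T => f N T t) _ i j
  rw [Matrix.sub_apply, sampleCov_apply, FactorParam.sigmaZZ, Matrix.add_apply, h2, ← h1]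
  simp only [observation_sub_sampleMean hT]
  rw [avg_mul_centered_add hT (fun t : Fin T => e i t ω) (fun t : Fin T => e j t ω)
    (sum_commonPart N T i) (sum_commonPart N T j)]
  simp only [momentNoise, Finset.sum_add_distrib, Finset.sum_sub_distrib, mul_add, mul_sub]
  ring

end Observation

theorem FactorRegime.mono {ι : Type*} {r : ℕ} {l l' : Filter ι} {N : ι → ℕ} {c : ℝ}
    {θs : (x : ι) → FactorParam (N x) r} {S : (x : ι) → Matrix (Fin (N x)) (Fin (N x)) ℝ}
    {Mbar Q : Matrix (Fin r) (Fin r) ℝ} (H : FactorRegime l N c θs S Mbar Q) (h : l' ≤ l) :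
    FactorRegime l' N c θs S Mbar Q :=
  { H with
    tendsto_dim := H.tendsto_dim.mono_left h
    tendsto_factorCov := H.tendsto_factorCov.mono_left h
    tendsto_loadingCov := H.tendsto_loadingCov.mono_left h
    tendsto_sq := H.tendsto_sq.mono_left h
    tendsto_diag := H.tendsto_diag.mono_left h
    tendsto_row := fun k => (H.tendsto_row k).mono_left h }

section Regime

variable {Ω : Type*} [MeasurableSpace Ω] {μ : Measure Ω} [IsProbabilityMeasure μ] {r : ℕ}
  {C : ℝ} {α : ℕ → ℝ} {lam f : ℕ → ℕ → ℕ → Fin r → ℝ} {σsq : ℕ → ℝ} {e : ℕ → ℕ → Ω → ℝ}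
  {Mbar Q : Matrix (Fin r) (Fin r) ℝ}

theorem tendsto_inv_snd_mul (K : ℝ) :
    Tendsto (fun p : ℕ × ℕ => (p.2 : ℝ)⁻¹ * K) atTop (𝓝 0) := by
  have h : Tendsto (fun p : ℕ × ℕ => p.2) atTop atTop := by
    rw [← prod_atTop_atTop_eq]
    exact tendsto_snd
  simpa using (tendsto_inv_atTop_nhds_zero_nat.comp h).mul_const K

theorem AssumptionC.sum_sq_le (hC : AssumptionC C lam f σsq Q) (N T i : ℕ) :
    ∑ k, lam N T i k ^ 2 ≤ C ^ 2 :=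
  (Real.sqrt_le_left hC.const_pos.le).1 (hC.loading_bound N T i)

theorem AssumptionC.abs_idioVar_le (hC : AssumptionC C lam f σsq Q) (i : ℕ) : |σsq i| ≤ C ^ 2 := by
  have h := hC.idioVar_mem i
  have : 0 < C ^ 2 := pow_pos hC.const_pos 2
  rw [abs_of_nonneg ((inv_pos.2 this).le.trans h.1)]
  exact h.2

/-- The second moments of the averaged noise are of order `1 / T`. -/
theorem exists_integral_sq_noise_le (hA : AssumptionA f Mbar) (hB : AssumptionB μ e σsq)
    (hC : AssumptionC C lam f σsq Q) : ∃ K : ℝ, 0 ≤ K ∧ ∀ᶠ p : ℕ × ℕ in atTop, ∀ i j : ℕ,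
      ∫ ω, ((p.2 : ℝ)⁻¹ * ∑ t : Fin p.2,
        momentNoise (commonPart lam f p.1 p.2) e σsq i j t ω) ^ 2 ∂μ ≤ (p.2 : ℝ)⁻¹ * K := by
  obtain ⟨K, hK0, hK⟩ := hB.exists_integral_sq_mul_sq_le
  have htr : 0 ≤ Mbar.trace := hA.1.posSemidef.trace_nonneg
  refine ⟨4 * (C ^ 2 * (C ^ 2 * (Mbar.trace + 1)) + C ^ 2 * (C ^ 2 * (Mbar.trace + 1)) + K +
    (C ^ 2) ^ 2), by positivity, ?_⟩
  filter_upwards [hA.2.matrix_trace.eventually_le_const (lt_add_one _)] with p hp i j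
  have hg : ∀ i, (p.2 : ℝ)⁻¹ * ∑ t : Fin p.2, commonPart lam f p.1 p.2 i t ^ 2 ≤
      C ^ 2 * (Mbar.trace + 1) := fun i =>
    (avg_sq_dotProduct_le (hC.sum_sq_le p.1 p.2 i) fun t : Fin p.2 => f p.1 p.2 t).trans
      (mul_le_mul_of_nonneg_left hp (sq_nonneg C))
  exact hB.integral_sq_avg_momentNoise_le _ (sq_nonneg C) hC.abs_idioVar_le hK0 hK (hg i) (hg j)

theorem factorRegime_of_assumptions (hA : AssumptionA f Mbar) (hB : AssumptionB μ e σsq)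
    (hC : AssumptionC C lam f σsq Q) :
    FactorRegime (probFilter μ (atTop : Filter (ℕ × ℕ))) (fun x => x.1.1) (C ^ 2)
      (fun x => trueParam lam f σsq x.1.1 x.1.2)
      (fun x => sampleCov (observation α lam f e x.1.1 x.1.2 x.2)) Mbar Q := by
  have hfst := tendsto_fst_probFilter (μ := μ) (l := (atTop : Filter (ℕ × ℕ)))
  have hfst1 : Tendsto (fun p : ℕ × ℕ => p.1) atTop atTop := by
    rw [← prod_atTop_atTop_eq]
    exact tendsto_fst
  have hT : ∀ᶠ x : (ℕ × ℕ) × Ω in probFilter μ atTop, 0 < x.1.2 := by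
    have h : Tendsto (fun p : ℕ × ℕ => p.2) atTop atTop := by
      rw [← prod_atTop_atTop_eq]
      exact tendsto_snd
    exact (h.comp hfst).eventually_gt_atTop 0
  set Y : ℕ × ℕ → ℕ → ℕ → Ω → ℝ := fun p i j ω => (p.2 : ℝ)⁻¹ * ∑ t : Fin p.2,
    momentNoise (commonPart lam f p.1 p.2) e σsq i j t ω
  set m : ℕ × ℕ → ℕ → Ω → ℝ := fun p i ω => (p.2 : ℝ)⁻¹ * ∑ t : Fin p.2, e i t ω
  have hYint : ∀ p i j, Integrable (fun ω => Y p i j ω ^ 2) μ := fun p i j =>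
    ((memLp_finsetSum _ fun (t : Fin p.2) _ => hB.memLp_momentNoise _ i j t).const_mul
      _).integrable_sq
  have hmint : ∀ p i, Integrable (fun ω => m p i ω ^ 2) μ := fun p i =>
    ((memLp_finsetSum _ fun (t : Fin p.2) _ => hB.memLp_two i t).const_mul _).integrable_sq
  have hmle : ∀ p i, ∫ ω, m p i ω ^ 2 ∂μ ≤ (p.2 : ℝ)⁻¹ * C ^ 2 := fun p i =>
    hB.integral_sq_mean_le i p.2 ((le_abs_self _).trans (hC.abs_idioVar_le i)) (sq_nonneg C)
  obtain ⟨K, hK0, hK⟩ : ∃ K : ℝ, 0 ≤ K ∧ ∀ᶠ p : ℕ × ℕ in atTop, ∀ i j : ℕ,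
      ∫ ω, Y p i j ω ^ 2 ∂μ ≤ (p.2 : ℝ)⁻¹ * K := exists_integral_sq_noise_le hA hB hC
  have hW : ∀ x : (ℕ × ℕ) × Ω, 0 < x.1.2 → ∀ i j,
      (sampleCov (observation α lam f e x.1.1 x.1.2 x.2) -
        (trueParam lam f σsq x.1.1 x.1.2).sigmaZZ) i j =
          Y x.1 i j x.2 - m x.1 i x.2 * m x.1 j x.2 :=
    fun x hx i j => sampleCov_observation_sub_apply hx _ i j
  clear_value Y m
  have hb : ∀ p : ℕ × ℕ, 0 ≤ (p.2 : ℝ)⁻¹ * K := fun p => by positivity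
  have hmk : ∀ k, Tendsto (fun x : (ℕ × ℕ) × Ω => m x.1 k x.2 ^ 2) (probFilter μ atTop) (𝓝 0) :=
    fun k => tendsto_probFilter_of_integral_le (X := fun p ω => m p k ω ^ 2)
      (fun _ _ => sq_nonneg _) (.of_forall fun p => hmint p k) (.of_forall fun p => hmle p k)
      (tendsto_inv_snd_mul _)
  have hmavg : Tendsto (fun x : (ℕ × ℕ) × Ω => (x.1.1 : ℝ)⁻¹ *
      ∑ i : Fin x.1.1, m x.1 i x.2 ^ 2) (probFilter μ atTop) (𝓝 0) :=
    tendsto_probFilter_of_integral_le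
      (X := fun p ω => (p.1 : ℝ)⁻¹ * ∑ i : Fin p.1, m p i ω ^ 2)
      (fun _ _ => by positivity)
      (.of_forall fun p => (integrable_finsetSum _ fun (i : Fin p.1) _ => hmint p i).const_mul _)
      (.of_forall fun p => integral_avg_le (by positivity) (fun i => hmint p i)
        fun i => hmle p i) (tendsto_inv_snd_mul _)
  have hYavg : ∀ a b : ℕ → ℕ, Tendsto (fun x : (ℕ × ℕ) × Ω => (x.1.1 : ℝ)⁻¹ *
      ∑ i : Fin x.1.1, Y x.1 (a i) (b i) x.2 ^ 2) (probFilter μ atTop) (𝓝 0) := fun a b =>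
    tendsto_probFilter_of_integral_le
      (X := fun p ω => (p.1 : ℝ)⁻¹ * ∑ i : Fin p.1, Y p (a i) (b i) ω ^ 2)
      (fun _ _ => by positivity)
      (.of_forall fun p =>
        (integrable_finsetSum _ fun (i : Fin p.1) _ => hYint p (a i) (b i)).const_mul _)
      (hK.mono fun p hp => integral_avg_le (hb p) (fun i => hYint p _ _)
        fun i => hp (a i) (b i)) (tendsto_inv_snd_mul _)
  have hYY : Tendsto (fun x : (ℕ × ℕ) × Ω => (x.1.1 : ℝ)⁻¹ * ∑ i : Fin x.1.1,
      ((x.1.1 : ℝ)⁻¹ * ∑ j : Fin x.1.1, Y x.1 i j x.2 ^ 2)) (probFilter μ atTop) (𝓝 0) := by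
    have hi : ∀ (p : ℕ × ℕ) (i : Fin p.1), Integrable (fun ω =>
        (p.1 : ℝ)⁻¹ * ∑ j : Fin p.1, Y p i j ω ^ 2) μ := fun p i =>
      (integrable_finsetSum _ fun (j : Fin p.1) _ => hYint p i j).const_mul _
    exact tendsto_probFilter_of_integral_le
      (X := fun p ω => (p.1 : ℝ)⁻¹ * ∑ i : Fin p.1, ((p.1 : ℝ)⁻¹ * ∑ j : Fin p.1, Y p i j ω ^ 2))
      (fun _ _ => by positivity)
      (.of_forall fun p => (integrable_finsetSum _ fun (i : Fin p.1) _ => hi p i).const_mul _)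
      (hK.mono fun p hp => integral_avg_le (hb p) (fun i => hi p i)
        fun i => integral_avg_le (hb p) (fun j => hYint p _ _) fun j => hp i j)
      (tendsto_inv_snd_mul _)
  have hsub : ∀ u v : ℝ, (u - v) ^ 2 ≤ 2 * u ^ 2 + 2 * v ^ 2 := fun u v => by
    nlinarith [sq_nonneg (u + v)]
  refine
    { tendsto_dim := hfst1.comp hfst
      const_pos := pow_pos hC.const_pos 2
      loading_sq_le := fun x i k => (Finset.single_le_sum (f := fun k => lam x.1.1 x.1.2 i k ^ 2)
        (fun _ _ => sq_nonneg _) (Finset.mem_univ k)).trans (hC.sum_sq_le _ _ _)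
      idioVar_mem := fun x i => hC.idioVar_mem i
      factorCov_psd := fun x => posSemidef_sampleCov _
      posDef_factor := hA.1
      tendsto_factorCov := hA.2.comp hfst
      posDef_loading := hC.posDef
      tendsto_loadingCov := hC.tendsto.comp hfst
      moment_psd := fun x => posSemidef_sampleCov _
      tendsto_sq := ?_
      tendsto_diag := ?_
      tendsto_row := fun k => ?_ }
  · refine squeeze_zero' (.of_forall fun x => by positivity) ?_
      (by simpa using (hYY.const_mul 2).add ((hmavg.pow 2).const_mul 2))
    filter_upwards [hT] with x hx
    simp only [hW x hx]
    have e : ((x.1.1 : ℝ)⁻¹ * ∑ i : Fin x.1.1, m x.1 i x.2 ^ 2) ^ 2 = ((x.1.1 : ℝ) ^ 2)⁻¹ *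
        ∑ i : Fin x.1.1, ∑ j : Fin x.1.1, (m x.1 i x.2 * m x.1 j x.2) ^ 2 := by
      rw [mul_pow, inv_pow, sq (∑ i : Fin x.1.1, m x.1 i x.2 ^ 2), Finset.sum_mul_sum]
      simp only [mul_pow]
    rw [e, ← Finset.mul_sum, ← mul_assoc (x.1.1 : ℝ)⁻¹, ← mul_inv, ← sq]
    simp only [mul_left_comm (2 : ℝ), ← mul_add]
    refine mul_le_mul_of_nonneg_left ?_ (by positivity)
    simp only [Finset.mul_sum, ← Finset.sum_add_distrib]
    exact Finset.sum_le_sum fun i _ => Finset.sum_le_sum fun j _ =>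
      (hsub _ _).trans (mul_add _ _ _).ge
  · have hlim := (hYavg id id).sqrt.add hmavg
    rw [Real.sqrt_zero, zero_add] at hlim
    refine squeeze_zero' (.of_forall fun x => by positivity) ?_ hlim
    filter_upwards [hT] with x hx
    simp only [hW x hx]
    have h1 : (x.1.1 : ℝ)⁻¹ * ∑ i : Fin x.1.1, |Y x.1 i i x.2| ≤
        √((x.1.1 : ℝ)⁻¹ * ∑ i : Fin x.1.1, Y x.1 i i x.2 ^ 2) := by
      refine Real.le_sqrt_of_sq_le ?_
      have h := sq_sum_le_card_mul_sum_sq (s := (Finset.univ : Finset (Fin x.1.1)))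
        (f := fun i => |Y x.1 i i x.2|)
      simp only [sq_abs, Finset.card_univ, Fintype.card_fin] at h
      rw [mul_pow]
      calc (x.1.1 : ℝ)⁻¹ ^ 2 * (∑ i : Fin x.1.1, |Y x.1 i i x.2|) ^ 2
          ≤ (x.1.1 : ℝ)⁻¹ ^ 2 * (x.1.1 * ∑ i : Fin x.1.1, Y x.1 i i x.2 ^ 2) := by gcongr
        _ = ((x.1.1 : ℝ)⁻¹ * x.1.1) * ((x.1.1 : ℝ)⁻¹ * ∑ i : Fin x.1.1, Y x.1 i i x.2 ^ 2) := by
            ring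
        _ ≤ 1 * _ := mul_le_mul_of_nonneg_right inv_mul_le_one (by positivity)
        _ = _ := one_mul _
    refine le_trans ?_ (add_le_add_left h1 _)
    rw [← mul_add, ← Finset.sum_add_distrib]
    refine mul_le_mul_of_nonneg_left (Finset.sum_le_sum fun i _ => ?_) (by positivity)
    refine (abs_sub _ _).trans (le_of_eq ?_)
    rw [abs_mul_self, ← sq]
  · refine squeeze_zero' (.of_forall fun x => by positivity) ?_
      (by simpa using ((hYavg id fun _ => k).const_mul 2).add (((hmk k).mul hmavg).const_mul 2))
    filter_upwards [hT, (hfst1.comp hfst).eventually_gt_atTop k] with x hx hk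
    have hcol : ∀ i, ((sampleCov (observation α lam f e x.1.1 x.1.2 x.2) -
        (trueParam lam f σsq x.1.1 x.1.2).sigmaZZ) *ᵥ indexVec x.1.1 k) i =
          Y x.1 i k x.2 - m x.1 i x.2 * m x.1 k x.2 := fun i => by
      have hk' : indexVec x.1.1 k = Pi.single (⟨k, hk⟩ : Fin x.1.1) 1 := by
        ext j
        simp [indexVec, Pi.single_apply, Fin.ext_iff]
      rw [hk', mulVec_single_one, col_apply, hW x hx]
    simp only [hcol]
    rw [mul_left_comm (m x.1 k x.2 ^ 2), mul_left_comm (2 : ℝ), mul_left_comm (2 : ℝ), ← mul_add]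
    refine mul_le_mul_of_nonneg_left ?_ (by positivity)
    simp only [Finset.mul_sum, ← Finset.sum_add_distrib]
    refine Finset.sum_le_sum fun i _ => (hsub _ _).trans (le_of_eq ?_)
    rw [mul_pow (m x.1 i x.2), mul_comm (m x.1 k x.2 ^ 2)]

end Regime

theorem proposition5p1 {Ω : Type*} [MeasurableSpace Ω] (μ : Measure Ω) [IsProbabilityMeasure μ]
    {r : ℕ} (ic : IdentCond) (C : ℝ)
    (α : ℕ → ℝ) (lam f : ℕ → ℕ → ℕ → Fin r → ℝ) (σsq : ℕ → ℝ) (e : ℕ → ℕ → Ω → ℝ)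
    (Mbar Q : Matrix (Fin r) (Fin r) ℝ)
    (hA : AssumptionA f Mbar)
    (hB : AssumptionB μ e σsq)
    (hC : AssumptionC C lam f σsq Q)
    -- the true `M_ff` is asymptotically interior to the region in which it is estimated
    (hD : ∀ k l, |Mbar k l| < C)
    (hic : Identified ic lam f σsq Mbar Q)
    (θhat : (N T : ℕ) → Ω → FactorParam N r)
    -- with probability tending to one, `θhat` is an MLE, with the right column signs
    (hMLE : Tendsto (fun p : ℕ × ℕ => μ {ω |
        ¬ ((θhat p.1 p.2 ω).IsMLE C ic (sampleCov (observation α lam f e p.1 p.2 ω)) ∧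
          (θhat p.1 p.2 ω).SignsMatch ic (trueParam lam f σsq p.1 p.2))}) atTop (𝓝 0)) :
    TendstoInMeasure μ
        (fun (p : ℕ × ℕ) ω => (p.1 : ℝ)⁻¹ * ∑ i : Fin p.1, 1 / (θhat p.1 p.2 ω).idioVar i *
          ∑ k, ((θhat p.1 p.2 ω).loading i k - lam p.1 p.2 i k) ^ 2)
        atTop (fun _ => 0) ∧
      TendstoInMeasure μ
        (fun (p : ℕ × ℕ) ω => (p.1 : ℝ)⁻¹ * ∑ i : Fin p.1,
          ((θhat p.1 p.2 ω).idioVar i - σsq i) ^ 2)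
        atTop (fun _ => 0) ∧
      ∀ k l, TendstoInMeasure μ
        (fun (p : ℕ × ℕ) ω => (θhat p.1 p.2 ω).factorCov k l -
          sampleCov (fun t : Fin p.2 => f p.1 p.2 t) k l)
        atTop (fun _ => 0) := by
  have H := factorRegime_of_assumptions (α := α) hA hB hC
  have hfst := tendsto_fst_probFilter (μ := μ) (l := (atTop : Filter (ℕ × ℕ)))
  have hgood : ∀ᶠ x : (ℕ × ℕ) × Ω in probFilter μ atTop,
      (θhat x.1.1 x.1.2 x.2).IsMLE C ic (sampleCov (observation α lam f e x.1.1 x.1.2 x.2)) ∧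
        (θhat x.1.1 x.1.2 x.2).SignsMatch ic (trueParam lam f σsq x.1.1 x.1.2) :=
    eventually_probFilter.2 hMLE
  have htrue := hfst.eventually hic.1
  have hcons : ∀ g : Ultrafilter ((ℕ × ℕ) × Ω), (g : Filter ((ℕ × ℕ) × Ω)) ≤ probFilter μ atTop →
      (MeanSqClose (g : Filter ((ℕ × ℕ) × Ω)) (fun x => (θhat x.1.1 x.1.2 x.2).loading)
        (fun x => (trueParam lam f σsq x.1.1 x.1.2).loading) ∧
      Tendsto (fun x : (ℕ × ℕ) × Ω => (θhat x.1.1 x.1.2 x.2).factorCov) g (𝓝 Mbar)) ∧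
      Tendsto (fun x : (ℕ × ℕ) × Ω => (x.1.1 : ℝ)⁻¹ * ∑ i : Fin x.1.1,
        ((θhat x.1.1 x.1.2 x.2).idioVar i - σsq i) ^ 2) g (𝓝 0) := fun g hg => by
    have Hg := H.mono hg
    have hmle := (hgood.filter_mono hg).mono fun _ hx => hx.1
    have hsign := (hgood.filter_mono hg).mono fun _ hx => hx.2
    have htr := htrue.filter_mono hg
    refine ⟨?_, Hg.tendsto_idioVar (Hg.dominatesTruth hD hmle htr)⟩
    cases ic with
    | ic1 => exact Hg.consistent_ic1 hD hmle htr
    | ic2 => exact Hg.consistent_ic2 hD hmle htr hsign hic.2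
    | ic3 => exact Hg.consistent_ic3 hD hmle htr hsign hic.2
    | ic4 => exact Hg.consistent_ic4 hD hmle htr
    | ic5 =>
      obtain ⟨δ, hδ, hbd⟩ := hic.2
      refine Hg.consistent_ic5 hD hmle htr hsign hδ ?_
      filter_upwards [(hfst.eventually hbd).filter_mono hg] with x hx i k hik
      change δ ≤ |lam x.1.1 x.1.2 i k|
      rw [hik]
      exact hx k
  refine ⟨tendstoInMeasure_iff_tendsto_probFilter.2 ((tendsto_iff_ultrafilter _ _ _).2
    fun g hg => ?_), tendstoInMeasure_iff_tendsto_probFilter.2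
    ((tendsto_iff_ultrafilter _ _ _).2 fun g hg => (hcons g hg).2), fun k l =>
    tendstoInMeasure_iff_tendsto_probFilter.2 ((tendsto_iff_ultrafilter _ _ _).2
    fun g hg => ?_)⟩
  · have hC2 : 0 < C ^ 2 := pow_pos hC.const_pos 2
    have hsum := (tendsto_finsetSum Finset.univ fun k _ => (hcons g hg).1.1 k).const_mul (C ^ 2)
    rw [Finset.sum_const_zero, mul_zero] at hsum
    refine squeeze_zero' ?_ ?_ hsum
    · filter_upwards [hgood.filter_mono hg] with x hx
      refine mul_nonneg (by positivity) (Finset.sum_nonneg fun i _ => mul_nonneg ?_ (by positivity))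
      exact one_div_nonneg.2 ((inv_pos.2 hC2).le.trans (hx.1.1.idioVar_mem i).1)
    · filter_upwards [hgood.filter_mono hg] with x hx
      rw [← Finset.mul_sum, Finset.sum_comm, mul_left_comm]
      refine mul_le_mul_of_nonneg_left ?_ (by positivity)
      rw [Finset.mul_sum]
      refine Finset.sum_le_sum fun i _ => mul_le_mul_of_nonneg_right ?_ (by positivity)
      rw [one_div]
      exact inv_le_of_inv_le₀ hC2 (hx.1.1.idioVar_mem i).1
  · have h := (tendsto_matrix_iff.1 (hcons g hg).1.2 k l).sub
      (tendsto_matrix_iff.1 ((H.mono hg).tendsto_factorCov) k l)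
    rw [sub_self] at h
    exact h
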